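/- Let $d\ge 1$ be an integer, $1<p<2$, $1<q<\infty$, $\frac1p+\frac1{p'}=1$, and let $\mathbb K$ be $\mathbb R$ or $\mathbb C$. For a measure $\mu$ and a $\mu$-measurable function $f$ put $f^*(t)=\inf\{\tau>0:\mu\{x:|f(x)|>\tau\}\le t\}$. For $r,s\in(0,\infty)$ put $$\|f\|_{r,s}=\Big(\int_0^\infty\big(t^{1/r}f^*(t)\big)^s\,\frac{dt}{t}\Big)^{1/s}.$$ The Lorentz space $L^{r,s}(\mathbb R^d)$ (resp. $L^{r,s}(\mathbb T^d)$, $\mathbb T^d=[-\pi,\pi]^d$) consists of the classes of measurable functions with $\|f\|_{r,s}<\infty$ with respect to Lebesgue measure on $\mathbb R^d$ (resp. $\mathbb T^d$). The space $\ell^{r,s}(\mathbb Z^d)$ consists of the families $c=(c_m)_{m\in\mathbb Z^d}$ with $$\|c\|_{r,s}=\Big(\sum_{k=1}^\infty\big(k^{1/r-1/s}c_k^*\big)^s\Big)^{1/s}<\infty,$$ where $c_k^*=\inf\{\tau>0:\#\{m:|c_m|>\tau\}\le k-1\}$ is the nonincreasing rearrangement of $c$. A bounded linear operator $T:X\to Y$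 between (quasi-)normed spaces is called strictly singular if for every infinite-dimensional closed subspace $E\subset X$ and every $\varepsilon>0$ there is $x\in E$ with $\|x\|_X=1$ and $\|Tx\|_Y\le\varepsilon$. The source spaces below consist of $\mathbb K$-valued functions, the target spaces of complex-valued ones, and linearity is over $\mathbb K$. 1. The Fourier transform $\mathcal F:L^{p,q}(\mathbb R^d)\to L^{p',q}(\mathbb R^d)$, that is, the bounded linear operator with $\mathcal F f(x)=\int_{\mathbb R^d}f(t)e^{-i\langle x,t\rangle}\,dt$ for almost every $x$ whenever $f\in L^{p,q}(\mathbb R^d)$ is integrable, exists and is not strictly singular. 2. The discrete Fourier transform $\mathcal F:L^{p,q}(\mathbb T^d)\to\ell^{p',q}(\mathbb Z^d)$, $(\mathcal F f)(m)=\int_{\mathbb T^d}f(t)e^{-i\langle t,m\rangle}\,dt$, is well defined, linear and bounded, and is not strictly singular. -/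

import Mathlib

open MeasureTheory Filter Topology
open scoped ENNReal

noncomputable section

/-! ## Strict singularity between spaces with a (quasi-)norm -/

section Operators

variable {𝕜 X Y : Type*} [Field 𝕜] [AddCommGroup X] [Module 𝕜 X] [AddCommGroup Y] [Module 𝕜 Y]
  [Norm X] [Norm Y]

/-- The linear map `T` is bounded with respect to the (quasi-)norms of `X` and `Y`. -/
def IsBoundedOperator (T : X →ₗ[𝕜] Y) : Prop :=
  ∃ C : ℝ, ∀ x : X, ‖T x‖ ≤ C * ‖x‖

/-- The subspace `E` is (sequentially) closed for the topology of the (quasi-)norm of `X`. -/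
def IsClosedSubspace (E : Submodule 𝕜 X) : Prop :=
  ∀ (u : ℕ → X) (x : X), (∀ n, u n ∈ E) →
    Tendsto (fun n => ‖u n - x‖) atTop (𝓝 0) → x ∈ E

/-- `T` is strictly singular: on no infinite-dimensional closed subspace is it bounded below. -/
def StrictlySingular (T : X →ₗ[𝕜] Y) : Prop :=
  ∀ E : Submodule 𝕜 X, ¬ FiniteDimensional 𝕜 E → IsClosedSubspace E →
    ∀ ε : ℝ, 0 < ε → ∃ x ∈ E, ‖x‖ = 1 ∧ ‖T x‖ ≤ ε

end Operators

/-! ## Lorentz spaces of functions -/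

section LorentzFunctions

variable {α F : Type*} [MeasurableSpace α] [NormedAddCommGroup F]

/-- The nonincreasing rearrangement
`f^*(t) = inf {τ : μ {x : |f x| > τ} ≤ t}`. -/
def rearrangement (μ : Measure α) (f : α → F) (t : ℝ≥0∞) : ℝ≥0∞ :=
  sInf {τ : ℝ≥0∞ | μ {x | τ < ‖f x‖ₑ} ≤ t}

/-- The Lorentz (quasi-)norm `(∫₀^∞ (t^{1/r} f^*(t))^s dt/t)^{1/s}`, with values in `[0, ∞]`. -/
def eLorentzNorm (μ : Measure α) (r s : ℝ) (f : α → F) : ℝ≥0∞ :=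
  (∫⁻ t in Set.Ioi (0 : ℝ),
    (ENNReal.ofReal t ^ (1 / r) * rearrangement μ f (ENNReal.ofReal t)) ^ s
      * (ENNReal.ofReal t)⁻¹) ^ (1 / s)

theorem rearrangement_antitone (μ : Measure α) (f : α → F) : Antitone (rearrangement μ f) :=
  fun _ _ h => sInf_le_sInf fun _ hτ => le_trans hτ h

theorem rearrangement_congr_ae {μ : Measure α} {f g : α → F} (h : f =ᵐ[μ] g) :
    rearrangement μ f = rearrangement μ g := by
  funext t
  have : ∀ τ : ℝ≥0∞, μ {x | τ < ‖f x‖ₑ} = μ {x | τ < ‖g x‖ₑ} := fun τ => by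
    apply measure_congr
    filter_upwards [h] with x hx
    change (τ < ‖f x‖ₑ) = (τ < ‖g x‖ₑ)
    rw [hx]
  simp only [rearrangement, this]

theorem rearrangement_add_le (μ : Measure α) (f g : α → F) (t u : ℝ≥0∞) :
    rearrangement μ (f + g) (t + u) ≤ rearrangement μ f t + rearrangement μ g u := by
  unfold rearrangement
  rw [ENNReal.sInf_add]
  refine le_iInf₂ fun τ hτ => ?_
  rw [add_comm τ, ENNReal.sInf_add]
  refine le_iInf₂ fun σ hσ => sInf_le ?_
  refine le_trans (le_trans (measure_mono ?_) (measure_union_le _ _)) (add_le_add hτ hσ)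
  intro x hx
  by_contra hcon
  simp only [Set.mem_union, Set.mem_ofPred_eq, not_or, not_lt] at hcon hx
  refine absurd (lt_of_lt_of_le hx (enorm_add_le (f x) (g x))) (not_lt.2 ?_)
  rw [add_comm σ τ]
  exact add_le_add hcon.1 hcon.2

theorem rearrangement_zero (μ : Measure α) (t : ℝ≥0∞) :
    rearrangement μ (0 : α → F) t = 0 := by
  have : rearrangement μ (0 : α → F) t ≤ 0 := sInf_le (by simp)
  simpa using this

theorem rearrangement_smul_le {𝕜 : Type*} [NormedField 𝕜] [NormedSpace 𝕜 F] (μ : Measure α)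
    (c : 𝕜) (f : α → F) (t : ℝ≥0∞) :
    rearrangement μ (c • f) t ≤ ‖c‖ₑ * rearrangement μ f t := by
  by_cases hc : c = 0
  · subst hc
    rw [zero_smul, rearrangement_zero]
    simp
  have h0 : ‖c‖ₑ ≠ 0 := by simpa using hc
  have h1 : ‖c‖ₑ ≠ ∞ := by simp
  rw [← ENNReal.div_le_iff' h0 h1]
  refine le_sInf fun τ hτ => ?_
  rw [ENNReal.div_le_iff' h0 h1]
  refine sInf_le (le_trans (measure_mono ?_) hτ)
  intro x hx
  simp only [Set.mem_ofPred_eq, Pi.smul_apply, enorm_smul] at hx ⊢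
  by_contra hcon
  exact absurd hx (not_lt.2 (mul_le_mul_right (not_lt.1 hcon) _))

theorem rpow_add_le_two (s : ℝ) (hs : 0 < s) (a b : ℝ≥0∞) :
    (a + b) ^ s ≤ 2 ^ s * (a ^ s + b ^ s) := by
  have h : a + b ≤ 2 * max a b := by
    rw [two_mul]
    exact add_le_add (le_max_left _ _) (le_max_right _ _)
  refine (ENNReal.rpow_le_rpow h hs.le).trans ?_
  rw [ENNReal.mul_rpow_of_nonneg _ _ hs.le]
  gcongr
  rcases le_total a b with hab | hab
  · rw [max_eq_right hab]
    exact le_add_self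
  · rw [max_eq_left hab]
    exact le_self_add

theorem eLorentzNorm_lt_top_iff {μ : Measure α} {r s : ℝ} (hs : 0 < s) {f : α → F} :
    eLorentzNorm μ r s f < ∞ ↔ (∫⁻ t in Set.Ioi (0 : ℝ),
      (ENNReal.ofReal t ^ (1 / r) * rearrangement μ f (ENNReal.ofReal t)) ^ s
        * (ENNReal.ofReal t)⁻¹) < ∞ :=
  ENNReal.rpow_lt_top_iff_of_pos (by positivity)

theorem eLorentzNorm_congr_ae {μ : Measure α} {r s : ℝ} {f g : α → F} (h : f =ᵐ[μ] g) :
    eLorentzNorm μ r s f = eLorentzNorm μ r s g := by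
  simp only [eLorentzNorm, rearrangement_congr_ae h]

theorem lintegral_Ioi_half (A : ℝ → ℝ≥0∞) (hA : Measurable A) :
    ∫⁻ t in Set.Ioi (0 : ℝ), A (2⁻¹ * t) = 2 * ∫⁻ t in Set.Ioi (0 : ℝ), A t := by
  have h := setLIntegral_map (μ := (volume : Measure ℝ)) (s := Set.Ioi (0 : ℝ))
    (g := fun t : ℝ => 2⁻¹ * t) measurableSet_Ioi hA (by fun_prop)
  rw [Real.map_volume_mul_left (by norm_num)] at h
  have hpre : (fun t : ℝ => 2⁻¹ * t) ⁻¹' Set.Ioi 0 = Set.Ioi 0 := by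
    ext t
    simp
  rw [hpre] at h
  rw [← h, Measure.restrict_smul, lintegral_smul_measure]
  simp

theorem eLorentzNorm_add_lt_top {μ : Measure α} {r s : ℝ} (hs : 0 < s) {f g : α → F}
    (hf : eLorentzNorm μ r s f < ∞) (hg : eLorentzNorm μ r s g < ∞) :
    eLorentzNorm μ r s (f + g) < ∞ := by
  rw [eLorentzNorm_lt_top_iff hs] at hf hg ⊢
  set A : (α → F) → ℝ → ℝ≥0∞ := fun f t =>
    (ENNReal.ofReal t ^ (1 / r) * rearrangement μ f (ENNReal.ofReal t)) ^ s
      * (ENNReal.ofReal t)⁻¹ with hAdef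
  have hA : ∀ f, Measurable (A f) := fun f => by
    have : Measurable (rearrangement μ f) := (rearrangement_antitone μ f).measurable
    fun_prop
  set C : ℝ≥0∞ := (2 ^ (1 / r)) ^ s * 2 ^ s with hC
  have hCtop : C ≠ ∞ := by
    refine ENNReal.mul_ne_top (ENNReal.rpow_ne_top_of_nonneg hs.le ?_)
      (ENNReal.rpow_ne_top_of_nonneg hs.le (by simp))
    exact ENNReal.rpow_ne_top_of_ne_zero (by simp) (by simp)
  have key : ∀ t ∈ Set.Ioi (0 : ℝ),
      A (f + g) t ≤ C * (A f (2⁻¹ * t) + A g (2⁻¹ * t)) := by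
    intro t ht
    have ht' : (0 : ℝ) < 2⁻¹ * t := by
      have : (0 : ℝ) < t := ht
      positivity
    set u := ENNReal.ofReal (2⁻¹ * t) with hu
    have htu : ENNReal.ofReal t = 2 * u := by
      rw [hu, ENNReal.ofReal_mul (by norm_num), ← mul_assoc]
      rw [ENNReal.ofReal_inv_of_pos (by norm_num)]
      simp [ENNReal.mul_inv_cancel]
    have hadd : rearrangement μ (f + g) (2 * u) ≤ rearrangement μ f u + rearrangement μ g u := by
      rw [two_mul]
      exact rearrangement_add_le μ f g u u
    have hinv : (2 * u)⁻¹ ≤ u⁻¹ := by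
      rw [ENNReal.inv_le_inv, two_mul]
      exact le_self_add
    calc A (f + g) t
        = ((2 * u) ^ (1 / r) * rearrangement μ (f + g) (2 * u)) ^ s * (2 * u)⁻¹ := by
          simp only [hAdef, htu]
      _ ≤ ((2 * u) ^ (1 / r) * (rearrangement μ f u + rearrangement μ g u)) ^ s * u⁻¹ := by
          gcongr
      _ = (2 ^ (1 / r) * (u ^ (1 / r) * rearrangement μ f u
            + u ^ (1 / r) * rearrangement μ g u)) ^ s * u⁻¹ := by
          rw [ENNReal.mul_rpow_of_ne_top (x := 2) (y := u) (by simp) ENNReal.ofReal_ne_top,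
            mul_assoc, mul_add]
      _ = (2 ^ (1 / r)) ^ s * (u ^ (1 / r) * rearrangement μ f u
            + u ^ (1 / r) * rearrangement μ g u) ^ s * u⁻¹ := by
          rw [ENNReal.mul_rpow_of_nonneg _ _ hs.le]
      _ ≤ (2 ^ (1 / r)) ^ s * (2 ^ s * ((u ^ (1 / r) * rearrangement μ f u) ^ s
            + (u ^ (1 / r) * rearrangement μ g u) ^ s)) * u⁻¹ := by
          gcongr
          exact rpow_add_le_two s hs _ _
      _ = C * (A f (2⁻¹ * t) + A g (2⁻¹ * t)) := by
          simp only [hAdef, hC, ← hu]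
          ring
  refine lt_of_le_of_lt (setLIntegral_mono' measurableSet_Ioi key) ?_
  have hm : ∀ f, Measurable fun t : ℝ => A f (2⁻¹ * t) := fun f =>
    (hA f).comp (measurable_const_mul _)
  rw [lintegral_const_mul' _ _ hCtop, lintegral_add_left (hm f),
    lintegral_Ioi_half _ (hA f), lintegral_Ioi_half _ (hA g)]
  exact ENNReal.mul_lt_top hCtop.lt_top (ENNReal.add_lt_top.2
    ⟨ENNReal.mul_lt_top (by simp) hf, ENNReal.mul_lt_top (by simp) hg⟩)

theorem eLorentzNorm_smul_lt_top {𝕜 : Type*} [NormedField 𝕜] [NormedSpace 𝕜 F] {μ : Measure α}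
    {r s : ℝ} (hs : 0 < s) (c : 𝕜) {f : α → F} (hf : eLorentzNorm μ r s f < ∞) :
    eLorentzNorm μ r s (c • f) < ∞ := by
  rw [eLorentzNorm_lt_top_iff hs] at hf ⊢
  have hc : ‖c‖ₑ ^ s ≠ ∞ := ENNReal.rpow_ne_top_of_nonneg hs.le (by simp)
  refine lt_of_le_of_lt (lintegral_mono (g := fun t : ℝ => ‖c‖ₑ ^ s *
    ((ENNReal.ofReal t ^ (1 / r) * rearrangement μ f (ENNReal.ofReal t)) ^ s
      * (ENNReal.ofReal t)⁻¹)) fun t => ?_) ?_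
  · have h := rearrangement_smul_le μ c f (ENNReal.ofReal t)
    calc _ ≤ (ENNReal.ofReal t ^ (1 / r) * (‖c‖ₑ * rearrangement μ f (ENNReal.ofReal t))) ^ s
            * (ENNReal.ofReal t)⁻¹ := by gcongr
      _ = _ := by
        rw [mul_left_comm, ENNReal.mul_rpow_of_nonneg _ _ hs.le, mul_assoc]
  · rw [lintegral_const_mul' _ _ hc]
    exact ENNReal.mul_lt_top hc.lt_top hf

/-- The Lorentz space `L^{r,s}(μ)` of (classes of) `F`-valued measurable functions with finite
Lorentz (quasi-)norm, as a subspace of the space of all classes of measurable functions. Only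
indices `s > 0` are meaningful. -/
def lorentzSpace (𝕜 F : Type*) [NormedField 𝕜] [NormedAddCommGroup F] [NormedSpace 𝕜 F]
    (μ : Measure α) (r s : ℝ) : Submodule 𝕜 (α →ₘ[μ] F) where
  carrier := {f | 0 < s → eLorentzNorm μ r s f < ∞}
  zero_mem' := fun hs => by
    rw [eLorentzNorm_congr_ae AEEqFun.coeFn_zero]
    simp [eLorentzNorm, rearrangement_zero, hs]
  add_mem' := fun {f g} hf hg hs => by
    rw [eLorentzNorm_congr_ae (AEEqFun.coeFn_add f g)]
    exact eLorentzNorm_add_lt_top hs (hf hs) (hg hs)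
  smul_mem' := fun c f hf hs => by
    rw [eLorentzNorm_congr_ae (AEEqFun.coeFn_smul c f)]
    exact eLorentzNorm_smul_lt_top hs c (hf hs)

instance lorentzSpace.instNorm (𝕜 F : Type*) [NormedField 𝕜] [NormedAddCommGroup F]
    [NormedSpace 𝕜 F] (μ : Measure α) (r s : ℝ) : Norm (lorentzSpace 𝕜 F μ r s) :=
  ⟨fun f => (eLorentzNorm μ r s (f : α →ₘ[μ] F)).toReal⟩

end LorentzFunctions

/-! ## Lorentz sequence spaces -/

section LorentzSequences

variable {ι F : Type*} [MeasurableSpace ι] [NormedAddCommGroup F]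

/-- The Lorentz sequence (quasi-)norm `(∑_{k ≥ 1} (k^{1/r - 1/s} c_k^*)^s)^{1/s}`, with values in
`[0, ∞]`. Here `c_k^* = inf {τ : #{m : |c m| > τ} ≤ k - 1}`, and `k` is written `k + 1`. -/
def eLorentzSeqNorm (r s : ℝ) (c : ι → F) : ℝ≥0∞ :=
  (∑' k : ℕ, (((k : ℝ≥0∞) + 1) ^ (1 / r - 1 / s) * rearrangement Measure.count c k) ^ s) ^ (1 / s)

theorem eLorentzSeqNorm_lt_top_iff {r s : ℝ} (hs : 0 < s) {c : ι → F} :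
    eLorentzSeqNorm r s c < ∞ ↔ (∑' k : ℕ, (((k : ℝ≥0∞) + 1) ^ (1 / r - 1 / s)
      * rearrangement Measure.count c k) ^ s) < ∞ :=
  ENNReal.rpow_lt_top_iff_of_pos (by positivity)

theorem tsum_half (a : ℕ → ℝ≥0∞) : ∑' n : ℕ, a (n / 2) = 2 * ∑' k : ℕ, a k := by
  have h := tsum_even_add_odd (f := fun n => a (n / 2)) ENNReal.summable ENNReal.summable
  rw [← h, two_mul]
  congr 1
  · exact tsum_congr fun k => by congr 1; omega
  · exact tsum_congr fun k => by congr 1; omega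

theorem rpow_half_le (e : ℝ) : ∃ C : ℝ≥0∞, C ≠ ∞ ∧ ∀ n : ℕ,
    ((n : ℝ≥0∞) + 1) ^ e ≤ C * (((n / 2 : ℕ) : ℝ≥0∞) + 1) ^ e := by
  have h1 : ∀ n : ℕ, ((n : ℝ≥0∞) + 1) ≤ 2 * (((n / 2 : ℕ) : ℝ≥0∞) + 1) := fun n => by
    have : n + 1 ≤ 2 * (n / 2 + 1) := by omega
    exact_mod_cast this
  have h2 : ∀ n : ℕ, (((n / 2 : ℕ) : ℝ≥0∞) + 1) ≤ (n : ℝ≥0∞) + 1 := fun n => by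
    have : n / 2 + 1 ≤ n + 1 := by omega
    exact_mod_cast this
  rcases le_total 0 e with he | he
  · refine ⟨2 ^ e, ENNReal.rpow_ne_top_of_nonneg he (by simp), fun n => ?_⟩
    rw [← ENNReal.mul_rpow_of_nonneg _ _ he]
    exact ENNReal.rpow_le_rpow (h1 n) he
  · refine ⟨1, by simp, fun n => ?_⟩
    rw [one_mul]
    have h3 := ENNReal.rpow_le_rpow (h2 n) (neg_nonneg.2 he)
    rw [ENNReal.rpow_neg, ENNReal.rpow_neg] at h3
    exact ENNReal.inv_le_inv.1 h3

theorem eLorentzSeqNorm_add_lt_top {r s : ℝ} (hs : 0 < s) {b c : ι → F}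
    (hb : eLorentzSeqNorm r s b < ∞) (hc : eLorentzSeqNorm r s c < ∞) :
    eLorentzSeqNorm r s (b + c) < ∞ := by
  rw [eLorentzSeqNorm_lt_top_iff hs] at hb hc ⊢
  obtain ⟨C, hC, hle⟩ := rpow_half_le (1 / r - 1 / s)
  set A : (ι → F) → ℕ → ℝ≥0∞ := fun c k => (((k : ℝ≥0∞) + 1) ^ (1 / r - 1 / s)
      * rearrangement Measure.count c k) ^ s with hA
  have hD : C ^ s * 2 ^ s ≠ ∞ := ENNReal.mul_ne_top
    (ENNReal.rpow_ne_top_of_nonneg hs.le hC) (ENNReal.rpow_ne_top_of_nonneg hs.le (by simp))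
  have key : ∀ n : ℕ, A (b + c) n ≤ C ^ s * 2 ^ s * (A b (n / 2) + A c (n / 2)) := by
    intro n
    have hadd : rearrangement Measure.count (b + c) (n : ℝ≥0∞)
        ≤ rearrangement Measure.count b ((n / 2 : ℕ) : ℝ≥0∞)
          + rearrangement Measure.count c ((n / 2 : ℕ) : ℝ≥0∞) := by
      refine le_trans (rearrangement_antitone _ _ ?_) (rearrangement_add_le _ b c _ _)
      have : n / 2 + n / 2 ≤ n := by omega
      exact_mod_cast this
    calc A (b + c) n
        ≤ (C * (((n / 2 : ℕ) : ℝ≥0∞) + 1) ^ (1 / r - 1 / s)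
            * (rearrangement Measure.count b ((n / 2 : ℕ) : ℝ≥0∞)
              + rearrangement Measure.count c ((n / 2 : ℕ) : ℝ≥0∞))) ^ s :=
          ENNReal.rpow_le_rpow (mul_le_mul' (hle n) hadd) hs.le
      _ ≤ _ := by
          rw [mul_assoc, ENNReal.mul_rpow_of_nonneg _ _ hs.le, mul_add, mul_assoc (C ^ s)]
          exact mul_le_mul_right (rpow_add_le_two s hs _ _) _
  refine lt_of_le_of_lt (ENNReal.tsum_le_tsum key) ?_
  rw [ENNReal.tsum_mul_left, ENNReal.tsum_add, tsum_half, tsum_half]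
  exact ENNReal.mul_lt_top hD.lt_top (ENNReal.add_lt_top.2
    ⟨ENNReal.mul_lt_top (by simp) hb, ENNReal.mul_lt_top (by simp) hc⟩)

theorem eLorentzSeqNorm_smul_lt_top {𝕜 : Type*} [NormedField 𝕜] [NormedSpace 𝕜 F]
    {r s : ℝ} (hs : 0 < s) (a : 𝕜) {c : ι → F} (hc : eLorentzSeqNorm r s c < ∞) :
    eLorentzSeqNorm r s (a • c) < ∞ := by
  rw [eLorentzSeqNorm_lt_top_iff hs] at hc ⊢
  have ha : ‖a‖ₑ ^ s ≠ ∞ := ENNReal.rpow_ne_top_of_nonneg hs.le (by simp)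
  refine lt_of_le_of_lt (ENNReal.tsum_le_tsum (g := fun k : ℕ => ‖a‖ₑ ^ s *
    ((((k : ℝ≥0∞) + 1) ^ (1 / r - 1 / s) * rearrangement Measure.count c k) ^ s))
    fun k => ?_) ?_
  · rw [← ENNReal.mul_rpow_of_nonneg _ _ hs.le, mul_left_comm]
    exact ENNReal.rpow_le_rpow (mul_le_mul_right (rearrangement_smul_le _ a c _) _) hs.le
  · rw [ENNReal.tsum_mul_left]
    exact ENNReal.mul_lt_top ha.lt_top hc

/-- The Lorentz sequence space `ℓ^{r,s}(ι)` of `F`-valued families with finite Lorentz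
(quasi-)norm. Only indices `s > 0` are meaningful. -/
def lorentzSeqSpace (𝕜 ι F : Type*) [MeasurableSpace ι] [NormedField 𝕜] [NormedAddCommGroup F]
    [NormedSpace 𝕜 F] (r s : ℝ) : Submodule 𝕜 (ι → F) where
  carrier := {c | 0 < s → eLorentzSeqNorm r s c < ∞}
  zero_mem' := fun hs => by
    simp [eLorentzSeqNorm, rearrangement_zero, hs]
  add_mem' := fun hb hc hs => eLorentzSeqNorm_add_lt_top hs (hb hs) (hc hs)
  smul_mem' := fun a _ hc hs => eLorentzSeqNorm_smul_lt_top hs a (hc hs)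

instance lorentzSeqSpace.instNorm (𝕜 ι F : Type*) [MeasurableSpace ι] [NormedField 𝕜]
    [NormedAddCommGroup F] [NormedSpace 𝕜 F] (r s : ℝ) : Norm (lorentzSeqSpace 𝕜 ι F r s) :=
  ⟨fun c => (eLorentzSeqNorm r s (c : ι → F)).toReal⟩

end LorentzSequences

/-! ## The Fourier transforms -/

section Fourier

variable {𝕜 : Type*} [RCLike 𝕜] [NormedAlgebra 𝕜 ℂ] {d : ℕ} {r s r' s' : ℝ}

/-- `T : L^{r,s}(ℝ^d) → L^{r',s'}(ℝ^d)` is the Fourier transform: the bounded linear operator which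
on integrable functions is `f ↦ (x ↦ ∫ f(t) e^{-i⟨x,t⟩} dt)`. The functions in the domain take
values in `𝕜`, which is `ℝ` or `ℂ`; those in the target take values in `ℂ`. -/
def IsFourierTransform
    (T : lorentzSpace 𝕜 𝕜 (volume : Measure (EuclideanSpace ℝ (Fin d))) r s →ₗ[𝕜]
      lorentzSpace 𝕜 ℂ (volume : Measure (EuclideanSpace ℝ (Fin d))) r' s') : Prop :=
  IsBoundedOperator T ∧
    ∀ f : lorentzSpace 𝕜 𝕜 (volume : Measure (EuclideanSpace ℝ (Fin d))) r s,
      Integrable (f : EuclideanSpace ℝ (Fin d) →ₘ[volume] 𝕜) volume →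
      ∀ᵐ x, (T f : EuclideanSpace ℝ (Fin d) →ₘ[volume] ℂ) x =
        ∫ t, (f : EuclideanSpace ℝ (Fin d) →ₘ[volume] 𝕜) t •
          Complex.exp (-(Complex.I * (inner ℝ x t : ℝ)))

/-- Lebesgue measure on the torus `𝕋^d = [-π, π]^d`. -/
def torusMeasure (d : ℕ) : Measure (EuclideanSpace ℝ (Fin d)) :=
  volume.restrict {t | ∀ i, t i ∈ Set.Icc (-Real.pi) Real.pi}

/-- `T : L^{r,s}(𝕋^d) → ℓ^{r',s'}(ℤ^d)` is the discrete Fourier transform: the bounded linear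
operator `f ↦ (m ↦ ∫_{𝕋^d} f(t) e^{-i⟨t,m⟩} dt)`. -/
def IsDiscreteFourierTransform
    (T : lorentzSpace 𝕜 𝕜 (torusMeasure d) r s →ₗ[𝕜]
      lorentzSeqSpace 𝕜 (Fin d → ℤ) ℂ r' s') : Prop :=
  IsBoundedOperator T ∧
    ∀ (f : lorentzSpace 𝕜 𝕜 (torusMeasure d) r s) (m : Fin d → ℤ),
      (T f : (Fin d → ℤ) → ℂ) m =
        ∫ t, (f : EuclideanSpace ℝ (Fin d) →ₘ[torusMeasure d] 𝕜) t •
          Complex.exp (-(Complex.I * ((∑ i, t i * (m i : ℝ) : ℝ) : ℂ))) ∂torusMeasure d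

end Fourier

end

/-!
Proof idea. The Fourier transform is bounded on `L^{p,q}` because it is bounded from `L¹` to `L^∞`
and from `L²` to `L²`: splitting `f` at every level gives real interpolation between the two.

For the failure of strict singularity take step functions `∑ aₙ 1_{Qₙ}` on a lacunary sequence of
dyadic cubes `Qₙ`. Their Lorentz norm is comparable to the `ℓ^q` norm of `|Qₙ|^{1/p} aₙ`. The
Fourier transform of `1_{Qₙ}` has modulus comparable to `|Qₙ|` on a box of frequencies of measure
`|Qₙ|⁻¹`, while the other cubes contribute to that box terms decaying geometrically in the distance
of the scales. If the scales are separated enough, these terms are absorbed, so that the Fourier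
transform is bounded below on an infinite-dimensional closed subspace.
-/

/-! ## Dyadic discretisation of the Lorentz norm -/

theorem two_rpow_add (x y : ℝ) : (2 : ℝ≥0∞) ^ (x + y) = 2 ^ x * 2 ^ y :=
  ENNReal.rpow_add x y (by simp) (by simp)

theorem two_rpow_ne_zero (x : ℝ) : (2 : ℝ≥0∞) ^ x ≠ 0 := by
  simp [ENNReal.rpow_eq_zero_iff]

theorem two_rpow_ne_top (x : ℝ) : (2 : ℝ≥0∞) ^ x ≠ ∞ :=
  ENNReal.rpow_ne_top_of_ne_zero (by simp) (by simp)

theorem two_rpow_le {x y : ℝ} (h : x ≤ y) : (2 : ℝ≥0∞) ^ x ≤ 2 ^ y :=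
  ENNReal.rpow_le_rpow_of_exponent_le (by norm_num) h

theorem two_rpow_lt {x y : ℝ} (h : x < y) : (2 : ℝ≥0∞) ^ x < 2 ^ y :=
  ENNReal.rpow_lt_rpow_of_exponent_lt (by norm_num) (by simp) h

theorem two_rpow_lt_one {x : ℝ} (h : x < 0) : (2 : ℝ≥0∞) ^ x < 1 := by
  simpa using two_rpow_lt h

theorem two_rpow_mul_rpow (a : ℝ) {s : ℝ} (hs : 0 ≤ s) (y : ℝ≥0∞) :
    (2 ^ a * y) ^ s = 2 ^ (a * s) * y ^ s := by
  rw [ENNReal.mul_rpow_of_nonneg _ _ hs, ← ENNReal.rpow_mul]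

theorem ofReal_two_zpow (j : ℤ) : ENNReal.ofReal (2 ^ j) = 2 ^ (j : ℝ) := by
  rw [← Real.rpow_intCast, ← ENNReal.ofReal_rpow_of_pos two_pos, ENNReal.ofReal_ofNat]

/-- The dyadic discretisation `∑_j (2^{j/r} φ(2^j))^s` of `∫ (t^{1/r} φ(t))^s dt/t`. -/
noncomputable def dyadicSum (r s : ℝ) (φ : ℝ≥0∞ → ℝ≥0∞) : ℝ≥0∞ :=
  ∑' j : ℤ, (2 ^ ((j : ℝ) / r) * φ (2 ^ (j : ℝ))) ^ s

theorem dyadicSum_shift (r s : ℝ) (φ : ℝ≥0∞ → ℝ≥0∞) (i : ℤ) :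
    ∑' j : ℤ, (2 ^ (((j + i : ℤ) : ℝ) / r) * φ (2 ^ ((j + i : ℤ) : ℝ))) ^ s = dyadicSum r s φ :=
  (Equiv.addRight i).tsum_eq fun j : ℤ => (2 ^ ((j : ℝ) / r) * φ (2 ^ (j : ℝ))) ^ s

theorem tsum_half_rpow_le_dyadicSum {ι : Type*} {l : ι → ℤ} (hl : Function.Injective l) (r : ℝ)
    {s : ℝ} (hs : 0 < s) (φ : ℝ≥0∞ → ℝ≥0∞) :
    ∑' n, (2 ^ ((l n : ℝ) / r) * φ (2 ^ ((l n - 1 : ℤ) : ℝ))) ^ s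
      ≤ 2 ^ (1 / r * s) * dyadicSum r s φ := by
  have hinj : Function.Injective fun n => l n - 1 := fun m n h => hl (by simpa using h)
  have hweight (n : ι) : (l n : ℝ) / r = 1 / r + ((l n - 1 : ℤ) : ℝ) / r := by
    push_cast
    ring
  simp_rw [hweight, two_rpow_add (1 / r), mul_assoc, two_rpow_mul_rpow (1 / r) hs.le]
  rw [ENNReal.tsum_mul_left]
  exact mul_le_mul_right (ENNReal.tsum_comp_le_tsum_of_injective hinj
    fun j : ℤ => (2 ^ ((j : ℝ) / r) * φ (2 ^ (j : ℝ))) ^ s) _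

theorem iUnion_Ico_two_zpow : ⋃ j : ℤ, Set.Ico ((2 : ℝ) ^ j) (2 ^ (j + 1)) = Set.Ioi 0 := by
  ext t
  rw [Set.mem_iUnion, Set.mem_Ioi]
  exact ⟨fun ⟨j, hj⟩ => (zpow_pos two_pos j).trans_le hj.1,
    fun ht => exists_mem_Ico_zpow ht one_lt_two⟩

theorem lintegral_Ioi_eq_tsum_dyadic (F : ℝ → ℝ≥0∞) :
    ∫⁻ t in Set.Ioi 0, F t = ∑' j : ℤ, ∫⁻ t in Set.Ico ((2 : ℝ) ^ j) (2 ^ (j + 1)), F t := by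
  rw [← iUnion_Ico_two_zpow]
  exact lintegral_iUnion (fun _ => measurableSet_Ico)
    (zpow_right_mono₀ one_le_two).pairwise_disjoint_on_Ico_succ F

theorem volume_Ico_two_zpow (j : ℤ) :
    volume (Set.Ico ((2 : ℝ) ^ j) (2 ^ (j + 1))) = 2 ^ (j : ℝ) := by
  rw [Real.volume_Ico, ← ofReal_two_zpow, zpow_add_one₀ two_ne_zero]
  ring_nf

theorem ofReal_mem_Icc_two_rpow {j : ℤ} {t : ℝ} (ht : t ∈ Set.Ico ((2 : ℝ) ^ j) (2 ^ (j + 1))) :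
    ENNReal.ofReal t ∈ Set.Icc ((2 : ℝ≥0∞) ^ (j : ℝ)) (2 ^ ((j : ℝ) + 1)) := by
  rw [← Int.cast_one (R := ℝ), ← Int.cast_add, ← ofReal_two_zpow, ← ofReal_two_zpow]
  exact ⟨ENNReal.ofReal_le_ofReal ht.1, ENNReal.ofReal_le_ofReal ht.2.le⟩

section Discretisation

variable {r s : ℝ} {φ : ℝ≥0∞ → ℝ≥0∞}

theorem lintegral_le_dyadicSum (hr : 0 < r) (hs : 0 < s) (hφ : Antitone φ) :
    ∫⁻ t in Set.Ioi (0 : ℝ), (ENNReal.ofReal t ^ (1 / r) * φ (ENNReal.ofReal t)) ^ s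
      * (ENNReal.ofReal t)⁻¹ ≤ 2 ^ (s / r) * dyadicSum r s φ := by
  rw [lintegral_Ioi_eq_tsum_dyadic, dyadicSum, ← ENNReal.tsum_mul_left]
  refine ENNReal.tsum_le_tsum fun j => ?_
  calc _ ≤ ∫⁻ _ in Set.Ico ((2 : ℝ) ^ j) (2 ^ (j + 1)),
        ((2 ^ ((j : ℝ) + 1)) ^ (1 / r) * φ (2 ^ (j : ℝ))) ^ s * (2 ^ (j : ℝ))⁻¹ := by
        refine setLIntegral_mono' measurableSet_Ico fun t ht => ?_
        obtain ⟨hjt, htj⟩ := ofReal_mem_Icc_two_rpow ht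
        gcongr
        exact hφ hjt
    _ = ((2 ^ ((j : ℝ) + 1)) ^ (1 / r) * φ (2 ^ (j : ℝ))) ^ s := by
        rw [setLIntegral_const, volume_Ico_two_zpow, mul_assoc,
          ENNReal.inv_mul_cancel (two_rpow_ne_zero _) (two_rpow_ne_top _), mul_one]
    _ = 2 ^ (s / r) * (2 ^ ((j : ℝ) / r) * φ (2 ^ (j : ℝ))) ^ s := by
        rw [← ENNReal.rpow_mul, two_rpow_mul_rpow _ hs.le, two_rpow_mul_rpow _ hs.le, ← mul_assoc,
          ← two_rpow_add]
        ring_nf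

theorem dyadicSum_le_lintegral (hr : 0 < r) (hs : 0 < s) (hφ : Antitone φ) :
    dyadicSum r s φ ≤ 2 ^ (1 + s / r) * ∫⁻ t in Set.Ioi (0 : ℝ),
      (ENNReal.ofReal t ^ (1 / r) * φ (ENNReal.ofReal t)) ^ s * (ENNReal.ofReal t)⁻¹ := by
  rw [lintegral_Ioi_eq_tsum_dyadic, ← dyadicSum_shift r s φ 1, ← ENNReal.tsum_mul_left]
  refine ENNReal.tsum_le_tsum fun j => ?_
  push_cast
  calc (2 ^ (((j : ℝ) + 1) / r) * φ (2 ^ ((j : ℝ) + 1))) ^ s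
      = 2 ^ (1 + s / r) * ∫⁻ _ in Set.Ico ((2 : ℝ) ^ j) (2 ^ (j + 1)),
          ((2 ^ (j : ℝ)) ^ (1 / r) * φ (2 ^ ((j : ℝ) + 1))) ^ s * (2 ^ ((j : ℝ) + 1))⁻¹ := by
        rw [setLIntegral_const, volume_Ico_two_zpow, ← ENNReal.rpow_neg, ← ENNReal.rpow_mul,
          two_rpow_mul_rpow _ hs.le, two_rpow_mul_rpow _ hs.le, mul_assoc, ← two_rpow_add,
          mul_right_comm, ← mul_assoc, ← two_rpow_add, ← two_rpow_add]
        ring_nf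
    _ ≤ _ := by
        gcongr 2 ^ (1 + s / r) * ?_
        refine setLIntegral_mono' measurableSet_Ico fun t ht => ?_
        obtain ⟨hjt, htj⟩ := ofReal_mem_Icc_two_rpow ht
        gcongr
        exact hφ htj

end Discretisation

section LorentzNorm

variable {α F : Type*} [MeasurableSpace α] [NormedAddCommGroup F] {μ : Measure α} {r s : ℝ}
  {f : α → F}

theorem eLorentzNorm_rpow (hs : 0 < s) :
    eLorentzNorm μ r s f ^ s = ∫⁻ t in Set.Ioi (0 : ℝ),
      (ENNReal.ofReal t ^ (1 / r) * rearrangement μ f (ENNReal.ofReal t)) ^ s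
        * (ENNReal.ofReal t)⁻¹ := by
  rw [eLorentzNorm, ← ENNReal.rpow_mul, one_div_mul_cancel hs.ne', ENNReal.rpow_one]

theorem eLorentzNorm_rpow_le_dyadicSum (hr : 0 < r) (hs : 0 < s) :
    eLorentzNorm μ r s f ^ s ≤ 2 ^ (s / r) * dyadicSum r s (rearrangement μ f) := by
  rw [eLorentzNorm_rpow hs]
  exact lintegral_le_dyadicSum hr hs (rearrangement_antitone μ f)

theorem dyadicSum_le_eLorentzNorm_rpow (hr : 0 < r) (hs : 0 < s) :
    dyadicSum r s (rearrangement μ f) ≤ 2 ^ (1 + s / r) * eLorentzNorm μ r s f ^ s := by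
  rw [eLorentzNorm_rpow hs]
  exact dyadicSum_le_lintegral hr hs (rearrangement_antitone μ f)

theorem two_rpow_mul_rearrangement_le (hr : 0 < r) (hs : 0 < s) (j : ℤ) :
    2 ^ ((j : ℝ) / r) * rearrangement μ f (2 ^ (j : ℝ))
      ≤ 2 ^ (1 / s + 1 / r) * eLorentzNorm μ r s f := by
  have hexp : (1 / s + 1 / r) * s = 1 + s / r := by field_simp
  rw [← ENNReal.rpow_le_rpow_iff hs, two_rpow_mul_rpow (1 / s + 1 / r) hs.le, hexp]
  exact (ENNReal.le_tsum j).trans (dyadicSum_le_eLorentzNorm_rpow hr hs)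

end LorentzNorm

/-! ## Sequence norms as Lorentz norms over the counting measure -/

section SequenceNorm

variable {ι F : Type*} [MeasurableSpace ι] [NormedAddCommGroup F]

theorem eLorentzSeqNorm_rpow {r s : ℝ} (hs : 0 < s) (c : ι → F) :
    eLorentzSeqNorm r s c ^ s
      = ∑' k : ℕ, ((k : ℝ≥0∞) + 1) ^ (s / r - 1) * rearrangement Measure.count c k ^ s := by
  rw [eLorentzSeqNorm, ← ENNReal.rpow_mul, one_div_mul_cancel hs.ne', ENNReal.rpow_one]
  refine tsum_congr fun k => ?_
  rw [ENNReal.mul_rpow_of_nonneg _ _ hs.le, ← ENNReal.rpow_mul]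
  congr 2
  field_simp

variable [Countable ι] [MeasurableSingletonClass ι]

theorem rearrangement_count_eq (c : ι → F) {k : ℕ} {u : ℝ≥0∞} (hku : k ≤ u) (huk : u < k + 1) :
    rearrangement Measure.count c u = rearrangement Measure.count c k := by
  refine (rearrangement_antitone _ c hku).antisymm (le_sInf fun τ hτ => sInf_le ?_)
  have hmeas : MeasurableSet {x | τ < ‖c x‖ₑ} := (Set.to_countable _).measurableSet
  have hlt : Measure.count {x | τ < ‖c x‖ₑ} < k + 1 := lt_of_le_of_lt hτ huk
  change Measure.count {x | τ < ‖c x‖ₑ} ≤ k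
  rw [Measure.count_apply hmeas] at hlt ⊢
  have hk : (k : ℝ≥0∞) + 1 = ((k + 1 : ℕ∞) : ℝ≥0∞) := by simp
  rw [hk, ENat.toENNReal_lt] at hlt
  rw [← ENat.toENNReal_coe, ENat.toENNReal_le]
  exact Order.le_of_lt_add_one hlt

theorem eLorentzNorm_count_rpow {r s : ℝ} (hs : 0 < s) (c : ι → F) :
    eLorentzNorm Measure.count r s c ^ s
      = ∑' k : ℕ, (∫⁻ t in Set.Ico (k : ℝ) (k + 1),
          ENNReal.ofReal t ^ (s / r) * (ENNReal.ofReal t)⁻¹)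
            * rearrangement Measure.count c k ^ s := by
  have hunion : ⋃ k : ℕ, Set.Ico (k : ℝ) (k + 1) = Set.Ici 0 := by
    ext t
    rw [Set.mem_iUnion, Set.mem_Ici]
    exact ⟨fun ⟨k, hk⟩ => k.cast_nonneg.trans hk.1,
      fun ht => ⟨⌊t⌋₊, Nat.floor_le ht, Nat.lt_floor_add_one t⟩⟩
  have hdisj : Pairwise (Function.onFun Disjoint fun k : ℕ => Set.Ico (k : ℝ) (k + 1)) := by
    exact_mod_cast (Nat.mono_cast (α := ℝ)).pairwise_disjoint_on_Ico_succ
  rw [eLorentzNorm_rpow hs, setLIntegral_congr Ioi_ae_eq_Ici, ← hunion,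
    lintegral_iUnion (fun _ => measurableSet_Ico) hdisj]
  refine tsum_congr fun k => ?_
  rw [← lintegral_mul_const _ (by fun_prop)]
  refine setLIntegral_congr_fun measurableSet_Ico fun t ht => ?_
  have hkt : (k : ℝ≥0∞) ≤ ENNReal.ofReal t := by
    rw [← ENNReal.ofReal_natCast]
    exact ENNReal.ofReal_le_ofReal ht.1
  have htk : ENNReal.ofReal t < k + 1 := by
    rw [← ENNReal.ofReal_natCast, ← ENNReal.ofReal_one,
      ← ENNReal.ofReal_add k.cast_nonneg zero_le_one]
    exact (ENNReal.ofReal_lt_ofReal_iff (by positivity)).2 ht.2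
  simp only [rearrangement_count_eq c hkt htk]
  rw [ENNReal.mul_rpow_of_nonneg _ _ hs.le, ← ENNReal.rpow_mul, one_div_mul_eq_div, mul_right_comm]

theorem ofReal_mem_Icc_of_half_le {k : ℕ} {t : ℝ} (h₁ : 2⁻¹ * ((k : ℝ) + 1) ≤ t)
    (h₂ : t ≤ k + 1) :
    ENNReal.ofReal t ∈ Set.Icc (2⁻¹ * ((k : ℝ≥0∞) + 1)) (k + 1) := by
  have hk : ENNReal.ofReal ((k : ℝ) + 1) = (k : ℝ≥0∞) + 1 := by
    rw [ENNReal.ofReal_add k.cast_nonneg zero_le_one, ENNReal.ofReal_natCast, ENNReal.ofReal_one]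
  have hhalf : ENNReal.ofReal (2⁻¹ * ((k : ℝ) + 1)) = 2⁻¹ * ((k : ℝ≥0∞) + 1) := by
    rw [ENNReal.ofReal_mul (by norm_num), ENNReal.ofReal_inv_of_pos two_pos,
      ENNReal.ofReal_ofNat, hk]
  exact ⟨hhalf ▸ ENNReal.ofReal_le_ofReal h₁, hk ▸ ENNReal.ofReal_le_ofReal h₂⟩

theorem natCast_add_one_rpow_sub_one (k : ℕ) (a : ℝ) :
    ((k : ℝ≥0∞) + 1) ^ (a - 1) = (k + 1) ^ a * ((k : ℝ≥0∞) + 1)⁻¹ := by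
  rw [ENNReal.rpow_sub _ _ (by simp) (by simp), ENNReal.rpow_one, div_eq_mul_inv]

theorem rpow_sub_one_le_lintegral_Ico {a : ℝ} (ha : 0 < a) (k : ℕ) :
    ((k : ℝ≥0∞) + 1) ^ (a - 1) ≤ 2 ^ (a + 1) * ∫⁻ t in Set.Ico (k : ℝ) (k + 1),
      ENNReal.ofReal t ^ a * (ENNReal.ofReal t)⁻¹ := by
  have hvol : (k : ℝ) + 1 - (k + 2⁻¹) = 2⁻¹ := by ring
  have htwo : (2 : ℝ≥0∞)⁻¹ = 2 ^ (-1 : ℝ) := by rw [ENNReal.rpow_neg_one]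
  calc ((k : ℝ≥0∞) + 1) ^ (a - 1)
      = 2 ^ (a + 1) * ∫⁻ _ in Set.Ico ((k : ℝ) + 2⁻¹) (k + 1),
          (2⁻¹ * (k + 1 : ℝ≥0∞)) ^ a * ((k : ℝ≥0∞) + 1)⁻¹ := by
        rw [setLIntegral_const, Real.volume_Ico, hvol, ENNReal.ofReal_inv_of_pos two_pos,
          ENNReal.ofReal_ofNat, htwo, two_rpow_mul_rpow _ ha.le, mul_assoc (2 ^ _),
          ← natCast_add_one_rpow_sub_one, mul_right_comm, ← mul_assoc, ← two_rpow_add,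
          ← two_rpow_add]
        ring_nf
        rw [ENNReal.rpow_zero, mul_one]
    _ ≤ 2 ^ (a + 1) * ∫⁻ t in Set.Ico ((k : ℝ) + 2⁻¹) (k + 1),
          ENNReal.ofReal t ^ a * (ENNReal.ofReal t)⁻¹ := by
        gcongr 2 ^ (a + 1) * ?_
        refine setLIntegral_mono' measurableSet_Ico fun t ht => ?_
        have : (0 : ℝ) ≤ k := k.cast_nonneg
        obtain ⟨hlow, hupp⟩ := ofReal_mem_Icc_of_half_le (by linarith [ht.1]) ht.2.le
        gcongr
    _ ≤ _ := by gcongr; linarith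

theorem lintegral_Ico_zero_one_rpow_lt_top {a : ℝ} (ha : 0 < a) :
    ∫⁻ t in Set.Ico (0 : ℝ) 1, ENNReal.ofReal t ^ a * (ENNReal.ofReal t)⁻¹ < ∞ := by
  have hint : IntegrableOn (fun t : ℝ => t ^ (a - 1)) (Set.Ioo 0 1) :=
    (intervalIntegral.integrableOn_Ioo_rpow_iff one_pos).2 (by linarith)
  rw [setLIntegral_congr Ioo_ae_eq_Ico.symm]
  refine hint.lintegral_lt_top.trans_le' (setLIntegral_mono' measurableSet_Ioo fun t ht => ?_)
  have h0 : ENNReal.ofReal t ≠ 0 := by simpa using ht.1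
  rw [← ENNReal.ofReal_rpow_of_pos ht.1, ENNReal.rpow_sub _ _ h0 ENNReal.ofReal_ne_top,
    ENNReal.rpow_one, div_eq_mul_inv]

theorem exists_lintegral_Ico_le_rpow_sub_one {a : ℝ} (ha : 0 < a) :
    ∃ C : ℝ≥0∞, C ≠ ∞ ∧ ∀ k : ℕ, ∫⁻ t in Set.Ico (k : ℝ) (k + 1),
      ENNReal.ofReal t ^ a * (ENNReal.ofReal t)⁻¹ ≤ C * ((k : ℝ≥0∞) + 1) ^ (a - 1) := by
  set W := ∫⁻ t in Set.Ico (0 : ℝ) 1, ENNReal.ofReal t ^ a * (ENNReal.ofReal t)⁻¹ with hW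
  refine ⟨2 + W, by simp [hW, (lintegral_Ico_zero_one_rpow_lt_top ha).ne], fun k => ?_⟩
  rcases k.eq_zero_or_pos with rfl | hk
  · simp [hW]
  have hk1 : (1 : ℝ) ≤ k := by exact_mod_cast hk
  calc _ ≤ ∫⁻ _ in Set.Ico (k : ℝ) (k + 1), (k + 1) ^ a * (2⁻¹ * (k + 1 : ℝ≥0∞))⁻¹ := by
        refine setLIntegral_mono' measurableSet_Ico fun t ht => ?_
        obtain ⟨hlow, hupp⟩ := ofReal_mem_Icc_of_half_le (by linarith [ht.1]) ht.2.le
        gcongr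
    _ = 2 * ((k : ℝ≥0∞) + 1) ^ (a - 1) := by
        rw [setLIntegral_const, Real.volume_Ico, add_sub_cancel_left, ENNReal.ofReal_one, mul_one,
          ENNReal.mul_inv (by simp) (by simp), inv_inv, mul_left_comm,
          natCast_add_one_rpow_sub_one]
    _ ≤ (2 + W) * ((k : ℝ≥0∞) + 1) ^ (a - 1) := by gcongr; exact le_self_add

theorem exists_eLorentzSeqNorm_le_eLorentzNorm_count {r s : ℝ} (hr : 0 < r) (hs : 0 < s) :
    ∃ C : ℝ≥0∞, C ≠ ∞ ∧ ∀ c : ι → F,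
      eLorentzSeqNorm r s c ≤ C * eLorentzNorm Measure.count r s c := by
  refine ⟨(2 ^ (s / r + 1)) ^ (1 / s),
    ENNReal.rpow_ne_top_of_nonneg (by positivity) (two_rpow_ne_top _), fun c => ?_⟩
  rw [← ENNReal.rpow_le_rpow_iff hs, ENNReal.mul_rpow_of_nonneg _ _ hs.le, ← ENNReal.rpow_mul,
    one_div_mul_cancel hs.ne', ENNReal.rpow_one, eLorentzSeqNorm_rpow hs,
    eLorentzNorm_count_rpow hs, ← ENNReal.tsum_mul_left]
  refine ENNReal.tsum_le_tsum fun k => ?_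
  rw [← mul_assoc]
  gcongr
  exact rpow_sub_one_le_lintegral_Ico (by positivity) k

theorem exists_eLorentzNorm_count_le_eLorentzSeqNorm {r s : ℝ} (hr : 0 < r) (hs : 0 < s) :
    ∃ C : ℝ≥0∞, C ≠ ∞ ∧ ∀ c : ι → F,
      eLorentzNorm Measure.count r s c ≤ C * eLorentzSeqNorm r s c := by
  obtain ⟨C, hC, hweight⟩ := exists_lintegral_Ico_le_rpow_sub_one (a := s / r) (by positivity)
  refine ⟨C ^ (1 / s), ENNReal.rpow_ne_top_of_nonneg (by positivity) hC, fun c => ?_⟩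
  rw [← ENNReal.rpow_le_rpow_iff hs, ENNReal.mul_rpow_of_nonneg _ _ hs.le, ← ENNReal.rpow_mul,
    one_div_mul_cancel hs.ne', ENNReal.rpow_one, eLorentzSeqNorm_rpow hs,
    eLorentzNorm_count_rpow hs, ← ENNReal.tsum_mul_left]
  refine ENNReal.tsum_le_tsum fun k => ?_
  rw [← mul_assoc]
  gcongr
  exact hweight k

end SequenceNorm

/-! ## Hardy type inequalities for dyadic sums -/

theorem le_mul_of_rpow_le_mul_rpow {a b C : ℝ≥0∞} {q : ℝ} (hq : 0 < q)
    (h : a ^ q ≤ C * b ^ q) : a ≤ C ^ (1 / q) * b := by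
  rwa [← ENNReal.rpow_le_rpow_iff hq, ENNReal.mul_rpow_of_nonneg _ _ hq.le, ← ENNReal.rpow_mul,
    one_div_mul_cancel hq.ne', ENNReal.rpow_one]

theorem exists_mul_two_rpow_lt {c : ℝ} (hc : 0 < c) {M y : ℝ≥0∞} (hM : M ≠ ∞) (hy : y ≠ 0) :
    ∃ n : ℕ, M * 2 ^ (-(c * n)) < y := by
  have hlim := ENNReal.Tendsto.const_mul (ENNReal.tendsto_pow_atTop_nhds_zero_of_lt_one
    (two_rpow_lt_one (neg_neg_of_pos hc))) (Or.inr hM)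
  rw [mul_zero] at hlim
  obtain ⟨n, hn⟩ := (hlim.eventually_lt_const (pos_iff_ne_zero.2 hy)).exists
  refine ⟨n, ?_⟩
  rwa [← neg_mul, ENNReal.rpow_mul, ENNReal.rpow_natCast]

theorem tsum_two_rpow_neg_abs_ne_top {c : ℝ} (hc : 0 < c) :
    ∑' z : ℤ, (2 : ℝ≥0∞) ^ (-(c * |(z : ℝ)|)) ≠ ∞ := by
  have hv : (2 : ℝ≥0∞) ^ (-c) < 1 := two_rpow_lt_one (neg_neg_of_pos hc)
  have hgeom : ∑' n : ℕ, ((2 : ℝ≥0∞) ^ (-c)) ^ n ≠ ∞ := by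
    rw [ENNReal.tsum_geometric]
    exact ENNReal.inv_ne_top.2 (tsub_pos_of_lt hv).ne'
  have hnat (n : ℕ) : (2 : ℝ≥0∞) ^ (-(c * |((n : ℤ) : ℝ)|)) = (2 ^ (-c)) ^ n := by
    rw [← ENNReal.rpow_natCast, ← ENNReal.rpow_mul, Int.cast_natCast, Nat.abs_cast, neg_mul]
  have hneg (n : ℕ) : (2 : ℝ≥0∞) ^ (-(c * |((-(n + 1 : ℤ) : ℤ) : ℝ)|)) ≤ (2 ^ (-c)) ^ n := by
    rw [← hnat]
    refine two_rpow_le (neg_le_neg (mul_le_mul_of_nonneg_left ?_ hc.le))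
    push_cast
    rw [abs_neg, Nat.abs_cast, abs_of_nonneg (by positivity)]
    linarith
  rw [tsum_of_nat_of_neg_add_one ENNReal.summable ENNReal.summable, tsum_congr hnat]
  exact ENNReal.add_ne_top.2 ⟨hgeom, ne_top_of_le_ne_top hgeom (ENNReal.tsum_le_tsum hneg)⟩

theorem tsum_sq_mul_rpow_le {ι : Type*} (v y : ι → ℝ≥0∞) {q : ℝ} (hq : 0 < q) :
    (∑' i, v i ^ 2 * y i) ^ q ≤ (∑' i, v i) ^ q * ∑' i, v i ^ q * y i ^ q := by
  set M : ℝ≥0∞ := (∑' i, v i ^ q * y i ^ q) ^ (1 / q) with hM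
  have hMq : M ^ q = ∑' i, v i ^ q * y i ^ q := by
    rw [hM, ← ENNReal.rpow_mul, one_div_mul_cancel hq.ne', ENNReal.rpow_one]
  have hle (i : ι) : v i * y i ≤ M := by
    rw [← ENNReal.rpow_le_rpow_iff hq, hMq, ENNReal.mul_rpow_of_nonneg _ _ hq.le]
    exact ENNReal.le_tsum (f := fun i => v i ^ q * y i ^ q) i
  calc (∑' i, v i ^ 2 * y i) ^ q ≤ (∑' i, v i * M) ^ q := by
        refine ENNReal.rpow_le_rpow (ENNReal.tsum_le_tsum fun i => ?_) hq.le
        rw [pow_two, mul_assoc]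
        exact mul_le_mul_right (hle i) _
    _ = _ := by rw [ENNReal.tsum_mul_right, ENNReal.mul_rpow_of_nonneg _ _ hq.le, hMq]

/- Squaring the weight leaves room for a single estimate valid for every `q > 0`, where Young's
inequality would need `q ≥ 1`. -/
theorem tsum_convolution_sq_rpow_le {κ : Type*} {l : κ → ℤ} (hl : Function.Injective l)
    (w : ℤ → ℝ≥0∞) (a : κ → ℝ≥0∞) {q : ℝ} (hq : 0 < q) :
    ∑' i, (∑' j, w (l i - l j) ^ 2 * a j) ^ q
      ≤ (∑' z, w z) ^ q * (∑' z, w z ^ q) * ∑' j, a j ^ q := by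
  have hrow (i : κ) : ∑' j, w (l i - l j) ≤ ∑' z, w z :=
    ENNReal.tsum_comp_le_tsum_of_injective (fun _ _ h => hl (sub_right_injective h)) w
  have hcol (j : κ) : ∑' i, w (l i - l j) ^ q ≤ ∑' z, w z ^ q :=
    ENNReal.tsum_comp_le_tsum_of_injective (fun _ _ h => hl (sub_left_injective h)) (w · ^ q)
  calc ∑' i, (∑' j, w (l i - l j) ^ 2 * a j) ^ q
      ≤ ∑' i, (∑' z, w z) ^ q * ∑' j, w (l i - l j) ^ q * a j ^ q := by
        refine ENNReal.tsum_le_tsum fun i => (tsum_sq_mul_rpow_le _ _ hq).trans ?_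
        gcongr
        exact hrow i
    _ = (∑' z, w z) ^ q * ∑' j, (∑' i, w (l i - l j) ^ q) * a j ^ q := by
        rw [ENNReal.tsum_mul_left, ENNReal.tsum_comm]
        simp_rw [ENNReal.tsum_mul_right]
    _ ≤ (∑' z, w z) ^ q * ∑' j, (∑' z, w z ^ q) * a j ^ q := by
        gcongr with j
        exact hcol j
    _ = _ := by rw [ENNReal.tsum_mul_left, mul_assoc]

theorem exists_tsum_convolution_rpow_const (κ : Type*) {c q : ℝ} (hc : 0 < c) (hq : 0 < q) :
    ∃ C : ℝ≥0∞, C ≠ ∞ ∧ ∀ {l : κ → ℤ}, Function.Injective l → ∀ a : κ → ℝ≥0∞,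
      ∑' i, (∑' j, 2 ^ (-(c * |(l i : ℝ) - l j|)) * a j) ^ q ≤ C * ∑' j, a j ^ q := by
  set w : ℤ → ℝ≥0∞ := fun z => 2 ^ (-(c / 2 * |(z : ℝ)|)) with hw
  have hw2 (i j : ℤ) : w (i - j) ^ 2 = 2 ^ (-(c * |(i : ℝ) - j|)) := by
    rw [hw, ← ENNReal.rpow_natCast, ← ENNReal.rpow_mul]
    push_cast
    ring_nf
  have hwq (z : ℤ) : w z ^ q = 2 ^ (-(c / 2 * q * |(z : ℝ)|)) := by
    rw [hw, ← ENNReal.rpow_mul]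
    ring_nf
  refine ⟨(∑' z, w z) ^ q * ∑' z, w z ^ q, ENNReal.mul_ne_top
    (ENNReal.rpow_ne_top_of_nonneg hq.le (tsum_two_rpow_neg_abs_ne_top (half_pos hc))) ?_,
    fun hl a => ?_⟩
  · rw [tsum_congr hwq]
    exact tsum_two_rpow_neg_abs_ne_top (by positivity)
  · simp_rw [← hw2]
    exact tsum_convolution_sq_rpow_le hl w a hq

/-- The dyadic counterpart of `∫₀^{2^j} φ(t) dt`, which controls the integrable part of a function
with rearrangement `φ` split at the level `φ(2^j)`. -/
noncomputable def headSum (φ : ℝ≥0∞ → ℝ≥0∞) (j : ℤ) : ℝ≥0∞ :=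
  ∑' i : Set.Iio j, φ (2 ^ ((i : ℤ) : ℝ)) * 2 ^ (((i : ℤ) : ℝ) + 1)

/-- The dyadic counterpart of `∫_{2^j}^∞ φ(t)² dt`, which controls the square integrable part of a
function with rearrangement `φ` split at the level `φ(2^j)`. -/
noncomputable def tailSum (φ : ℝ≥0∞ → ℝ≥0∞) (j : ℤ) : ℝ≥0∞ :=
  ∑' i : Set.Ici j, φ (2 ^ ((i : ℤ) : ℝ)) ^ 2 * 2 ^ (((i : ℤ) : ℝ) + 1)

section Hardy

variable {p p' q : ℝ}

theorem exists_headSum_const (hpp : p.HolderConjugate p') (hq : 0 < q) :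
    ∃ C : ℝ≥0∞, C ≠ ∞ ∧ ∀ φ : ℝ≥0∞ → ℝ≥0∞,
      ∑' j : ℤ, (2 ^ (-((j : ℝ) / p')) * headSum φ j) ^ q ≤ C * dyadicSum p q φ := by
  have hexp : 1 / p' = 1 - 1 / p := by linarith [hpp.one_div_add_one_div]
  obtain ⟨C, hC, hconv⟩ :=
    exists_tsum_convolution_rpow_const ℤ (one_div_pos.2 hpp.symm.pos) hq
  refine ⟨C * 2 ^ (1 * q), ENNReal.mul_ne_top hC (two_rpow_ne_top _), fun φ => ?_⟩
  set a : ℤ → ℝ≥0∞ := fun i => 2 ^ (1 : ℝ) * (2 ^ ((i : ℝ) / p) * φ (2 ^ (i : ℝ))) with ha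
  have hterm (j i : ℤ) (hij : i < j) : 2 ^ (-((j : ℝ) / p'))
      * (φ (2 ^ (i : ℝ)) * 2 ^ ((i : ℝ) + 1)) = 2 ^ (-(1 / p' * |(j : ℝ) - i|)) * a i := by
    have hij' : (i : ℝ) < j := by exact_mod_cast hij
    rw [abs_of_pos (sub_pos.2 hij'), ha, mul_comm (φ _)]
    simp only [← mul_assoc, ← two_rpow_add]
    rw [div_eq_mul_one_div (j : ℝ), div_eq_mul_one_div (i : ℝ), hexp]
    ring_nf
  calc ∑' j : ℤ, (2 ^ (-((j : ℝ) / p')) * headSum φ j) ^ q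
      ≤ ∑' j : ℤ, (∑' i : ℤ, 2 ^ (-(1 / p' * |(j : ℝ) - i|)) * a i) ^ q := by
        refine ENNReal.tsum_le_tsum fun j => ENNReal.rpow_le_rpow ?_ hq.le
        rw [headSum, ← ENNReal.tsum_mul_left, tsum_congr fun i : Set.Iio j => hterm j i i.2]
        exact ENNReal.tsum_comp_le_tsum_of_injective Subtype.val_injective _
    _ ≤ C * ∑' i, a i ^ q := hconv Function.injective_id a
    _ = C * 2 ^ (1 * q) * dyadicSum p q φ := by
        simp_rw [ha, two_rpow_mul_rpow 1 hq.le]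
        rw [ENNReal.tsum_mul_left, dyadicSum, mul_assoc]

theorem exists_tailSum_const (hpp : p.HolderConjugate p') (hp2 : p < 2) (hq : 0 < q) :
    ∃ C : ℝ≥0∞, C ≠ ∞ ∧ ∀ φ : ℝ≥0∞ → ℝ≥0∞,
      ∑' j : ℤ, (2 ^ (-((j : ℝ) / p')) * (2 ^ ((j : ℝ) / 2) * tailSum φ j ^ (1 / 2 : ℝ))) ^ q
        ≤ C * dyadicSum p q φ := by
  have hexp : 1 / p' = 1 - 1 / p := by linarith [hpp.one_div_add_one_div]
  have hc : 0 < 2 * (1 / p) - 1 := by linarith [one_div_lt_one_div_of_lt hpp.pos hp2]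
  have hq2 : 0 < q / 2 := half_pos hq
  obtain ⟨C, hC, hconv⟩ := exists_tsum_convolution_rpow_const ℤ hc hq2
  refine ⟨C * 2 ^ (1 * (q / 2)), ENNReal.mul_ne_top hC (two_rpow_ne_top _), fun φ => ?_⟩
  set a : ℤ → ℝ≥0∞ := fun i => 2 ^ (1 : ℝ) * (2 ^ ((i : ℝ) / p) * φ (2 ^ (i : ℝ))) ^ (2 : ℝ)
    with ha
  have hsq (j : ℤ) : (2 ^ (-((j : ℝ) / p')) * (2 ^ ((j : ℝ) / 2) * tailSum φ j ^ (1 / 2 : ℝ))) ^ q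
      = (2 ^ (j - 2 * ((j : ℝ) / p')) * tailSum φ j) ^ (q / 2) := by
    rw [← mul_assoc, ← two_rpow_add, two_rpow_mul_rpow _ hq.le, two_rpow_mul_rpow _ hq2.le,
      ← ENNReal.rpow_mul]
    ring_nf
  have hterm (j i : ℤ) (hji : j ≤ i) : 2 ^ (j - 2 * ((j : ℝ) / p'))
      * (φ (2 ^ (i : ℝ)) ^ 2 * 2 ^ ((i : ℝ) + 1))
        = 2 ^ (-((2 * (1 / p) - 1) * |(j : ℝ) - i|)) * a i := by
    have hji' : (j : ℝ) ≤ i := by exact_mod_cast hji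
    simp only [ha]
    rw [abs_of_nonpos (sub_nonpos.2 hji'), two_rpow_mul_rpow _ zero_le_two,
      ENNReal.rpow_ofNat (φ _), mul_comm (φ _ ^ 2)]
    simp only [← mul_assoc, ← two_rpow_add]
    rw [div_eq_mul_one_div (j : ℝ), div_eq_mul_one_div (i : ℝ), hexp]
    ring_nf
  calc _ ≤ ∑' j : ℤ, (∑' i : ℤ, 2 ^ (-((2 * (1 / p) - 1) * |(j : ℝ) - i|)) * a i) ^ (q / 2) := by
        refine ENNReal.tsum_le_tsum fun j => (hsq j).trans_le (ENNReal.rpow_le_rpow ?_ hq2.le)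
        rw [tailSum, ← ENNReal.tsum_mul_left, tsum_congr fun i : Set.Ici j => hterm j i i.2]
        exact ENNReal.tsum_comp_le_tsum_of_injective Subtype.val_injective _
    _ ≤ C * ∑' i, a i ^ (q / 2) := hconv Function.injective_id a
    _ = C * 2 ^ (1 * (q / 2)) * dyadicSum p q φ := by
        simp_rw [ha, two_rpow_mul_rpow 1 hq2.le, ← ENNReal.rpow_mul,
          mul_div_cancel₀ q two_ne_zero]
        rw [ENNReal.tsum_mul_left, dyadicSum, mul_assoc]

theorem headSum_lt_top (hpp : p.HolderConjugate p') (hq : 0 < q) {φ : ℝ≥0∞ → ℝ≥0∞}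
    (h : dyadicSum p q φ < ∞) (j : ℤ) : headSum φ j < ∞ := by
  obtain ⟨C, hC, hle⟩ := exists_headSum_const hpp hq
  have hlt := ((ENNReal.le_tsum j).trans (hle φ)).trans_lt (ENNReal.mul_lt_top hC.lt_top h)
  rw [ENNReal.rpow_lt_top_iff_of_pos hq] at hlt
  exact ENNReal.lt_top_of_mul_ne_top_right hlt.ne (two_rpow_ne_zero _)

theorem tailSum_lt_top (hpp : p.HolderConjugate p') (hp2 : p < 2) (hq : 0 < q)
    {φ : ℝ≥0∞ → ℝ≥0∞} (h : dyadicSum p q φ < ∞) (j : ℤ) : tailSum φ j < ∞ := by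
  obtain ⟨C, hC, hle⟩ := exists_tailSum_const hpp hp2 hq
  have hlt := ((ENNReal.le_tsum j).trans (hle φ)).trans_lt (ENNReal.mul_lt_top hC.lt_top h)
  rw [ENNReal.rpow_lt_top_iff_of_pos hq, ← mul_assoc, ← two_rpow_add] at hlt
  have hroot := ENNReal.lt_top_of_mul_ne_top_right hlt.ne (two_rpow_ne_zero _)
  rwa [ENNReal.rpow_lt_top_iff_of_pos (by norm_num)] at hroot

end Hardy

/-! ## Splitting a function at a level of its rearrangement -/

section Splitting

variable {α F : Type*} [MeasurableSpace α] [NormedAddCommGroup F] {μ : Measure α} {f : α → F}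
  {p p' q : ℝ}

theorem measure_rearrangement_lt_le (μ : Measure α) (f : α → F) (t : ℝ≥0∞) :
    μ {x | rearrangement μ f t < ‖f x‖ₑ} ≤ t := by
  obtain ⟨u, hu, hlim, hmem⟩ := exists_seq_tendsto_sInf
    (S := {τ : ℝ≥0∞ | μ {x | τ < ‖f x‖ₑ} ≤ t}) ⟨∞, by simp⟩ (OrderBot.bddBelow _)
  have hsub : {x | rearrangement μ f t < ‖f x‖ₑ} ⊆ ⋃ n, {x | u n < ‖f x‖ₑ} := by
    intro x hx
    obtain ⟨n, hn⟩ := (hlim.eventually_lt_const hx).exists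
    exact Set.mem_iUnion.2 ⟨n, hn⟩
  have hmono : Monotone fun n => {x | u n < ‖f x‖ₑ} := fun m n hmn x hx => (hu hmn).trans_lt hx
  refine (measure_mono hsub).trans ?_
  rw [hmono.measure_iUnion]
  exact iSup_le hmem

theorem exists_rearrangement_two_rpow_lt (hp : 0 < p) (hq : 0 < q)
    (hf : eLorentzNorm μ p q f < ∞) {y : ℝ≥0∞} (hy : y ≠ 0) :
    ∃ n : ℤ, rearrangement μ f (2 ^ (n : ℝ)) < y := by
  obtain ⟨n, hn⟩ := exists_mul_two_rpow_lt (one_div_pos.2 hp)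
    (ENNReal.mul_ne_top (two_rpow_ne_top (1 / q + 1 / p)) hf.ne) hy
  refine ⟨n, lt_of_le_of_lt ?_ hn⟩
  calc rearrangement μ f (2 ^ ((n : ℤ) : ℝ))
      = 2 ^ (((n : ℤ) : ℝ) / p) * rearrangement μ f (2 ^ ((n : ℤ) : ℝ))
          * 2 ^ (-(1 / p * n)) := by
        rw [mul_right_comm, ← two_rpow_add, Int.cast_natCast, one_div_mul_eq_div, add_neg_cancel,
          ENNReal.rpow_zero, one_mul]
    _ ≤ _ := mul_le_mul' (two_rpow_mul_rearrangement_le hp hq n) le_rfl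

theorem ae_exists_enorm_le_rearrangement (μ : Measure α) (f : α → F) :
    ∀ᵐ x ∂μ, ∃ i : ℤ, ‖f x‖ₑ ≤ rearrangement μ f (2 ^ (i : ℝ)) := by
  rw [ae_iff]
  push Not
  by_contra hne
  obtain ⟨n, hn⟩ := exists_mul_two_rpow_lt one_pos ENNReal.one_ne_top hne
  refine hn.not_ge (le_trans (measure_mono fun x hx => hx (-n))
    ((measure_rearrangement_lt_le μ f _).trans_eq ?_))
  simp

theorem ae_exists_layer (hp : 0 < p) (hq : 0 < q) (hf : eLorentzNorm μ p q f < ∞) :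
    ∀ᵐ x ∂μ, ‖f x‖ₑ ≠ 0 → ∃ i : ℤ, rearrangement μ f (2 ^ ((i : ℝ) + 1)) < ‖f x‖ₑ
      ∧ ‖f x‖ₑ ≤ rearrangement μ f (2 ^ (i : ℝ)) := by
  filter_upwards [ae_exists_enorm_le_rearrangement μ f] with x hx hx0
  obtain ⟨n, hn⟩ := exists_rearrangement_two_rpow_lt hp hq hf hx0
  have hbdd (i : ℤ) (hi : ‖f x‖ₑ ≤ rearrangement μ f (2 ^ (i : ℝ))) : i ≤ n := by
    by_contra! hni
    exact (hi.trans (rearrangement_antitone μ f (two_rpow_le (by exact_mod_cast hni.le)))).not_gt hn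
  obtain ⟨i, hi, hmax⟩ := Int.exists_greatest_of_bdd ⟨n, hbdd⟩ hx
  refine ⟨i, not_le.1 fun h => ?_, hi⟩
  exact (lt_add_one i).not_ge (hmax (i + 1) (by exact_mod_cast h))

theorem setLIntegral_enorm_pow_le_tsum (hp : 0 < p) (hq : 0 < q)
    (hf : Measurable fun x => ‖f x‖ₑ) (hfin : eLorentzNorm μ p q f < ∞) {S : Set α} {I : Set ℤ}
    (hS : MeasurableSet S) (hI : ∀ x ∈ S, ∀ i : ℤ, rearrangement μ f (2 ^ ((i : ℝ) + 1)) < ‖f x‖ₑ →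
      ‖f x‖ₑ ≤ rearrangement μ f (2 ^ (i : ℝ)) → i ∈ I) {n : ℕ} (hn : n ≠ 0) :
    ∫⁻ x in S, ‖f x‖ₑ ^ n ∂μ
      ≤ ∑' i : I, rearrangement μ f (2 ^ ((i : ℤ) : ℝ)) ^ n * 2 ^ (((i : ℤ) : ℝ) + 1) := by
  set E : ℤ → Set α := fun i => {x | rearrangement μ f (2 ^ ((i : ℝ) + 1)) < ‖f x‖ₑ}
  have hE (i : ℤ) : MeasurableSet (E i) := measurableSet_lt measurable_const hf
  calc ∫⁻ x in S, ‖f x‖ₑ ^ n ∂μ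
      ≤ ∫⁻ x in S, ∑' i : I, (E i).indicator
          (fun _ => rearrangement μ f (2 ^ ((i : ℤ) : ℝ)) ^ n) x ∂μ := by
        refine setLIntegral_mono_ae' hS ?_
        filter_upwards [ae_exists_layer hp hq hfin] with x hx hxS
        rcases eq_or_ne ‖f x‖ₑ 0 with h0 | h0
        · rw [h0, zero_pow hn]
          exact zero_le
        obtain ⟨i, hlt, hle⟩ := hx h0
        refine le_trans ?_ (ENNReal.le_tsum ⟨i, hI x hxS i hlt hle⟩)
        rw [Set.indicator_of_mem (show x ∈ E i from hlt)]
        gcongr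
    _ ≤ ∫⁻ x, ∑' i : I, (E i).indicator
          (fun _ => rearrangement μ f (2 ^ ((i : ℤ) : ℝ)) ^ n) x ∂μ := setLIntegral_le_lintegral _ _
    _ = ∑' i : I, rearrangement μ f (2 ^ ((i : ℤ) : ℝ)) ^ n * μ (E i) := by
        rw [lintegral_tsum fun i : I => (measurable_const.indicator (hE i)).aemeasurable]
        simp_rw [lintegral_indicator_const (hE _)]
    _ ≤ _ := by
        gcongr with i
        exact measure_rearrangement_lt_le μ f _

theorem setLIntegral_large_le_headSum (hp : 0 < p) (hq : 0 < q)
    (hf : Measurable fun x => ‖f x‖ₑ) (hfin : eLorentzNorm μ p q f < ∞) (j : ℤ) :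
    ∫⁻ x in {x | rearrangement μ f (2 ^ (j : ℝ)) < ‖f x‖ₑ}, ‖f x‖ₑ ∂μ
      ≤ headSum (rearrangement μ f) j := by
  simpa only [pow_one, headSum] using setLIntegral_enorm_pow_le_tsum (I := Set.Iio j) hp hq hf hfin
    (measurableSet_lt measurable_const hf) (fun x hx i _ hle => by
      by_contra hji
      exact (lt_of_lt_of_le hx hle).not_ge
        (rearrangement_antitone μ f (two_rpow_le (by exact_mod_cast not_lt.1 hji)))) one_ne_zero

theorem setLIntegral_small_sq_le_tailSum (hp : 0 < p) (hq : 0 < q)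
    (hf : Measurable fun x => ‖f x‖ₑ) (hfin : eLorentzNorm μ p q f < ∞) (j : ℤ) :
    ∫⁻ x in {x | rearrangement μ f (2 ^ (j : ℝ)) < ‖f x‖ₑ}ᶜ, ‖f x‖ₑ ^ 2 ∂μ
      ≤ tailSum (rearrangement μ f) j :=
  setLIntegral_enorm_pow_le_tsum hp hq hf hfin (measurableSet_lt measurable_const hf).compl
    (fun x hx i hlt _ => by
      by_contra hij
      exact (hlt.trans_le (not_lt.1 hx)).not_ge (rearrangement_antitone μ f
        (two_rpow_le (by exact_mod_cast Int.add_one_le_of_lt (not_le.1 hij))))) two_ne_zero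

theorem dyadicSum_rearrangement_lt_top (hp : 0 < p) (hq : 0 < q)
    (hf : eLorentzNorm μ p q f < ∞) : dyadicSum p q (rearrangement μ f) < ∞ :=
  (dyadicSum_le_eLorentzNorm_rpow hp hq).trans_lt
    (ENNReal.mul_lt_top (two_rpow_ne_top _).lt_top (ENNReal.rpow_lt_top_of_nonneg hq.le hf.ne))

theorem exists_add_eq_of_eLorentzNorm_lt_top (hpp : p.HolderConjugate p') (hp2 : p < 2)
    (hq : 0 < q) (hf : StronglyMeasurable f) (hfin : eLorentzNorm μ p q f < ∞) (j : ℤ) :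
    ∃ g h : α → F, g + h = f ∧ Integrable g μ ∧ MemLp h 2 μ ∧
      eLpNorm g 1 μ ≤ headSum (rearrangement μ f) j ∧
      eLpNorm h 2 μ ≤ tailSum (rearrangement μ f) j ^ (1 / 2 : ℝ) := by
  have hD := dyadicSum_rearrangement_lt_top hpp.pos hq hfin
  set S := {x | rearrangement μ f (2 ^ (j : ℝ)) < ‖f x‖ₑ}
  have hS : MeasurableSet S := measurableSet_lt measurable_const hf.enorm
  have hg : eLpNorm (S.indicator f) 1 μ ≤ headSum (rearrangement μ f) j := by
    rw [eLpNorm_indicator_eq_eLpNorm_restrict hS, eLpNorm_one_eq_lintegral_enorm]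
    exact setLIntegral_large_le_headSum hpp.pos hq hf.enorm hfin j
  have hh : eLpNorm (Sᶜ.indicator f) 2 μ ≤ tailSum (rearrangement μ f) j ^ (1 / 2 : ℝ) := by
    rw [eLpNorm_indicator_eq_eLpNorm_restrict hS.compl,
      eLpNorm_eq_lintegral_rpow_enorm_toReal two_ne_zero ENNReal.ofNat_ne_top]
    simp only [ENNReal.toReal_ofNat, ENNReal.rpow_ofNat]
    exact ENNReal.rpow_le_rpow (setLIntegral_small_sq_le_tailSum hpp.pos hq hf.enorm hfin j)
      (by norm_num)
  exact ⟨S.indicator f, Sᶜ.indicator f, Set.indicator_self_add_compl S f,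
    memLp_one_iff_integrable.1 ⟨(hf.indicator hS).aestronglyMeasurable,
      hg.trans_lt (headSum_lt_top hpp hq hD j)⟩,
    ⟨(hf.indicator hS.compl).aestronglyMeasurable, hh.trans_lt
      (ENNReal.rpow_lt_top_of_nonneg (by norm_num) (tailSum_lt_top hpp hp2 hq hD j).ne)⟩, hg, hh⟩

theorem integrableOn_of_eLorentzNorm_lt_top (hpp : p.HolderConjugate p') (hp2 : p < 2)
    (hq : 0 < q) (hf : StronglyMeasurable f) (hfin : eLorentzNorm μ p q f < ∞) {s : Set α}
    (hs : μ s ≠ ∞) : IntegrableOn f s μ := by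
  obtain ⟨g, h, rfl, hg, hh, -⟩ := exists_add_eq_of_eLorentzNorm_lt_top hpp hp2 hq hf hfin 0
  have : IsFiniteMeasure (μ.restrict s) := isFiniteMeasure_restrict.2 hs
  exact hg.integrableOn.add ((hh.restrict s).integrable one_le_two)

theorem rearrangement_le_rpow_mul_eLpNorm {r : ℝ≥0∞} (hr0 : r ≠ 0) (hr : r ≠ ∞)
    (hf : AEStronglyMeasurable f μ) {u : ℝ≥0∞} (hu0 : u ≠ 0) (hu : u ≠ ∞) :
    rearrangement μ f u ≤ u ^ (-(1 / r.toReal)) * eLpNorm f r μ := by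
  have hr' : 0 < r.toReal := ENNReal.toReal_pos hr0 hr
  refine le_of_forall_gt_imp_ge_of_dense fun τ hτ => sInf_le ?_
  have hle : eLpNorm f r μ ^ r.toReal ≤ τ ^ r.toReal * u := by
    calc eLpNorm f r μ ^ r.toReal
        = (u ^ (1 / r.toReal) * (u ^ (-(1 / r.toReal)) * eLpNorm f r μ)) ^ r.toReal := by
          rw [← mul_assoc, ← ENNReal.rpow_add _ _ hu0 hu, add_neg_cancel, ENNReal.rpow_zero,
            one_mul]
      _ ≤ (u ^ (1 / r.toReal) * τ) ^ r.toReal := by gcongr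
      _ = τ ^ r.toReal * u := by
          rw [ENNReal.mul_rpow_of_nonneg _ _ hr'.le, ← ENNReal.rpow_mul,
            one_div_mul_cancel hr'.ne', ENNReal.rpow_one, mul_comm]
  calc μ {x | τ < ‖f x‖ₑ} ≤ μ {x | τ ≤ ‖f x‖ₑ} := measure_mono fun x (hx : τ < ‖f x‖ₑ) => hx.le
    _ ≤ τ⁻¹ ^ r.toReal * eLpNorm f r μ ^ r.toReal :=
        meas_ge_le_mul_pow_eLpNorm_enorm μ hr0 hr hf (zero_le.trans_lt hτ).ne' (by simp)
    _ ≤ τ⁻¹ ^ r.toReal * (τ ^ r.toReal * u) := by gcongr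
    _ = (τ⁻¹ * τ) ^ r.toReal * u := by rw [ENNReal.mul_rpow_of_nonneg _ _ hr'.le, mul_assoc]
    _ ≤ 1 ^ r.toReal * u := by gcongr; exact ENNReal.inv_mul_le_one τ
    _ = u := by rw [ENNReal.one_rpow, one_mul]

theorem rearrangement_le_eLpNorm_top (u : ℝ≥0∞) : rearrangement μ f u ≤ eLpNorm f ∞ μ := by
  have hnull : μ {x | eLpNorm f ∞ μ < ‖f x‖ₑ} = 0 := by
    simpa [ae_iff] using enorm_ae_le_eLpNormEssSup f μ
  exact sInf_le (hnull.trans_le zero_le)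

end Splitting

/-! ## Interpolation between `L¹ → L^∞` and `L² → L²` -/

section Interpolation

variable {β H : Type*} [MeasurableSpace β] [NormedAddCommGroup H] {ν : Measure β}

theorem rearrangement_add_le_eLpNorm {G G₁ G₂ : β → H} (h : G =ᵐ[ν] G₁ + G₂)
    (hG₂ : AEStronglyMeasurable G₂ ν) (j : ℝ) :
    rearrangement ν G (2 ^ (-j)) ≤ eLpNorm G₁ ∞ ν + 2 ^ (j / 2) * eLpNorm G₂ 2 ν := by
  calc rearrangement ν G (2 ^ (-j)) = rearrangement ν (G₁ + G₂) (0 + 2 ^ (-j)) := by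
        rw [rearrangement_congr_ae h, zero_add]
    _ ≤ rearrangement ν G₁ 0 + rearrangement ν G₂ (2 ^ (-j)) := rearrangement_add_le ν G₁ G₂ _ _
    _ ≤ _ := by
        refine add_le_add (rearrangement_le_eLpNorm_top 0) ((rearrangement_le_rpow_mul_eLpNorm
          two_ne_zero ENNReal.ofNat_ne_top hG₂ (two_rpow_ne_zero _)
          (two_rpow_ne_top _)).trans_eq ?_)
        rw [← ENNReal.rpow_mul, ENNReal.toReal_ofNat]
        ring_nf

variable {p p' q : ℝ} {K : ℝ≥0∞}

theorem exists_dyadicSum_interpolation_const (hpp : p.HolderConjugate p') (hp2 : p < 2)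
    (hq : 0 < q) (hK : K ≠ ∞) :
    ∃ C : ℝ≥0∞, C ≠ ∞ ∧ ∀ φ ψ : ℝ≥0∞ → ℝ≥0∞,
      (∀ j : ℤ, ψ (2 ^ (-(j : ℝ))) ≤
        K * (headSum φ j + 2 ^ ((j : ℝ) / 2) * tailSum φ j ^ (1 / 2 : ℝ))) →
      dyadicSum p' q ψ ≤ C * dyadicSum p q φ := by
  obtain ⟨C₁, hC₁, hhead⟩ := exists_headSum_const hpp hq
  obtain ⟨C₂, hC₂, htail⟩ := exists_tailSum_const hpp hp2 hq
  refine ⟨K ^ q * 2 ^ q * (C₁ + C₂), ENNReal.mul_ne_top (ENNReal.mul_ne_top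
    (ENNReal.rpow_ne_top_of_nonneg hq.le hK) (two_rpow_ne_top q))
    (ENNReal.add_ne_top.2 ⟨hC₁, hC₂⟩), fun φ ψ hψ => ?_⟩
  set A : ℤ → ℝ≥0∞ := fun j => 2 ^ (-((j : ℝ) / p')) * headSum φ j
  set B : ℤ → ℝ≥0∞ := fun j =>
    2 ^ (-((j : ℝ) / p')) * (2 ^ ((j : ℝ) / 2) * tailSum φ j ^ (1 / 2 : ℝ))
  calc dyadicSum p' q ψ = ∑' j : ℤ, (2 ^ (-((j : ℝ) / p')) * ψ (2 ^ (-(j : ℝ)))) ^ q := by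
        rw [dyadicSum, ← (Equiv.neg ℤ).tsum_eq]
        simp only [Equiv.neg_apply, Int.cast_neg, neg_div]
    _ ≤ ∑' j : ℤ, K ^ q * 2 ^ q * (A j ^ q + B j ^ q) := by
        refine ENNReal.tsum_le_tsum fun j => ?_
        calc (2 ^ (-((j : ℝ) / p')) * ψ (2 ^ (-(j : ℝ)))) ^ q ≤ (K * (A j + B j)) ^ q := by
              rw [← mul_add, mul_left_comm]
              gcongr
              exact hψ j
          _ ≤ K ^ q * 2 ^ q * (A j ^ q + B j ^ q) := by
              rw [ENNReal.mul_rpow_of_nonneg _ _ hq.le, mul_assoc]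
              gcongr
              exact rpow_add_le_two q hq _ _
    _ ≤ K ^ q * 2 ^ q * (C₁ * dyadicSum p q φ + C₂ * dyadicSum p q φ) := by
        rw [ENNReal.tsum_mul_left, ENNReal.tsum_add]
        gcongr
        exacts [hhead φ, htail φ]
    _ = K ^ q * 2 ^ q * (C₁ + C₂) * dyadicSum p q φ := by
        rw [← add_mul, ← mul_assoc]

theorem exists_eLorentzNorm_interpolation_const (hpp : p.HolderConjugate p') (hp2 : p < 2)
    (hq : 0 < q) (hK : K ≠ ∞) {α F : Type*} [MeasurableSpace α] [NormedAddCommGroup F]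
    (μ : Measure α) (ν : Measure β) :
    ∃ C : ℝ≥0∞, C ≠ ∞ ∧ ∀ (f : α → F) (G : β → H), StronglyMeasurable f →
      eLorentzNorm μ p q f < ∞ →
      (∀ g h : α → F, g + h = f → Integrable g μ → MemLp h 2 μ → ∃ G₁ G₂ : β → H,
        G =ᵐ[ν] G₁ + G₂ ∧ AEStronglyMeasurable G₂ ν ∧
        eLpNorm G₁ ∞ ν ≤ K * eLpNorm g 1 μ ∧ eLpNorm G₂ 2 ν ≤ K * eLpNorm h 2 μ) →
      eLorentzNorm ν p' q G ≤ C * eLorentzNorm μ p q f := by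
  obtain ⟨C, hC, hdyadic⟩ := exists_dyadicSum_interpolation_const hpp hp2 hq hK
  refine ⟨(2 ^ (q / p') * (C * 2 ^ (1 + q / p))) ^ (1 / q),
    ENNReal.rpow_ne_top_of_nonneg (one_div_pos.2 hq).le (ENNReal.mul_ne_top (two_rpow_ne_top _)
      (ENNReal.mul_ne_top hC (two_rpow_ne_top _))), fun f G hf hfin hsplit =>
    le_mul_of_rpow_le_mul_rpow hq ?_⟩
  have hψ (j : ℤ) : rearrangement ν G (2 ^ (-(j : ℝ))) ≤ K * (headSum (rearrangement μ f) j
      + 2 ^ ((j : ℝ) / 2) * tailSum (rearrangement μ f) j ^ (1 / 2 : ℝ)) := by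
    obtain ⟨g, h, hgh, hg, hh, hg1, hh2⟩ :=
      exists_add_eq_of_eLorentzNorm_lt_top hpp hp2 hq hf hfin j
    obtain ⟨G₁, G₂, hG, hG₂, hle₁, hle₂⟩ := hsplit g h hgh hg hh
    refine (rearrangement_add_le_eLpNorm hG hG₂ j).trans ?_
    rw [mul_add, mul_left_comm K]
    gcongr
    exacts [hle₁.trans (by gcongr), hle₂.trans (by gcongr)]
  calc eLorentzNorm ν p' q G ^ q ≤ 2 ^ (q / p') * dyadicSum p' q (rearrangement ν G) :=
        eLorentzNorm_rpow_le_dyadicSum hpp.symm.pos hq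
    _ ≤ 2 ^ (q / p') * (C * dyadicSum p q (rearrangement μ f)) := by
        gcongr
        exact hdyadic _ _ hψ
    _ ≤ 2 ^ (q / p') * (C * (2 ^ (1 + q / p) * eLorentzNorm μ p q f ^ q)) := by
        gcongr
        exact dyadicSum_le_eLorentzNorm_rpow hpp.pos hq
    _ = _ := by simp only [mul_assoc]

end Interpolation

/-! ## The Fourier transform on `L¹ + L²` -/

section FourierSum

open scoped FourierTransform ContDiff

variable {V : Type*} [NormedAddCommGroup V] [InnerProductSpace ℝ V] [MeasurableSpace V]

/-- The Fourier transform `x ↦ ∫ f(t) e^{-i⟨x,t⟩} dμ(t)` in angular frequency, that is, without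
the factor `2π` of `𝓕` in the exponent. For `μ` supported on a torus its values at integer points
are the Fourier coefficients. -/
noncomputable def angularFourier (μ : Measure V) (f : V → ℂ) : V → ℂ :=
  VectorFourier.fourierIntegral Real.probChar μ (innerₗ V) f

theorem angularFourier_apply (μ : Measure V) (f : V → ℂ) (x : V) :
    angularFourier μ f x = ∫ t, f t * Complex.exp (-(Complex.I * (inner ℝ x t : ℝ))) ∂μ := by
  rw [angularFourier, VectorFourier.fourierIntegral_probChar]
  refine integral_congr_ae (ae_of_all _ fun t => ?_)
  simp only [innerₗ_apply_apply, smul_eq_mul, real_inner_comm x t, mul_comm, mul_neg]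

theorem angularFourier_congr_ae {μ : Measure V} {f g : V → ℂ} (h : f =ᵐ[μ] g) :
    angularFourier μ f = angularFourier μ g :=
  VectorFourier.fourierIntegral_congr_ae _ _ _ h

theorem angularFourier_const_smul (μ : Measure V) (c : ℂ) (f : V → ℂ) :
    angularFourier μ (c • f) = c • angularFourier μ f :=
  VectorFourier.fourierIntegral_const_smul _ _ _ _ _

theorem enorm_angularFourier_le (μ : Measure V) (f : V → ℂ) (x : V) :
    ‖angularFourier μ f x‖ₑ ≤ eLpNorm f 1 μ := by
  rw [angularFourier, VectorFourier.fourierIntegral, eLpNorm_one_eq_lintegral_enorm]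
  refine (enorm_integral_le_lintegral_enorm _).trans_eq (lintegral_congr fun t => ?_)
  rw [Circle.smul_def, enorm_smul, ← ofReal_norm, Circle.norm_coe, ENNReal.ofReal_one, one_mul]

variable [BorelSpace V]

theorem angularFourier_add {μ : Measure V} {f g : V → ℂ} (hf : Integrable f μ)
    (hg : Integrable g μ) :
    angularFourier μ (f + g) = angularFourier μ f + angularFourier μ g :=
  VectorFourier.fourierIntegral_add Real.continuous_probChar continuous_inner hf hg

theorem continuous_angularFourier {μ : Measure V} {f : V → ℂ} (hf : Integrable f μ) :
    Continuous (angularFourier μ f) :=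
  VectorFourier.fourierIntegral_continuous Real.continuous_probChar continuous_inner hf

variable [FiniteDimensional ℝ V]

theorem angularFourier_eq_fourier (f : V → ℂ) (x : V) :
    angularFourier volume f x = 𝓕 f ((2 * Real.pi)⁻¹ • x) := by
  rw [Real.fourier_eq', angularFourier_apply]
  refine integral_congr_ae (ae_of_all _ fun t => ?_)
  simp only [smul_eq_mul, real_inner_smul_right]
  rw [mul_comm, real_inner_comm]
  congr 2
  have : (Real.pi : ℂ) ≠ 0 := by exact_mod_cast Real.pi_ne_zero
  push_cast
  field_simp

theorem fourier_ae_eq_fourier_toLp {f : V → ℂ} (h1 : Integrable f) (h2 : MemLp f 2) :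
    𝓕 f =ᵐ[volume] (𝓕 h2.toLp : Lp (α := V) ℂ 2 volume) := by
  have hcont : Continuous (𝓕 f) := VectorFourier.fourierIntegral_continuous
    Real.continuous_fourierChar continuous_inner h1
  refine ae_eq_of_integral_contDiff_smul_eq hcont.locallyIntegrable
    ((Lp.memLp _).locallyIntegrable (by norm_num)) fun g g_smooth g_cpt => ?_
  have hg₁ : HasCompactSupport (Complex.ofRealCLM ∘ g) := g_cpt.comp_left rfl
  have hg₂ : ContDiff ℝ ∞ (Complex.ofRealCLM ∘ g) := by fun_prop
  set G := hg₁.toSchwartzMap hg₂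
  have smul_eq (x : V) (z : ℂ) : g x • z = G x • z := Complex.real_smul
  calc ∫ x, g x • 𝓕 f x = ∫ x, G x • 𝓕 f x := by simp only [smul_eq]
    _ = ∫ x, 𝓕 G x • f x := by
      have := VectorFourier.integral_fourierIntegral_smul_eq_flip (L := innerₗ V)
        Real.continuous_fourierChar continuous_inner (G.integrable (μ := volume)) h1
      rw [flip_innerₗ] at this
      exact this.symm
    _ = ∫ x, 𝓕 G x • (h2.toLp : Lp (α := V) ℂ 2 volume) x := by
      refine integral_congr_ae ?_
      filter_upwards [h2.coeFn_toLp] with x hx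
      rw [hx]
    _ = ∫ x, G x • (𝓕 h2.toLp : Lp (α := V) ℂ 2 volume) x := by
      have := congrArg (fun T => T G) (Lp.fourier_toTemperedDistribution_eq h2.toLp)
      simpa only [TemperedDistribution.fourier_apply, Lp.toTemperedDistribution_apply] using this
    _ = ∫ x, g x • (𝓕 h2.toLp : Lp (α := V) ℂ 2 volume) x := by simp only [smul_eq]

/-- The Plancherel extension of `angularFourier volume` to square integrable functions. -/
noncomputable def fourierL2 (h : Lp (α := V) ℂ 2 volume) (x : V) : ℂ :=
  (𝓕 h : Lp (α := V) ℂ 2 volume) ((2 * Real.pi)⁻¹ • x)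

theorem quasiMeasurePreserving_smul_inv_two_pi :
    Measure.QuasiMeasurePreserving (fun x : V => (2 * Real.pi)⁻¹ • x) volume volume :=
  Measure.quasiMeasurePreserving_smul _ (by positivity)

theorem angularFourier_ae_eq_fourierL2 {f : V → ℂ} (h1 : Integrable f) (h2 : MemLp f 2) :
    angularFourier volume f =ᵐ[volume] fourierL2 h2.toLp := by
  filter_upwards [quasiMeasurePreserving_smul_inv_two_pi.ae (fourier_ae_eq_fourier_toLp h1 h2)]
    with x hx
  rw [angularFourier_eq_fourier, hx, fourierL2]

theorem fourierL2_add (h k : Lp (α := V) ℂ 2 volume) :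
    fourierL2 (h + k) =ᵐ[volume] fourierL2 h + fourierL2 k := by
  have := Lp.coeFn_add (𝓕 h : Lp (α := V) ℂ 2 volume) (𝓕 k)
  rw [← FourierTransform.fourier_add] at this
  exact quasiMeasurePreserving_smul_inv_two_pi.ae this

theorem fourierL2_const_smul (c : ℂ) (h : Lp (α := V) ℂ 2 volume) :
    fourierL2 (c • h) =ᵐ[volume] c • fourierL2 h := by
  have := Lp.coeFn_smul c (𝓕 h : Lp (α := V) ℂ 2 volume)
  rw [← FourierTransform.fourier_smul] at this
  exact quasiMeasurePreserving_smul_inv_two_pi.ae this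

theorem aestronglyMeasurable_fourierL2 (h : Lp (α := V) ℂ 2 volume) :
    AEStronglyMeasurable (fourierL2 h) volume :=
  (Lp.aestronglyMeasurable (𝓕 h : Lp (α := V) ℂ 2 volume)).comp_quasiMeasurePreserving
    quasiMeasurePreserving_smul_inv_two_pi

theorem eLpNorm_fourierL2 (h : Lp (α := V) ℂ 2 volume) :
    eLpNorm (fourierL2 h) 2 volume
      = ENNReal.ofReal ((2 * Real.pi) ^ Module.finrank ℝ V) ^ (1 / 2 : ℝ) * eLpNorm h 2 volume := by
  set H : Lp (α := V) ℂ 2 volume := 𝓕 h with hH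
  have hmap : Measure.map (fun x : V => (2 * Real.pi)⁻¹ • x) volume
      = ENNReal.ofReal ((2 * Real.pi) ^ Module.finrank ℝ V) • (volume : Measure V) := by
    rw [Measure.map_addHaar_smul _ (by positivity), ← inv_pow, inv_inv, abs_of_pos (by positivity)]
  have hm : AEStronglyMeasurable H (Measure.map (fun x : V => (2 * Real.pi)⁻¹ • x) volume) :=
    (Lp.aestronglyMeasurable H).mono_ac quasiMeasurePreserving_smul_inv_two_pi.absolutelyContinuous
  have hnorm : eLpNorm H 2 volume = eLpNorm h 2 volume := by
    rw [← Lp.enorm_def, ← Lp.enorm_def, ← ofReal_norm, ← ofReal_norm, hH, Lp.norm_fourier_eq]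
  have hcomp : fourierL2 h = H ∘ fun x : V => (2 * Real.pi)⁻¹ • x := rfl
  rw [hcomp, ← eLpNorm_map_measure hm (by fun_prop), hmap,
    eLpNorm_smul_measure_of_ne_top (by simp), hnorm, smul_eq_mul]
  norm_num

/-- `G` is the Fourier transform of `f ∈ L¹ + L²`, computed by some splitting of `f` into an
integrable and a square integrable function. -/
def IsSumFourier (f G : V → ℂ) : Prop :=
  ∃ (g : V → ℂ) (h : Lp (α := V) ℂ 2 volume), Integrable g ∧
    f =ᵐ[volume] g + h ∧ G =ᵐ[volume] angularFourier volume g + fourierL2 h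

namespace IsSumFourier

variable {f G f' G' : V → ℂ}

theorem of_add {g h : V → ℂ} (hg : Integrable g) (hh : MemLp h 2) :
    IsSumFourier (g + h) (angularFourier volume g + fourierL2 hh.toLp) :=
  ⟨g, hh.toLp, hg, (ae_eq_refl g).add hh.coeFn_toLp.symm, ae_eq_refl _⟩

theorem congr_right (h : IsSumFourier f G) (hG : G =ᵐ[volume] G') : IsSumFourier f G' := by
  obtain ⟨g, k, hg, hf, hG'⟩ := h
  exact ⟨g, k, hg, hf, hG.symm.trans hG'⟩

theorem add (h : IsSumFourier f G) (h' : IsSumFourier f' G') :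
    IsSumFourier (f + f') (G + G') := by
  obtain ⟨g, k, hg, hf, hG⟩ := h
  obtain ⟨g', k', hg', hf', hG'⟩ := h'
  refine ⟨g + g', k + k', hg.add hg', ?_, ?_⟩
  · filter_upwards [hf, hf', Lp.coeFn_add k k'] with x hx hx' hk
    simp only [Pi.add_apply, hx, hx', hk]
    ring
  · filter_upwards [hG, hG', fourierL2_add k k'] with x hx hx' hk
    simp only [Pi.add_apply, hx, hx', hk, angularFourier_add hg hg']
    ring

theorem const_smul (c : ℂ) (h : IsSumFourier f G) : IsSumFourier (c • f) (c • G) := by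
  obtain ⟨g, k, hg, hf, hG⟩ := h
  refine ⟨c • g, c • k, hg.smul c, ?_, ?_⟩
  · filter_upwards [hf, Lp.coeFn_smul c k] with x hx hk
    simp only [Pi.add_apply, Pi.smul_apply, hx, hk, smul_add]
  · filter_upwards [hG, fourierL2_const_smul c k] with x hx hk
    simp only [Pi.add_apply, Pi.smul_apply, hx, hk, angularFourier_const_smul, smul_add]

theorem ae_eq_zero (h : IsSumFourier f G) (hf : f =ᵐ[volume] 0) : G =ᵐ[volume] 0 := by
  obtain ⟨g, k, hg, hgk, hG⟩ := h
  have hkg : k =ᵐ[volume] (-1 : ℂ) • g := by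
    filter_upwards [hgk, hf] with x hx hx'
    simp only [Pi.add_apply, Pi.smul_apply, Pi.zero_apply, smul_eq_mul] at hx hx' ⊢
    linear_combination hx' - hx
  have hk : Integrable k := (hg.smul (-1 : ℂ)).congr hkg.symm
  have hFk := angularFourier_ae_eq_fourierL2 hk (Lp.memLp k)
  rw [Lp.toLp_coeFn, angularFourier_congr_ae hkg, angularFourier_const_smul] at hFk
  filter_upwards [hG, hFk] with x hx hFkx
  rw [hx, Pi.add_apply, ← hFkx]
  simp

theorem unique (h : IsSumFourier f G) (h' : IsSumFourier f' G') (hf : f =ᵐ[volume] f') :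
    G =ᵐ[volume] G' := by
  have hsub := (h.add (h'.const_smul (-1))).ae_eq_zero (by
    filter_upwards [hf] with x hx
    simp [hx])
  filter_upwards [hsub] with x hx
  simp only [Pi.add_apply, Pi.smul_apply, Pi.zero_apply, smul_eq_mul] at hx
  linear_combination hx

theorem of_integrable (hf : Integrable f) : IsSumFourier f (angularFourier volume f) := by
  refine ⟨f, 0, hf, ?_, ?_⟩
  · exact ae_of_all _ fun x => by simp
  · filter_upwards [fourierL2_const_smul 0 (0 : Lp (α := V) ℂ 2 volume)] with x hx
    rw [zero_smul, zero_smul] at hx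
    simp [hx]

theorem aestronglyMeasurable (h : IsSumFourier f G) : AEStronglyMeasurable G volume := by
  obtain ⟨g, k, hg, -, hG⟩ := h
  exact ((continuous_angularFourier hg).aestronglyMeasurable.add
    (aestronglyMeasurable_fourierL2 k)).congr hG.symm

end IsSumFourier

end FourierSum

/-! ## Existence of the Fourier transform on `ℝ^d` -/

section Complexification

variable {𝕜 : Type*} [RCLike 𝕜] [NormedAlgebra 𝕜 ℂ] {α : Type*}

/-- A real or complex valued function, regarded as a complex valued one in order to take its
Fourier transform. -/
noncomputable def complexify (f : α → 𝕜) : α → ℂ := fun x => algebraMap 𝕜 ℂ (f x)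

theorem enorm_complexify (f : α → 𝕜) (x : α) : ‖complexify f x‖ₑ = ‖f x‖ₑ := by
  rw [complexify, ← ofReal_norm, ← ofReal_norm, norm_algebraMap']

variable [MeasurableSpace α] {μ : Measure α}

theorem eLorentzNorm_complexify (r s : ℝ) (f : α → 𝕜) :
    eLorentzNorm μ r s (complexify f) = eLorentzNorm μ r s f := by
  simp only [eLorentzNorm, rearrangement, enorm_complexify]

theorem stronglyMeasurable_complexify (f : α →ₘ[μ] 𝕜) : StronglyMeasurable (complexify f) :=
  (algebraMap_isometry 𝕜 ℂ).continuous.comp_stronglyMeasurable f.stronglyMeasurable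

theorem integrable_complexify {f : α →ₘ[μ] 𝕜} (hf : Integrable f μ) :
    Integrable (complexify f) μ :=
  hf.congr' (stronglyMeasurable_complexify f).aestronglyMeasurable
    (ae_of_all _ fun x => (norm_algebraMap' ℂ (f x)).symm)

theorem complexify_coeFn_add (f g : α →ₘ[μ] 𝕜) :
    complexify (f + g : α →ₘ[μ] 𝕜) =ᵐ[μ] complexify f + complexify g := by
  filter_upwards [AEEqFun.coeFn_add f g] with x hx
  simp [complexify, hx]

theorem complexify_coeFn_smul (c : 𝕜) (f : α →ₘ[μ] 𝕜) :
    complexify (c • f : α →ₘ[μ] 𝕜) =ᵐ[μ] algebraMap 𝕜 ℂ c • complexify f := by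
  filter_upwards [AEEqFun.coeFn_smul c f] with x hx
  simp [complexify, hx]

theorem angularFourier_complexify {V : Type*} [NormedAddCommGroup V] [InnerProductSpace ℝ V]
    [MeasurableSpace V] {μ : Measure V} (f : V → 𝕜) (x : V) :
    angularFourier μ (complexify f) x
      = ∫ t, f t • Complex.exp (-(Complex.I * (inner ℝ x t : ℝ))) ∂μ := by
  simp only [angularFourier_apply, complexify, Algebra.smul_def]

end Complexification

theorem toReal_le_toReal_mul_toReal {C x y : ℝ≥0∞} (hC : C ≠ ∞) (hx : x ≠ ∞) (h : y ≤ C * x) :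
    y.toReal ≤ C.toReal * x.toReal := by
  rw [← ENNReal.toReal_mul]
  exact ENNReal.toReal_mono (ENNReal.mul_ne_top hC hx) h

section FourierExistence

variable {p p' q : ℝ}

theorem exists_eLorentzNorm_isSumFourier_const (V : Type*) [NormedAddCommGroup V]
    [InnerProductSpace ℝ V] [FiniteDimensional ℝ V] [MeasurableSpace V] [BorelSpace V]
    (hpp : p.HolderConjugate p') (hp2 : p < 2) (hq : 0 < q) :
    ∃ C : ℝ≥0∞, C ≠ ∞ ∧ ∀ f G : V → ℂ, StronglyMeasurable f → eLorentzNorm volume p q f < ∞ →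
      IsSumFourier f G → eLorentzNorm volume p' q G ≤ C * eLorentzNorm volume p q f := by
  set K : ℝ≥0∞ := ENNReal.ofReal ((2 * Real.pi) ^ Module.finrank ℝ V) ^ (1 / 2 : ℝ)
  have hK : max 1 K ≠ ∞ := by simp [K]
  obtain ⟨C, hC, hinterp⟩ := exists_eLorentzNorm_interpolation_const (H := ℂ) hpp hp2 hq hK
    (F := ℂ) (volume : Measure V) (volume : Measure V)
  refine ⟨C, hC, fun f G hf hfin hG => hinterp f G hf hfin fun g h hgh hg hh =>
    ⟨angularFourier volume g, fourierL2 hh.toLp, hG.unique (.of_add hg hh) (by rw [hgh]),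
      aestronglyMeasurable_fourierL2 _, ?_, ?_⟩⟩
  · exact (eLpNormEssSup_le_of_ae_enorm_bound (ae_of_all _
      (enorm_angularFourier_le volume g))).trans (le_mul_of_one_le_left zero_le (le_max_left _ _))
  · rw [eLpNorm_fourierL2, eLpNorm_congr_ae hh.coeFn_toLp]
    gcongr
    exact le_max_right _ _

theorem exists_isSumFourier_of_eLorentzNorm_lt_top {V : Type*} [NormedAddCommGroup V]
    [InnerProductSpace ℝ V] [FiniteDimensional ℝ V] [MeasurableSpace V] [BorelSpace V]
    (hpp : p.HolderConjugate p') (hp2 : p < 2) (hq : 0 < q) {f : V → ℂ}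
    (hf : StronglyMeasurable f) (hfin : eLorentzNorm volume p q f < ∞) :
    ∃ G : V →ₘ[volume] ℂ, IsSumFourier f G := by
  obtain ⟨g, h, rfl, hg, hh, -⟩ := exists_add_eq_of_eLorentzNorm_lt_top hpp hp2 hq hf hfin 0
  exact ⟨AEEqFun.mk _ (IsSumFourier.of_add hg hh).aestronglyMeasurable,
    (IsSumFourier.of_add hg hh).congr_right (AEEqFun.coeFn_mk _ _).symm⟩

theorem exists_isFourierTransform (𝕜 : Type*) [RCLike 𝕜] [NormedAlgebra 𝕜 ℂ] (d : ℕ)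
    (hpp : p.HolderConjugate p') (hp2 : p < 2) (hq : 0 < q) :
    ∃ T : lorentzSpace 𝕜 𝕜 (volume : Measure (EuclideanSpace ℝ (Fin d))) p q →ₗ[𝕜]
      lorentzSpace 𝕜 ℂ (volume : Measure (EuclideanSpace ℝ (Fin d))) p' q,
      IsFourierTransform T := by
  obtain ⟨C, hC, hle⟩ :=
    exists_eLorentzNorm_isSumFourier_const (EuclideanSpace ℝ (Fin d)) hpp hp2 hq
  have hbound (f : lorentzSpace 𝕜 𝕜 (volume : Measure (EuclideanSpace ℝ (Fin d))) p q)
      {G : EuclideanSpace ℝ (Fin d) → ℂ} (hG : IsSumFourier (complexify f.1) G) :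
      eLorentzNorm volume p' q G ≤ C * eLorentzNorm volume p q f.1 := by
    have := hle _ G (stronglyMeasurable_complexify f.1)
    rw [eLorentzNorm_complexify] at this
    exact this (f.2 hq) hG
  have hex (f : lorentzSpace 𝕜 𝕜 (volume : Measure (EuclideanSpace ℝ (Fin d))) p q) :
      ∃ G : lorentzSpace 𝕜 ℂ (volume : Measure (EuclideanSpace ℝ (Fin d))) p' q,
        IsSumFourier (complexify f.1) G.1 := by
    obtain ⟨G, hG⟩ := exists_isSumFourier_of_eLorentzNorm_lt_top hpp hp2 hq
      (stronglyMeasurable_complexify f.1) (by rw [eLorentzNorm_complexify]; exact f.2 hq)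
    exact ⟨⟨G, fun _ => (hbound f hG).trans_lt (ENNReal.mul_lt_top hC.lt_top (f.2 hq))⟩, hG⟩
  choose T hT using hex
  refine ⟨{ toFun := T, map_add' := fun f g => ?_, map_smul' := fun c f => ?_ },
    ⟨C.toReal, fun f => toReal_le_toReal_mul_toReal hC (f.2 hq).ne (hbound f (hT f))⟩,
    fun f hf => ?_⟩
  · exact Subtype.ext (AEEqFun.ext (((hT (f + g)).unique ((hT f).add (hT g))
      (complexify_coeFn_add f.1 g.1)).trans (AEEqFun.coeFn_add _ _).symm))
  · refine Subtype.ext (AEEqFun.ext (((hT (c • f)).unique ((hT f).const_smul (algebraMap 𝕜 ℂ c))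
      (complexify_coeFn_smul c f.1)).trans ?_))
    filter_upwards [AEEqFun.coeFn_smul c (T f).1] with x hx
    simp [hx, Algebra.smul_def]
  · filter_upwards [(hT f).unique (.of_integrable (integrable_complexify hf)) (ae_eq_refl _)]
      with x hx
    exact hx.trans (angularFourier_complexify _ x)

end FourierExistence

/-! ## Fourier coefficients on the torus -/

section Cube

variable {d : ℕ}

/-- The cube `s ^ d` in Euclidean space. -/
def cube (d : ℕ) (s : Set ℝ) : Set (EuclideanSpace ℝ (Fin d)) := {t | ∀ i, t i ∈ s}

theorem cube_eq_preimage (s : Set ℝ) :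
    cube d s = (WithLp.ofLp : EuclideanSpace ℝ (Fin d) → Fin d → ℝ) ⁻¹'
      Set.univ.pi fun _ => s := by
  ext t
  simp [cube]

theorem measurableSet_cube {s : Set ℝ} (hs : MeasurableSet s) : MeasurableSet (cube d s) := by
  rw [cube_eq_preimage]
  exact (PiLp.volume_preserving_ofLp (Fin d)).measurable (MeasurableSet.univ_pi fun _ => hs)

theorem volume_cube {s : Set ℝ} (hs : MeasurableSet s) : volume (cube d s) = volume s ^ d := by
  rw [cube_eq_preimage, (PiLp.volume_preserving_ofLp (Fin d)).measure_preimage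
    (MeasurableSet.univ_pi fun _ => hs).nullMeasurableSet, volume_pi_pi]
  simp

theorem angularFourier_cube (s : Set ℝ) (x : EuclideanSpace ℝ (Fin d)) :
    angularFourier (volume.restrict (cube d s)) (fun _ => 1) x
      = ∏ i, ∫ u in s, Complex.exp (-(Complex.I * ((x i * u : ℝ) : ℂ))) := by
  have h := (PiLp.volume_preserving_ofLp (Fin d)).setIntegral_preimage_emb
    (MeasurableEquiv.toLp 2 (Fin d → ℝ)).symm.measurableEmbedding
    (fun t : Fin d → ℝ => ∏ i, Complex.exp (-(Complex.I * ((x i * t i : ℝ) : ℂ))))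
    (Set.univ.pi fun _ => s)
  rw [← cube_eq_preimage, volume_pi, Measure.restrict_pi_pi,
    integral_fintype_prod_eq_prod (𝕜 := ℂ)
      (f := fun i (u : ℝ) => Complex.exp (-(Complex.I * ((x i * u : ℝ) : ℂ))))] at h
  rw [angularFourier_apply, ← h]
  refine integral_congr_ae (ae_of_all _ fun t => ?_)
  simp only [one_mul, ← Complex.exp_sum, PiLp.inner_apply, RCLike.inner_apply, conj_trivial,
    mul_comm (t _), Complex.ofReal_sum, Finset.mul_sum, Finset.sum_neg_distrib]

end Cube

section Torus

variable {d : ℕ}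

theorem torusMeasure_eq (d : ℕ) :
    torusMeasure d = volume.restrict (cube d (Set.Icc (-Real.pi) Real.pi)) := rfl

instance isFiniteMeasure_torusMeasure : IsFiniteMeasure (torusMeasure d) := by
  refine ⟨?_⟩
  rw [torusMeasure_eq, Measure.restrict_apply_univ, volume_cube measurableSet_Icc]
  simp

/-- The point of Euclidean space with the integer coordinates `m`, at which the Fourier integral of
a function on the torus is its `m`-th Fourier coefficient. -/
noncomputable def latticePoint (m : Fin d → ℤ) : EuclideanSpace ℝ (Fin d) :=
  WithLp.toLp 2 fun i => (m i : ℝ)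

theorem inner_latticePoint (m : Fin d → ℤ) (t : EuclideanSpace ℝ (Fin d)) :
    inner ℝ (latticePoint m) t = ∑ i, t i * (m i : ℝ) := by
  simp [PiLp.inner_apply, latticePoint]

theorem latticePoint_sub (m n : Fin d → ℤ) :
    latticePoint (m - n) = latticePoint m - latticePoint n := by
  ext i
  simp [latticePoint]

theorem setIntegral_Icc_pi_exp (k : ℤ) :
    ∫ u in Set.Icc (-Real.pi) Real.pi, Complex.exp (-(Complex.I * (((k : ℝ) * u : ℝ) : ℂ)))
      = if k = 0 then ((2 * Real.pi : ℝ) : ℂ) else 0 := by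
  rw [integral_Icc_eq_integral_Ioc,
    ← intervalIntegral.integral_of_le (by linarith [Real.pi_pos])]
  split_ifs with hk
  · simp [hk, two_mul]
  · have hc : -(Complex.I * k) ≠ 0 := by simp [hk]
    have hlin (u : ℝ) : -(Complex.I * (((k : ℝ) * u : ℝ) : ℂ)) = -(Complex.I * k) * u := by
      push_cast
      ring
    have hperiod : -(Complex.I * k) * ((-Real.pi : ℝ) : ℂ)
        = -(Complex.I * k) * (Real.pi : ℝ) + k * (2 * Real.pi * Complex.I) := by
      push_cast
      ring
    simp_rw [hlin]
    rw [integral_exp_mul_complex hc, hperiod, Complex.exp_add, Complex.exp_int_mul_two_pi_mul_I,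
      mul_one, sub_self, zero_div]

theorem angularFourier_torusMeasure_one (k : Fin d → ℤ) :
    angularFourier (torusMeasure d) (fun _ => 1) (latticePoint k)
      = if k = 0 then (((2 * Real.pi) ^ d : ℝ) : ℂ) else 0 := by
  rw [torusMeasure_eq, angularFourier_cube]
  simp only [latticePoint, setIntegral_Icc_pi_exp]
  split_ifs with hk
  · simp [hk]
  · obtain ⟨i, hi⟩ := Function.ne_iff.1 hk
    exact Finset.prod_eq_zero (Finset.mem_univ i) (if_neg (by simpa using hi))

/-- The exponential `t ↦ (2π)^{-d/2} e^{i⟨m,t⟩}` on the torus, normalised in `L²(𝕋^d)`. -/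
noncomputable def torusCharacter (m : Fin d → ℤ) (t : EuclideanSpace ℝ (Fin d)) : ℂ :=
  (((√((2 * Real.pi) ^ d))⁻¹ : ℝ) : ℂ) * Complex.exp ((inner ℝ (latticePoint m) t : ℝ) * Complex.I)

theorem memLp_torusCharacter (m : Fin d → ℤ) : MemLp (torusCharacter m) 2 (torusMeasure d) := by
  refine MemLp.of_bound (C := ‖(√((2 * Real.pi) ^ d))⁻¹‖)
    (Continuous.aestronglyMeasurable (by unfold torusCharacter; fun_prop))
    (ae_of_all _ fun t => ?_)
  rw [torusCharacter, norm_mul, Complex.norm_exp_ofReal_mul_I, mul_one, Complex.norm_real]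

theorem conj_torusCharacter (m : Fin d → ℤ) (t : EuclideanSpace ℝ (Fin d)) :
    (starRingEnd ℂ) (torusCharacter m t) = (((√((2 * Real.pi) ^ d))⁻¹ : ℝ) : ℂ)
      * Complex.exp (-(Complex.I * (inner ℝ (latticePoint m) t : ℝ))) := by
  rw [torusCharacter, map_mul, ← Complex.exp_conj, map_mul, Complex.conj_I, Complex.conj_ofReal,
    Complex.conj_ofReal, mul_neg, mul_comm Complex.I]

theorem inner_torusCharacter {f : EuclideanSpace ℝ (Fin d) → ℂ} (hf : MemLp f 2 (torusMeasure d))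
    (m : Fin d → ℤ) :
    inner ℂ (memLp_torusCharacter m).toLp hf.toLp = (((√((2 * Real.pi) ^ d))⁻¹ : ℝ) : ℂ)
      * angularFourier (torusMeasure d) f (latticePoint m) := by
  rw [L2.inner_def, angularFourier_apply, ← integral_const_mul]
  refine integral_congr_ae ?_
  filter_upwards [(memLp_torusCharacter m).coeFn_toLp, hf.coeFn_toLp] with t hm ht
  rw [hm, ht, RCLike.inner_apply, conj_torusCharacter]
  ring

theorem angularFourier_torusCharacter (m n : Fin d → ℤ) :
    angularFourier (torusMeasure d) (torusCharacter n) (latticePoint m)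
      = (((√((2 * Real.pi) ^ d))⁻¹ : ℝ) : ℂ)
        * angularFourier (torusMeasure d) (fun _ => 1) (latticePoint (m - n)) := by
  simp only [angularFourier_apply, torusCharacter]
  rw [← integral_const_mul]
  refine integral_congr_ae (ae_of_all _ fun t => ?_)
  simp only [mul_assoc, one_mul, ← Complex.exp_add, latticePoint_sub, inner_sub_left]
  congr 2
  push_cast
  ring

theorem orthonormal_torusCharacter :
    Orthonormal ℂ fun m : Fin d → ℤ => (memLp_torusCharacter m).toLp := by
  have hpos : (0 : ℝ) < (2 * Real.pi) ^ d := by positivity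
  refine orthonormal_iff_ite.2 fun m n => ?_
  rw [inner_torusCharacter, angularFourier_torusCharacter, angularFourier_torusMeasure_one,
    ← mul_assoc, ← Complex.ofReal_mul, ← mul_inv, Real.mul_self_sqrt hpos.le]
  simp only [sub_eq_zero, mul_ite, mul_zero, ← Complex.ofReal_mul, inv_mul_cancel₀ hpos.ne',
    Complex.ofReal_one]

theorem eLpNorm_two_count_inner_le {𝕜 E ι : Type*} [RCLike 𝕜] [NormedAddCommGroup E]
    [InnerProductSpace 𝕜 E] [MeasurableSpace ι] [MeasurableSingletonClass ι] {v : ι → E}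
    (hv : Orthonormal 𝕜 v) (x : E) :
    eLpNorm (fun i => (inner 𝕜 (v i) x : 𝕜)) 2 Measure.count ≤ ‖x‖ₑ := by
  have hsq (i : ι) : ‖(inner 𝕜 (v i) x : 𝕜)‖ₑ ^ (2 : ℝ)
      = ENNReal.ofReal (‖(inner 𝕜 (v i) x : 𝕜)‖ ^ 2) := by
    rw [ENNReal.rpow_two, ← ofReal_norm, ENNReal.ofReal_pow (norm_nonneg _)]
  rw [eLpNorm_eq_lintegral_rpow_enorm_toReal two_ne_zero (by simp), ENNReal.toReal_ofNat,
    lintegral_count, one_div, ENNReal.rpow_inv_le_iff two_pos]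
  simp_rw [hsq]
  rw [← ENNReal.ofReal_tsum_of_nonneg (fun i => by positivity) (hv.inner_products_summable x),
    ENNReal.rpow_two, ← ofReal_norm, ← ENNReal.ofReal_pow (norm_nonneg _)]
  exact ENNReal.ofReal_le_ofReal (hv.tsum_inner_products_le x)

theorem eLpNorm_two_angularFourier_latticePoint_le {f : EuclideanSpace ℝ (Fin d) → ℂ}
    (hf : MemLp f 2 (torusMeasure d)) :
    eLpNorm (fun m => angularFourier (torusMeasure d) f (latticePoint m)) 2 Measure.count
      ≤ ‖√((2 * Real.pi) ^ d)‖ₑ * eLpNorm f 2 (torusMeasure d) := by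
  have hpos : √((2 * Real.pi) ^ d) ≠ 0 := by positivity
  have hcoeff : (fun m => angularFourier (torusMeasure d) f (latticePoint m))
      = √((2 * Real.pi) ^ d) • fun m => inner ℂ (memLp_torusCharacter m).toLp hf.toLp := by
    funext m
    rw [Pi.smul_apply, inner_torusCharacter, Complex.real_smul, ← mul_assoc, ← Complex.ofReal_mul,
      mul_inv_cancel₀ hpos, Complex.ofReal_one, one_mul]
  rw [hcoeff, eLpNorm_const_smul, ← Lp.enorm_toLp hf]
  gcongr
  exact eLpNorm_two_count_inner_le orthonormal_torusCharacter _

theorem exists_eLorentzSeqNorm_angularFourier_const (d : ℕ) {p p' q : ℝ}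
    (hpp : p.HolderConjugate p') (hp2 : p < 2) (hq : 0 < q) :
    ∃ C : ℝ≥0∞, C ≠ ∞ ∧ ∀ f : EuclideanSpace ℝ (Fin d) → ℂ, StronglyMeasurable f →
      eLorentzNorm (torusMeasure d) p q f < ∞ →
      eLorentzSeqNorm p' q (fun m => angularFourier (torusMeasure d) f (latticePoint m))
        ≤ C * eLorentzNorm (torusMeasure d) p q f := by
  have hK : max 1 ‖√((2 * Real.pi) ^ d)‖ₑ ≠ ∞ := by simp
  obtain ⟨C, hC, hinterp⟩ := exists_eLorentzNorm_interpolation_const (H := ℂ) hpp hp2 hq hK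
    (F := ℂ) (torusMeasure d) (Measure.count : Measure (Fin d → ℤ))
  obtain ⟨D, hD, hseq⟩ :=
    exists_eLorentzSeqNorm_le_eLorentzNorm_count (ι := Fin d → ℤ) (F := ℂ) hpp.symm.pos hq
  let coeff (f : EuclideanSpace ℝ (Fin d) → ℂ) (m : Fin d → ℤ) : ℂ :=
    angularFourier (torusMeasure d) f (latticePoint m)
  refine ⟨D * C, ENNReal.mul_ne_top hD hC, fun f hf hfin => (hseq _).trans ?_⟩
  rw [mul_assoc]
  gcongr
  refine hinterp f _ hf hfin fun g h hgh hg hh => ⟨coeff g, coeff h,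
    ae_of_all _ fun m => ?_, (measurable_of_countable _).aestronglyMeasurable, ?_, ?_⟩
  · rw [← hgh, angularFourier_add hg (hh.integrable (by norm_num))]
    rfl
  · exact (eLpNormEssSup_le_of_ae_enorm_bound (ae_of_all _ fun m =>
      enorm_angularFourier_le _ g _)).trans (le_mul_of_one_le_left zero_le (le_max_left _ _))
  · refine (eLpNorm_two_angularFourier_latticePoint_le hh).trans ?_
    gcongr
    exact le_max_right _ _

theorem exists_isDiscreteFourierTransform (𝕜 : Type*) [RCLike 𝕜] [NormedAlgebra 𝕜 ℂ] (d : ℕ)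
    {p p' q : ℝ} (hpp : p.HolderConjugate p') (hp2 : p < 2) (hq : 0 < q) :
    ∃ T : lorentzSpace 𝕜 𝕜 (torusMeasure d) p q →ₗ[𝕜] lorentzSeqSpace 𝕜 (Fin d → ℤ) ℂ p' q,
      IsDiscreteFourierTransform T := by
  obtain ⟨C, hC, hle⟩ := exists_eLorentzSeqNorm_angularFourier_const d hpp hp2 hq
  let coeff (f : lorentzSpace 𝕜 𝕜 (torusMeasure d) p q) (m : Fin d → ℤ) : ℂ :=
    angularFourier (torusMeasure d) (complexify f.1) (latticePoint m)
  have hbound (f : lorentzSpace 𝕜 𝕜 (torusMeasure d) p q) :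
      eLorentzSeqNorm p' q (coeff f) ≤ C * eLorentzNorm (torusMeasure d) p q f.1 := by
    have := hle _ (stronglyMeasurable_complexify f.1)
    rw [eLorentzNorm_complexify] at this
    exact this (f.2 hq)
  have hint (f : lorentzSpace 𝕜 𝕜 (torusMeasure d) p q) :
      Integrable (complexify f.1) (torusMeasure d) :=
    integrable_complexify (integrableOn_univ.1 (integrableOn_of_eLorentzNorm_lt_top hpp hp2 hq
      f.1.stronglyMeasurable (f.2 hq) (measure_ne_top _ _)))
  refine ⟨{
    toFun := fun f => ⟨coeff f, fun _ =>
      (hbound f).trans_lt (ENNReal.mul_lt_top hC.lt_top (f.2 hq))⟩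
    map_add' := fun f g => Subtype.ext (funext fun m => ?_)
    map_smul' := fun c f => Subtype.ext (funext fun m => ?_) },
    ⟨C.toReal, fun f => toReal_le_toReal_mul_toReal hC (f.2 hq).ne (hbound f)⟩, fun f m => ?_⟩
  · change angularFourier _ (complexify ((f.1 + g.1 : _ →ₘ[_] 𝕜))) _ = _
    rw [angularFourier_congr_ae (complexify_coeFn_add f.1 g.1),
      angularFourier_add (hint f) (hint g)]
    rfl
  · change angularFourier _ (complexify ((c • f.1 : _ →ₘ[_] 𝕜))) _ = _
    rw [angularFourier_congr_ae (complexify_coeFn_smul c f.1), angularFourier_const_smul]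
    exact (Algebra.smul_def c (coeff f m)).symm
  · exact (angularFourier_complexify _ _).trans (by simp only [inner_latticePoint])

end Torus

/-! ## Subspaces of step functions -/

section IsStepOn

variable {α F ι : Type*} [MeasurableSpace α] [NormedAddCommGroup F] {μ : Measure α} {r s : ℝ}

/-- `f` is a step function on the family `A` with values `a`: almost everywhere, `f` equals `a n`
on each `A n` and `0` off `⋃ n, A n`. -/
def IsStepOn (μ : Measure α) (A : ι → Set α) (a : ι → F) (f : α → F) : Prop :=
  ∀ᵐ x ∂μ, (∀ n, x ∈ A n → f x = a n) ∧ ((∀ n, x ∉ A n) → f x = 0)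

theorem IsStepOn.congr {A : ι → Set α} {a : ι → F} {f g : α → F} (h : IsStepOn μ A a f)
    (hfg : f =ᵐ[μ] g) : IsStepOn μ A a g := by
  filter_upwards [h, hfg] with x hx hx'
  rwa [← hx']

theorem isStepOn_indicator [DecidableEq ι] {A : ι → Set α}
    (hd : Pairwise (Function.onFun Disjoint A)) (n : ι) (c : F) :
    IsStepOn μ A (Pi.single n c) ((A n).indicator fun _ => c) := by
  refine ae_of_all _ fun x => ⟨fun m hm => ?_, fun hx => Set.indicator_of_notMem (hx n) _⟩
  rcases eq_or_ne m n with rfl | hmn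
  · rw [Set.indicator_of_mem hm, Pi.single_eq_same]
  · rw [Set.indicator_of_notMem (Set.disjoint_left.1 (hd hmn) hm), Pi.single_eq_of_ne hmn]

theorem IsStepOn.complexify {𝕜 : Type*} [RCLike 𝕜] [NormedAlgebra 𝕜 ℂ] {A : ι → Set α}
    {a : ι → 𝕜} {f : α → 𝕜} (h : IsStepOn μ A a f) :
    IsStepOn μ A (fun n => algebraMap 𝕜 ℂ (a n)) (complexify f) := by
  filter_upwards [h] with x hx
  refine ⟨fun n hn => congrArg (algebraMap 𝕜 ℂ) (hx.1 n hn), fun hn => ?_⟩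
  rw [_root_.complexify, hx.2 hn, map_zero]

theorem tendsto_rearrangement_of_eLorentzNorm (hr : 0 < r) (hs : 0 < s) {f : ℕ → α → F}
    (h : Tendsto (fun n => eLorentzNorm μ r s (f n)) atTop (𝓝 0)) (j : ℤ) :
    Tendsto (fun n => rearrangement μ (f n) (2 ^ (j : ℝ))) atTop (𝓝 0) := by
  have hle (n : ℕ) : rearrangement μ (f n) (2 ^ (j : ℝ))
      ≤ 2 ^ (-((j : ℝ) / r)) * 2 ^ (1 / s + 1 / r) * eLorentzNorm μ r s (f n) := calc
    _ = 2 ^ (-((j : ℝ) / r)) * (2 ^ ((j : ℝ) / r) * rearrangement μ (f n) (2 ^ (j : ℝ))) := by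
        rw [← mul_assoc, ← two_rpow_add, neg_add_cancel, ENNReal.rpow_zero, one_mul]
    _ ≤ _ := by
        rw [mul_assoc]
        exact mul_le_mul_right (two_rpow_mul_rearrangement_le hr hs j) _
  refine tendsto_of_tendsto_of_tendsto_of_le_of_le tendsto_const_nhds ?_ (fun _ => zero_le) hle
  simpa only [mul_zero] using ENNReal.Tendsto.const_mul h
    (Or.inr (ENNReal.mul_ne_top (two_rpow_ne_top _) (two_rpow_ne_top _)))

theorem tendstoInMeasure_of_eLorentzNorm (hr : 0 < r) (hs : 0 < s) {f : ℕ → α → F} {g : α → F}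
    (h : Tendsto (fun n => eLorentzNorm μ r s (f n - g)) atTop (𝓝 0)) :
    TendstoInMeasure μ f atTop g := by
  intro ε hε
  refine ENNReal.tendsto_nhds_zero.2 fun δ hδ => ?_
  obtain ⟨k, hk⟩ := exists_mul_two_rpow_lt one_pos ENNReal.one_ne_top hδ.ne'
  have hk' : (2 : ℝ≥0∞) ^ (((-k : ℤ)) : ℝ) ≤ δ := by simpa using hk.le
  filter_upwards [(tendsto_rearrangement_of_eLorentzNorm hr hs h (-k)).eventually_lt_const hε]
    with n hn
  refine le_trans (measure_mono fun x hx => ?_)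
    ((measure_rearrangement_lt_le μ (f n - g) _).trans hk')
  exact hn.trans_le ((edist_eq_enorm_sub (f n x) (g x)).symm ▸ hx)

theorem isStepOn_of_tendsto (hr : 0 < r) (hs : 0 < s) {A : ι → Set α} {a : ℕ → ι → F}
    {f : ℕ → α → F} {g : α → F} (hf : ∀ n, IsStepOn μ A (a n) (f n))
    (h : Tendsto (fun n => eLorentzNorm μ r s (f n - g)) atTop (𝓝 0)) :
    ∃ b, IsStepOn μ A b g := by
  obtain ⟨k, -, hk⟩ := (tendstoInMeasure_of_eLorentzNorm hr hs h).exists_seq_tendsto_ae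
  have : Nonempty F := ⟨0⟩
  refine ⟨fun n => limUnder atTop fun i => a (k i) n, ?_⟩
  filter_upwards [hk, ae_all_iff.2 hf] with x hx hstep
  refine ⟨fun n hn => ?_, fun hn => ?_⟩
  · simp only [fun i => (hstep (k i)).1 n hn] at hx
    exact hx.limUnder_eq.symm
  · simp only [fun i => (hstep (k i)).2 hn] at hx
    exact tendsto_nhds_unique hx tendsto_const_nhds

theorem linearIndependent_of_isStepOn_single {𝕜 : Type*} [RCLike 𝕜] [DecidableEq ι]
    {A : ι → Set α} (hμ : ∀ n, μ (A n) ≠ 0) {e : ι → α →ₘ[μ] 𝕜}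
    (he : ∀ n, IsStepOn μ A (Pi.single n (1 : 𝕜)) (e n)) : LinearIndependent 𝕜 e := by
  refine linearIndependent_iff'.2 fun t c h0 i hi => ?_
  have hsum : ∀ᵐ x ∂μ, ∑ k ∈ t, c k * e k x = 0 := by
    have hcoe := AEEqFun.coeFn_finsetSum t fun k => c k • e k
    rw [h0] at hcoe
    filter_upwards [hcoe, AEEqFun.coeFn_zero (μ := μ) (β := 𝕜),
      (Finset.eventually_all t).2 fun k _ => AEEqFun.coeFn_smul (c k) (e k)] with x hx hx0 hsmul
    rw [hx0] at hx
    rw [Pi.zero_apply, Finset.sum_apply, Finset.sum_congr rfl hsmul] at hx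
    exact hx.symm
  have hstep := (Finset.eventually_all t).2 fun k _ => he k
  by_contra hci
  have hnull : ∀ᵐ x ∂μ, x ∉ A i := by
    filter_upwards [hsum, hstep] with x hx hstep_x hxi
    have heval : ∀ k ∈ t, c k * e k x = c k * (Pi.single k (1 : 𝕜) : ι → 𝕜) i := fun k hk => by
      rw [(hstep_x k hk).1 i hxi]
    rw [Finset.sum_congr rfl heval] at hx
    exact hci (by simpa [Pi.single_apply, hi] using hx)
  exact hμ i (measure_eq_zero_iff_ae_notMem.2 hnull)

end IsStepOn

section StepSubspace

variable {α ι : Type*} [MeasurableSpace α] (𝕜 : Type*) [RCLike 𝕜] (μ : Measure α) (r s : ℝ)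

/-- The subspace of the step functions on `A` in `L^{r,s}(μ)`. For a lacunary sequence of dyadic
cubes it is the subspace on which the Fourier transform is bounded below. -/
def stepSubspace (A : ι → Set α) : Submodule 𝕜 (lorentzSpace 𝕜 𝕜 μ r s) where
  carrier := {f | ∃ a : ι → 𝕜, IsStepOn μ A a f.1}
  zero_mem' := by
    refine ⟨0, ?_⟩
    filter_upwards [AEEqFun.coeFn_zero (μ := μ) (β := 𝕜)] with x hx
    exact ⟨fun _ _ => hx, fun _ => hx⟩
  add_mem' := by
    rintro f g ⟨a, ha⟩ ⟨b, hb⟩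
    refine ⟨a + b, ?_⟩
    filter_upwards [ha, hb, AEEqFun.coeFn_add f.1 g.1] with x hxa hxb hx
    refine ⟨fun n hn => hx.trans ?_, fun hn => hx.trans ?_⟩
    · rw [Pi.add_apply, hxa.1 n hn, hxb.1 n hn, Pi.add_apply]
    · rw [Pi.add_apply, hxa.2 hn, hxb.2 hn, add_zero]
  smul_mem' := by
    rintro c f ⟨a, ha⟩
    refine ⟨c • a, ?_⟩
    filter_upwards [ha, AEEqFun.coeFn_smul c f.1] with x hxa hx
    refine ⟨fun n hn => hx.trans ?_, fun hn => hx.trans ?_⟩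
    · rw [Pi.smul_apply, hxa.1 n hn, Pi.smul_apply]
    · rw [Pi.smul_apply, hxa.2 hn, smul_zero]

variable {𝕜 μ r s}

theorem isClosedSubspace_stepSubspace (hr : 0 < r) (hs : 0 < s) (A : ι → Set α) :
    IsClosedSubspace (stepSubspace 𝕜 μ r s A) := by
  intro u x hu hlim
  choose a ha using hu
  refine isStepOn_of_tendsto hr hs ha ?_
  have hnorm (n : ℕ) :
      eLorentzNorm μ r s ((u n).1 - x.1 : α → 𝕜) = ENNReal.ofReal ‖u n - x‖ := calc
    _ = eLorentzNorm μ r s (u n - x).1 :=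
        eLorentzNorm_congr_ae (AEEqFun.coeFn_sub (u n).1 x.1).symm
    _ = _ := (ENNReal.ofReal_toReal ((u n - x).2 hs).ne).symm
  simpa only [hnorm, ENNReal.ofReal_zero] using ENNReal.tendsto_ofReal hlim

theorem not_finiteDimensional_stepSubspace [Infinite ι] {A : ι → Set α}
    (hA : ∀ n, MeasurableSet (A n)) (hd : Pairwise (Function.onFun Disjoint A))
    (hμ : ∀ n, μ (A n) ≠ 0)
    (hfin : ∀ n, eLorentzNorm μ r s ((A n).indicator fun _ => (1 : 𝕜)) < ∞) :
    ¬ FiniteDimensional 𝕜 (stepSubspace 𝕜 μ r s A) := by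
  classical
  intro hfd
  let e₀ (n : ι) : α →ₘ[μ] 𝕜 := AEEqFun.mk ((A n).indicator fun _ => (1 : 𝕜))
    (aestronglyMeasurable_const.indicator (hA n))
  have hcoe (n : ι) : e₀ n =ᵐ[μ] (A n).indicator fun _ => (1 : 𝕜) := AEEqFun.coeFn_mk _ _
  have hstep (n : ι) : IsStepOn μ A (Pi.single n (1 : 𝕜)) (e₀ n) :=
    (isStepOn_indicator hd n 1).congr (hcoe n).symm
  let e (n : ι) : stepSubspace 𝕜 μ r s A :=
    ⟨⟨e₀ n, fun _ => (eLorentzNorm_congr_ae (hcoe n)).trans_lt (hfin n)⟩, _, hstep n⟩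
  have hind : LinearIndependent 𝕜 e := LinearIndependent.of_comp
    ((lorentzSpace 𝕜 𝕜 μ r s).subtype ∘ₗ (stepSubspace 𝕜 μ r s A).subtype)
    (linearIndependent_of_isStepOn_single hμ hstep)
  have := hind.finite
  exact not_finite ι

end StepSubspace

theorem not_strictlySingular_of_le {𝕜 X Y : Type*} [RCLike 𝕜] [AddCommGroup X] [Module 𝕜 X]
    [AddCommGroup Y] [Module 𝕜 Y] [Norm X] [Norm Y] {T : X →ₗ[𝕜] Y} {E : Submodule 𝕜 X}
    (hE : ¬ FiniteDimensional 𝕜 E) (hcl : IsClosedSubspace E) {c : ℝ} (hc : 0 ≤ c)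
    (h : ∀ x ∈ E, ‖x‖ ≤ c * ‖T x‖) : ¬ StrictlySingular T := by
  intro hT
  obtain ⟨x, hx, hx1, hTx⟩ := hT E hE hcl (1 / (2 * (c + 1))) (by positivity)
  have hle := (h x hx).trans (mul_le_mul_of_nonneg_left hTx hc)
  rw [hx1, mul_one_div, le_div_iff₀ (by positivity)] at hle
  linarith

/-! ## Lorentz norms of lacunary step functions -/

section Lacunary

variable {α F ι : Type*} [MeasurableSpace α] [NormedAddCommGroup F] {μ : Measure α}
  {A : ι → Set α} {a : ι → F} {f : α → F} {l : ι → ℤ} {p q : ℝ}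

theorem exists_mem_enorm_le_rearrangement {B : Set α} {t : ℝ≥0∞} (ht : t < μ B) {P : α → Prop}
    (hP : ∀ᵐ x ∂μ, P x) (f : α → F) : ∃ x ∈ B, P x ∧ ‖f x‖ₑ ≤ rearrangement μ f t := by
  by_contra! hcon
  refine ht.not_ge (le_trans (measure_mono_ae ?_) (measure_rearrangement_lt_le μ f t))
  filter_upwards [hP] with x hx hxB
  exact hcon x hxB hx

theorem tsum_two_rpow_neg_le (hl : Function.Injective l) (j : ℤ) :
    ∑' m : {m // -l m < j}, (2 : ℝ≥0∞) ^ (-(l m : ℝ)) ≤ 2 ^ (j : ℝ) := by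
  let e (m : {m // -l m < j}) : ℕ := (j - 1 + l m).toNat
  have he (m : {m // -l m < j}) : ((e m : ℕ) : ℤ) = j - 1 + l m :=
    Int.toNat_of_nonneg (by have := m.2; omega)
  have hinj : Function.Injective e := fun m n hmn => by
    have hm := he m
    rw [hmn, he n] at hm
    exact Subtype.ext (hl (by omega))
  calc ∑' m : {m // -l m < j}, (2 : ℝ≥0∞) ^ (-(l m : ℝ))
      = ∑' m : {m // -l m < j}, 2 ^ ((j : ℝ) - 1) * (2⁻¹ : ℝ≥0∞) ^ e m := by
        refine tsum_congr fun m => ?_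
        have hcast : ((e m : ℕ) : ℝ) = (j : ℝ) - 1 + l m := by exact_mod_cast he m
        rw [← ENNReal.rpow_natCast, hcast, ENNReal.inv_rpow, ← ENNReal.rpow_neg, ← two_rpow_add]
        congr 1
        ring
    _ ≤ ∑' k : ℕ, 2 ^ ((j : ℝ) - 1) * (2⁻¹ : ℝ≥0∞) ^ k :=
        ENNReal.tsum_comp_le_tsum_of_injective hinj fun k => 2 ^ ((j : ℝ) - 1) * (2⁻¹ : ℝ≥0∞) ^ k
    _ = 2 ^ (j : ℝ) := by
        rw [ENNReal.tsum_mul_left, ENNReal.tsum_geometric, ENNReal.one_sub_inv_two, inv_inv]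
        nth_rewrite 2 [← ENNReal.rpow_one 2]
        rw [← two_rpow_add, sub_add_cancel]

theorem tsum_two_rpow_nonpos (x : ℝ) :
    ∑' i : ℤ, (if i ≤ 0 then (2 : ℝ≥0∞) ^ ((i : ℝ) * x) else 0) = (1 - 2 ^ (-x))⁻¹ := by
  have hinj : Function.Injective fun k : ℕ => -(k : ℤ) := fun a b h => by simpa using h
  rw [← hinj.tsum_eq, ← ENNReal.tsum_geometric]
  · refine tsum_congr fun k => ?_
    rw [if_pos (by omega), ← ENNReal.rpow_natCast, ← ENNReal.rpow_mul]
    congr 1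
    push_cast
    ring
  · intro i hi
    have hi0 : i ≤ 0 := not_lt.1 fun hlt => hi (if_neg hlt.not_ge)
    exact ⟨i.natAbs, by simp only; omega⟩

theorem one_sub_two_rpow_inv_ne_top {x : ℝ} (hx : x < 0) : (1 - (2 : ℝ≥0∞) ^ x)⁻¹ ≠ ∞ :=
  ENNReal.inv_ne_top.2 (tsub_pos_of_lt (two_rpow_lt_one hx)).ne'

theorem IsStepOn.rearrangement_rpow_le (hf : IsStepOn μ A a f) (hl : Function.Injective l)
    (hA : ∀ n, μ (A n) ≤ 2 ^ (-(l n : ℝ))) (hq : 0 < q) (j : ℤ) :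
    rearrangement μ f (2 ^ (j : ℝ)) ^ q ≤ ∑' m, if j ≤ -l m then ‖a m‖ₑ ^ q else 0 := by
  have := hl.countable
  rw [← ENNReal.le_rpow_inv_iff hq]
  set τ : ℝ≥0∞ := (∑' m, if j ≤ -l m then ‖a m‖ₑ ^ q else 0) ^ q⁻¹ with hτ
  have hle (n : ι) (hn : j ≤ -l n) : ‖a n‖ₑ ≤ τ := by
    rw [hτ, ENNReal.le_rpow_inv_iff hq]
    exact (if_pos hn).symm.trans_le
      (ENNReal.le_tsum (f := fun m => if j ≤ -l m then ‖a m‖ₑ ^ q else 0) n)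
  have hsub : {x | τ < ‖f x‖ₑ} ≤ᵐ[μ] ⋃ m : {m // -l m < j}, A m := by
    filter_upwards [hf] with x hx (hxτ : τ < ‖f x‖ₑ)
    obtain ⟨n, hn⟩ : ∃ n, x ∈ A n := by
      by_contra! hnot
      rw [hx.2 hnot, enorm_zero] at hxτ
      exact not_lt_zero hxτ
    rw [hx.1 n hn] at hxτ
    exact Set.mem_iUnion.2 ⟨⟨n, not_le.1 fun h => hxτ.not_ge (hle n h)⟩, hn⟩
  refine sInf_le ?_
  calc μ {x | τ < ‖f x‖ₑ} ≤ μ (⋃ m : {m // -l m < j}, A m) := measure_mono_ae hsub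
    _ ≤ ∑' m : {m // -l m < j}, μ (A m) := measure_iUnion_le _
    _ ≤ ∑' m : {m // -l m < j}, 2 ^ (-(l m : ℝ)) := ENNReal.tsum_le_tsum fun m => hA m
    _ ≤ 2 ^ (j : ℝ) := tsum_two_rpow_neg_le hl j

theorem IsStepOn.dyadicSum_le (hf : IsStepOn μ A a f) (hl : Function.Injective l)
    (hA : ∀ n, μ (A n) ≤ 2 ^ (-(l n : ℝ))) (hq : 0 < q) :
    dyadicSum p q (rearrangement μ f)
      ≤ (1 - 2 ^ (-(q / p)))⁻¹ * ∑' n, (2 ^ (-(l n : ℝ) / p) * ‖a n‖ₑ) ^ q := by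
  let u (i : ℤ) : ℝ≥0∞ := if i ≤ 0 then 2 ^ ((i : ℝ) * (q / p)) else 0
  have hterm (j : ℤ) (m : ι) : 2 ^ ((j : ℝ) / p * q) * (if j ≤ -l m then ‖a m‖ₑ ^ q else 0)
      = u (j + l m) * (2 ^ (-(l m : ℝ) / p) * ‖a m‖ₑ) ^ q := by
    by_cases hj : j ≤ -l m
    · rw [if_pos hj, show u (j + l m) = _ from if_pos (by omega), two_rpow_mul_rpow _ hq.le,
        ← mul_assoc, ← two_rpow_add]
      congr 2
      push_cast
      ring
    · rw [if_neg hj, show u (j + l m) = _ from if_neg (by omega), mul_zero, zero_mul]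
  calc dyadicSum p q (rearrangement μ f)
      ≤ ∑' j : ℤ, ∑' m, u (j + l m) * (2 ^ (-(l m : ℝ) / p) * ‖a m‖ₑ) ^ q := by
        refine ENNReal.tsum_le_tsum fun j => ?_
        rw [two_rpow_mul_rpow _ hq.le]
        simp only [← hterm, ENNReal.tsum_mul_left]
        exact mul_le_mul_right (hf.rearrangement_rpow_le hl hA hq j) _
    _ = ∑' m, (∑' j : ℤ, u j) * (2 ^ (-(l m : ℝ) / p) * ‖a m‖ₑ) ^ q := by
        rw [ENNReal.tsum_comm]
        refine tsum_congr fun m => ?_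
        rw [ENNReal.tsum_mul_right]
        exact congrArg (· * _) ((Equiv.addRight (l m)).tsum_eq u)
    _ = _ := by rw [ENNReal.tsum_mul_left, tsum_two_rpow_nonpos]

theorem IsStepOn.eLorentzNorm_rpow_le (hf : IsStepOn μ A a f) (hl : Function.Injective l)
    (hA : ∀ n, μ (A n) ≤ 2 ^ (-(l n : ℝ))) (hp : 0 < p) (hq : 0 < q) :
    eLorentzNorm μ p q f ^ q ≤ 2 ^ (q / p) * ((1 - 2 ^ (-(q / p)))⁻¹
      * ∑' n, (2 ^ (-(l n : ℝ) / p) * ‖a n‖ₑ) ^ q) :=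
  (eLorentzNorm_rpow_le_dyadicSum hp hq).trans (mul_le_mul_right (hf.dyadicSum_le hl hA hq) _)

theorem IsStepOn.le_dyadicSum (hf : IsStepOn μ A a f) (hl : Function.Injective l)
    (hA : ∀ n, 2 ^ (-(l n : ℝ)) ≤ μ (A n)) (hq : 0 < q) :
    ∑' n, (2 ^ (-(l n : ℝ) / p) * ‖a n‖ₑ) ^ q
      ≤ 2 ^ (1 / p * q) * dyadicSum p q (rearrangement μ f) := by
  refine le_trans (ENNReal.tsum_le_tsum fun n => ?_)
    (tsum_half_rpow_le_dyadicSum (neg_injective.comp hl) p hq (rearrangement μ f))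
  obtain ⟨x, hxA, hx, hle⟩ := exists_mem_enorm_le_rearrangement
    (t := 2 ^ ((-l n - 1 : ℤ) : ℝ)) ((two_rpow_lt (by push_cast; linarith)).trans_le (hA n)) hf f
  rw [hx.1 n hxA] at hle
  simp only [Function.comp_apply, Int.cast_neg]
  exact ENNReal.rpow_le_rpow (mul_le_mul_right hle _) hq.le

theorem IsStepOn.integrable {p' : ℝ} (hpp : p.HolderConjugate p') (hp2 : p < 2) (hq : 0 < q)
    (hf : IsStepOn μ A a f) (hfm : StronglyMeasurable f) (hfin : eLorentzNorm μ p q f < ∞)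
    {U : Set α} (hAU : ∀ n, A n ⊆ U) (hμU : μ U ≠ ∞) : Integrable f μ := by
  have hint := integrableOn_of_eLorentzNorm_lt_top hpp hp2 hq hfm hfin hμU
  refine hint.integrable_of_ae_notMem_eq_zero ?_
  filter_upwards [hf] with x hx hxU
  exact hx.2 fun n hn => hxU (hAU n hn)

end Lacunary

/-! ## Absorption of separated off-diagonal terms -/

theorem le_two_mul_of_le_add_half {x y : ℝ≥0∞} (hx : x ≠ ∞) (h : x ≤ y + 2⁻¹ * x) : x ≤ 2 * y := by
  have hhalf : 2⁻¹ * x ≤ y := by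
    refine ENNReal.le_of_add_le_add_right (a := 2⁻¹ * x) (by finiteness) ?_
    rwa [← add_mul, ENNReal.inv_two_add_inv_two, one_mul]
  rwa [ENNReal.inv_mul_le_iff two_ne_zero ENNReal.ofNat_ne_top] at hhalf

theorem injective_of_forall_lt_abs_sub {ι : Type*} {N : ℕ} {l : ι → ℤ}
    (h : ∀ n m, n ≠ m → (N : ℤ) < |l n - l m|) : Function.Injective l := fun n m hnm => by
  by_contra hne
  have := h n m hne
  rw [hnm, sub_self, abs_zero] at this
  omega

theorem exists_separation_absorption (ι : Type*) [DecidableEq ι] {c q : ℝ} (hc : 0 < c)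
    (hq : 0 < q) {K : ℝ≥0∞} (hK : K ≠ ∞) :
    ∃ N : ℕ, ∀ {l : ι → ℤ}, (∀ n m, n ≠ m → (N : ℤ) < |l n - l m|) → ∀ α β : ι → ℝ≥0∞,
      ∑' n, α n ^ q ≠ ∞ →
      (∀ n, α n ≤ β n + K * ∑' m, if m = n then 0 else 2 ^ (-(c * |(l n : ℝ) - l m|)) * α m) →
      ∑' n, α n ^ q ≤ 2 ^ (1 + q) * ∑' n, β n ^ q := by
  obtain ⟨C, hC, hconv⟩ := exists_tsum_convolution_rpow_const ι (half_pos hc) hq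
  have hKC : 2 ^ q * (K ^ q * C) ≠ ∞ := ENNReal.mul_ne_top (two_rpow_ne_top _)
    (ENNReal.mul_ne_top (ENNReal.rpow_ne_top_of_nonneg hq.le hK) hC)
  obtain ⟨N, hN⟩ := exists_mul_two_rpow_lt (c := c / 2 * q) (by positivity) hKC
    (ENNReal.inv_ne_zero.2 ENNReal.ofNat_ne_top : (2⁻¹ : ℝ≥0∞) ≠ 0)
  refine ⟨N, fun {l} hl α β hfin hle => ?_⟩
  set M : ι → ℝ≥0∞ := fun n => ∑' m, 2 ^ (-(c / 2 * |(l n : ℝ) - l m|)) * α m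
  have hoff (n : ι) : (∑' m, if m = n then 0 else 2 ^ (-(c * |(l n : ℝ) - l m|)) * α m)
      ≤ 2 ^ (-(c / 2 * N)) * M n := by
    rw [← ENNReal.tsum_mul_left]
    refine ENNReal.tsum_le_tsum fun m => ?_
    split_ifs with hmn
    · exact zero_le
    · have hsep : (N : ℝ) ≤ |(l n : ℝ) - l m| := by exact_mod_cast (hl n m (Ne.symm hmn)).le
      rw [← mul_assoc, ← two_rpow_add]
      exact mul_le_mul' (two_rpow_le (by nlinarith)) le_rfl
  have hterm (n : ι) : α n ^ q
      ≤ 2 ^ q * β n ^ q + 2 ^ q * (K ^ q * 2 ^ (-(c / 2 * q * N))) * M n ^ q := calc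
    α n ^ q ≤ (β n + K * (2 ^ (-(c / 2 * N)) * M n)) ^ q :=
        ENNReal.rpow_le_rpow ((hle n).trans (add_le_add le_rfl (mul_le_mul_right (hoff n) K))) hq.le
    _ ≤ 2 ^ q * (β n ^ q + (K * (2 ^ (-(c / 2 * N)) * M n)) ^ q) := rpow_add_le_two _ hq _ _
    _ = _ := by
        rw [ENNReal.mul_rpow_of_nonneg _ _ hq.le, two_rpow_mul_rpow _ hq.le]
        ring_nf
  rw [two_rpow_add, ENNReal.rpow_one, mul_assoc]
  refine le_two_mul_of_le_add_half hfin ?_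
  calc ∑' n, α n ^ q
      ≤ 2 ^ q * ∑' n, β n ^ q + 2 ^ q * (K ^ q * 2 ^ (-(c / 2 * q * N))) * ∑' n, M n ^ q := by
        rw [← ENNReal.tsum_mul_left, ← ENNReal.tsum_mul_left, ← ENNReal.tsum_add]
        exact ENNReal.tsum_le_tsum hterm
    _ ≤ 2 ^ q * ∑' n, β n ^ q
          + 2 ^ q * (K ^ q * 2 ^ (-(c / 2 * q * N))) * (C * ∑' n, α n ^ q) := by
        gcongr
        exact hconv (injective_of_forall_lt_abs_sub hl) α
    _ = 2 ^ q * ∑' n, β n ^ q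
          + 2 ^ q * (K ^ q * C) * 2 ^ (-(c / 2 * q * N)) * ∑' n, α n ^ q := by ring
    _ ≤ 2 ^ q * ∑' n, β n ^ q + 2⁻¹ * ∑' n, α n ^ q := by gcongr

/-! ## Fourier integrals of dyadic cubes -/

section Oscillation

variable {a b : ℝ}

theorem norm_exp_neg_I_mul_ofReal (θ : ℝ) : ‖Complex.exp (-(Complex.I * θ))‖ = 1 := by
  simp [Complex.norm_exp]

theorem norm_setIntegral_exp_le (hab : a ≤ b) (x : ℝ) :
    ‖∫ u in Set.Ioc a b, Complex.exp (-(Complex.I * ((x * u : ℝ) : ℂ)))‖ ≤ b - a := by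
  have h := norm_setIntegral_le_of_norm_le_const (μ := volume) (s := Set.Ioc a b)
    (f := fun u : ℝ => Complex.exp (-(Complex.I * ((x * u : ℝ) : ℂ)))) (C := 1)
    (by simp) fun u _ => (norm_exp_neg_I_mul_ofReal _).le
  rwa [one_mul, Real.volume_real_Ioc_of_le hab] at h

theorem norm_setIntegral_exp_le_two_div (hab : a ≤ b) {x : ℝ} (hx : x ≠ 0) :
    ‖∫ u in Set.Ioc a b, Complex.exp (-(Complex.I * ((x * u : ℝ) : ℂ)))‖ ≤ 2 / |x| := by
  have hc : -(Complex.I * x) ≠ 0 := by simp [hx]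
  have hlin (u : ℝ) : -(Complex.I * ((x * u : ℝ) : ℂ)) = -(Complex.I * x) * u := by
    push_cast
    ring
  rw [← intervalIntegral.integral_of_le hab]
  simp_rw [hlin]
  rw [integral_exp_mul_complex hc, norm_div, norm_neg, norm_mul, Complex.norm_I, one_mul,
    Complex.norm_real, Real.norm_eq_abs, ← hlin, ← hlin]
  gcongr
  refine (norm_sub_le _ _).trans_eq ?_
  rw [norm_exp_neg_I_mul_ofReal, norm_exp_neg_I_mul_ofReal, one_add_one_eq_two]

/-- Up to a unimodular factor the integrand is `e^{-ixv}` with `v` measured from the midpoint, and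
its real part is at least `1 / 2`. -/
theorem half_le_norm_setIntegral_exp (hab : a ≤ b) {x : ℝ} (hx : |x| * (b - a) ≤ 2) :
    (b - a) / 2 ≤ ‖∫ u in Set.Ioc a b, Complex.exp (-(Complex.I * ((x * u : ℝ) : ℂ)))‖ := by
  set c := (a + b) / 2 with hc
  let g (u : ℝ) : ℂ := Complex.exp (-(Complex.I * ((x * (u - c) : ℝ) : ℂ)))
  have hgi : IntegrableOn g (Set.Ioc a b) :=
    (Continuous.integrableOn_Icc (by fun_prop)).mono_set Set.Ioc_subset_Icc_self
  have hre (u : ℝ) : (g u).re = Real.cos (x * (u - c)) := by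
    rw [← Real.cos_neg, ← Complex.exp_ofReal_mul_I_re]
    refine congrArg (fun z => (Complex.exp z).re) ?_
    push_cast
    ring
  have hcos : ∀ u ∈ Set.Ioc a b, 1 / 2 ≤ (g u).re := fun u hu => by
    have hu' : |u - c| ≤ (b - a) / 2 := abs_le.2 ⟨by linarith [hu.1], by linarith [hu.2]⟩
    have habs : |x * (u - c)| ≤ 1 := by
      rw [abs_mul]
      nlinarith [abs_nonneg x]
    rw [hre]
    linarith [(sq_le_one_iff_abs_le_one _).2 habs,
      Real.one_sub_sq_div_two_le_cos (x := x * (u - c))]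
  have hmod : ‖∫ u in Set.Ioc a b, Complex.exp (-(Complex.I * ((x * u : ℝ) : ℂ)))‖
      = ‖∫ u in Set.Ioc a b, g u‖ := by
    rw [← one_mul ‖∫ u in Set.Ioc a b, g u‖, ← norm_exp_neg_I_mul_ofReal (x * c), ← norm_mul,
      ← integral_const_mul]
    refine congrArg norm (integral_congr_ae (ae_of_all _ fun u => ?_))
    simp only [g, ← Complex.exp_add]
    congr 1
    push_cast
    ring
  calc (b - a) / 2 = ∫ _ in Set.Ioc a b, (1 / 2 : ℝ) := by
        rw [setIntegral_const, Real.volume_real_Ioc_of_le hab, smul_eq_mul, mul_one_div]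
    _ ≤ ∫ u in Set.Ioc a b, (g u).re :=
        setIntegral_mono_on (by simp) hgi.re measurableSet_Ioc hcos
    _ = (∫ u in Set.Ioc a b, g u).re := Complex.reCLM.integral_comp_comm hgi
    _ ≤ ‖∫ u in Set.Ioc a b, g u‖ := Complex.re_le_norm _
    _ = _ := hmod.symm

end Oscillation

section DyadicCube

variable {d : ℕ}

/-- The cube `(2^{-k}, 2^{1-k}]^d`, of volume `2^{-dk}`. For `k ≥ 0` it lies in the torus. -/
def dyadicCube (d : ℕ) (k : ℤ) : Set (EuclideanSpace ℝ (Fin d)) :=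
  cube d (Set.Ioc (2 ^ (-k)) (2 * 2 ^ (-k)))

/-- The box `[2^k, 2^{k+1}]^d` of the frequencies dual to `dyadicCube d k`. -/
def frequencyBox (d : ℕ) (k : ℤ) : Set (EuclideanSpace ℝ (Fin d)) :=
  cube d (Set.Icc (2 ^ k) (2 * 2 ^ k))

theorem ofReal_two_zpow_pow (k : ℤ) (d : ℕ) :
    ENNReal.ofReal (2 ^ k) ^ d = 2 ^ ((d * k : ℤ) : ℝ) := by
  rw [ofReal_two_zpow, ← ENNReal.rpow_natCast, ← ENNReal.rpow_mul]
  congr 1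
  push_cast
  ring

theorem measurableSet_dyadicCube (d : ℕ) (k : ℤ) : MeasurableSet (dyadicCube d k) :=
  measurableSet_cube measurableSet_Ioc

theorem volume_dyadicCube (d : ℕ) (k : ℤ) :
    volume (dyadicCube d k) = 2 ^ (-((d * k : ℤ) : ℝ)) := by
  rw [dyadicCube, volume_cube measurableSet_Ioc, Real.volume_Ioc, two_mul, add_sub_cancel_right,
    ofReal_two_zpow_pow]
  push_cast
  rw [mul_neg]

theorem measure_dyadicCube_of_restrict_eq {μ : Measure (EuclideanSpace ℝ (Fin d))} {k : ℤ}
    (h : μ.restrict (dyadicCube d k) = volume.restrict (dyadicCube d k)) :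
    μ (dyadicCube d k) = 2 ^ (-((d * k : ℤ) : ℝ)) := by
  rw [← volume_dyadicCube, ← Measure.restrict_apply_self, h, Measure.restrict_apply_self]

theorem volume_frequencyBox (d : ℕ) (k : ℤ) :
    volume (frequencyBox d k) = 2 ^ ((d * k : ℤ) : ℝ) := by
  rw [frequencyBox, volume_cube measurableSet_Icc, Real.volume_Icc, two_mul, add_sub_cancel_right,
    ofReal_two_zpow_pow]

theorem pairwise_disjoint_dyadicCube (hd : 0 < d) :
    Pairwise (Function.onFun Disjoint (dyadicCube d)) := by
  refine (pairwise_disjoint_on _).2 fun m n hmn => Set.disjoint_left.2 fun t hm hn => ?_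
  have hstep : (2 : ℝ) * 2 ^ (-n) ≤ 2 ^ (-m) := by
    rw [← zpow_one_add₀ two_ne_zero]
    exact zpow_le_zpow_right₀ one_le_two (by omega)
  exact ((hm ⟨0, hd⟩).1.trans_le ((hn ⟨0, hd⟩).2.trans hstep)).false

theorem dyadicCube_subset_cube {k : ℤ} (hk : 0 ≤ k) : dyadicCube d k ⊆ cube d (Set.Ioc 0 2) := by
  have hle : (2 : ℝ) ^ (-k) ≤ 1 := zpow_le_one_of_nonpos₀ one_le_two (by omega)
  exact fun t ht i => ⟨(by positivity : (0 : ℝ) < 2 ^ (-k)).trans (ht i).1,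
    (ht i).2.trans (by linarith)⟩

theorem enorm_angularFourier_cube_le {s : Set ℝ} {x : EuclideanSpace ℝ (Fin d)} {c : ℝ}
    (h : ∀ i, ‖∫ u in s, Complex.exp (-(Complex.I * ((x i * u : ℝ) : ℂ)))‖ ≤ c) :
    ‖angularFourier (volume.restrict (cube d s)) (fun _ => 1) x‖ₑ ≤ ENNReal.ofReal c ^ d := by
  rw [angularFourier_cube, ← ofReal_norm, norm_prod,
    ENNReal.ofReal_prod_of_nonneg fun _ _ => norm_nonneg _]
  exact (Finset.prod_le_prod' fun i _ => ENNReal.ofReal_le_ofReal (h i)).trans_eq (by simp)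

theorem le_enorm_angularFourier_cube {s : Set ℝ} {x : EuclideanSpace ℝ (Fin d)} {c : ℝ}
    (h : ∀ i, c ≤ ‖∫ u in s, Complex.exp (-(Complex.I * ((x i * u : ℝ) : ℂ)))‖) :
    ENNReal.ofReal c ^ d ≤ ‖angularFourier (volume.restrict (cube d s)) (fun _ => 1) x‖ₑ := by
  rw [angularFourier_cube, ← ofReal_norm, norm_prod,
    ENNReal.ofReal_prod_of_nonneg fun _ _ => norm_nonneg _]
  exact le_of_eq_of_le (by simp) (Finset.prod_le_prod' fun i _ => ENNReal.ofReal_le_ofReal (h i))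

theorem enorm_angularFourier_dyadicCube_le (k : ℤ) (x : EuclideanSpace ℝ (Fin d)) :
    ‖angularFourier (volume.restrict (dyadicCube d k)) (fun _ => 1) x‖ₑ
      ≤ 2 ^ (-((d * k : ℤ) : ℝ)) := by
  refine (enorm_angularFourier_cube_le fun i =>
    norm_setIntegral_exp_le (by linarith [show (0 : ℝ) < 2 ^ (-k) by positivity]) (x i)).trans_eq ?_
  rw [two_mul, add_sub_cancel_right, ofReal_two_zpow_pow]
  push_cast
  rw [mul_neg]

theorem enorm_angularFourier_dyadicCube_le_of_mem (k : ℤ) {j : ℤ} {x : EuclideanSpace ℝ (Fin d)}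
    (hx : x ∈ frequencyBox d j) :
    ‖angularFourier (volume.restrict (dyadicCube d k)) (fun _ => 1) x‖ₑ
      ≤ 2 ^ (d : ℝ) * 2 ^ (-((d * j : ℤ) : ℝ)) := by
  have hpow : (0 : ℝ) < 2 ^ j := by positivity
  refine (enorm_angularFourier_cube_le (c := 2 ^ (1 - j)) fun i => ?_).trans_eq ?_
  · have hxi : 0 < x i := hpow.trans_le (hx i).1
    refine (norm_setIntegral_exp_le_two_div
      (by linarith [show (0 : ℝ) < 2 ^ (-k) by positivity]) hxi.ne').trans ?_
    rw [abs_of_pos hxi, zpow_sub₀ two_ne_zero, zpow_one]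
    exact div_le_div_of_nonneg_left two_pos.le hpow (hx i).1
  · rw [ofReal_two_zpow_pow, ← two_rpow_add]
    push_cast
    ring_nf

theorem le_enorm_angularFourier_dyadicCube {k : ℤ} {x : EuclideanSpace ℝ (Fin d)}
    (hx : x ∈ frequencyBox d k) :
    2 ^ (-(d : ℝ)) * 2 ^ (-((d * k : ℤ) : ℝ))
      ≤ ‖angularFourier (volume.restrict (dyadicCube d k)) (fun _ => 1) x‖ₑ := by
  have hpow : (0 : ℝ) < 2 ^ k := by positivity
  refine le_of_eq_of_le ?_ (le_enorm_angularFourier_cube (c := 2 ^ (-k - 1)) fun i => ?_)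
  · rw [ofReal_two_zpow_pow, ← two_rpow_add]
    push_cast
    ring_nf
  · have hxi : 0 < x i := hpow.trans_le (hx i).1
    rw [zpow_sub₀ two_ne_zero, zpow_one, zpow_neg]
    refine le_of_eq_of_le ?_ (half_le_norm_setIntegral_exp
      (by linarith [inv_pos.2 hpow]) ?_)
    · ring
    · rw [two_mul, add_sub_cancel_right, abs_of_pos hxi, ← div_eq_mul_inv, div_le_iff₀ hpow]
      exact (hx i).2

end DyadicCube

/-! ## Fourier integrals of lacunary step functions -/

section StepFourier

variable {V ι : Type*} [NormedAddCommGroup V] [InnerProductSpace ℝ V] [MeasurableSpace V]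
  [OpensMeasurableSpace V] {μ : Measure V} {A : ι → Set V} {a : ι → ℂ} {f : V → ℂ}

theorem IsStepOn.hasSum_angularFourier [Countable ι] (hf : IsStepOn μ A a f)
    (hA : ∀ n, MeasurableSet (A n)) (hd : Pairwise (Function.onFun Disjoint A))
    (hfi : Integrable f μ) (x : V) :
    HasSum (fun n => a n * angularFourier (μ.restrict (A n)) (fun _ => 1) x)
      (angularFourier μ f x) := by
  have hint : Integrable (fun t => f t * Complex.exp (-(Complex.I * (inner ℝ x t : ℝ)))) μ :=
    hfi.mul_bdd (c := 1) (Continuous.aestronglyMeasurable (by fun_prop))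
      (ae_of_all _ fun t => (norm_exp_neg_I_mul_ofReal _).le)
  have hterm (n : ι) : ∫ t in A n, f t * Complex.exp (-(Complex.I * (inner ℝ x t : ℝ))) ∂μ
      = a n * angularFourier (μ.restrict (A n)) (fun _ => 1) x := by
    rw [angularFourier_apply, ← integral_const_mul]
    refine setIntegral_congr_ae (hA n) ?_
    filter_upwards [hf] with t ht htn
    rw [ht.1 n htn, one_mul]
  have hsum := hasSum_integral_iUnion hA hd hint.integrableOn
  simp_rw [hterm] at hsum
  rwa [setIntegral_eq_integral_of_ae_compl_eq_zero, ← angularFourier_apply] at hsum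
  filter_upwards [hf] with t ht htA
  rw [ht.2 fun n hn => htA (Set.mem_iUnion.2 ⟨n, hn⟩), zero_mul]

theorem enorm_le_add_tsum_enorm_ite_of_hasSum [DecidableEq ι] {u : ι → ℂ} {z : ℂ} (h : HasSum u z)
    (n : ι) : ‖u n‖ₑ ≤ ‖z‖ₑ + ∑' m, if m = n then 0 else ‖u m‖ₑ := by
  have hsplit := h.summable.tsum_eq_add_tsum_ite n
  rw [h.tsum_eq] at hsplit
  calc ‖u n‖ₑ = ‖z - ∑' m, if m = n then 0 else u m‖ₑ := by rw [hsplit, add_sub_cancel_right]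
    _ ≤ ‖z‖ₑ + ∑' m, ‖if m = n then 0 else u m‖ₑ :=
        enorm_sub_le.trans (add_le_add le_rfl enorm_tsum_le_tsum_enorm)
    _ = _ := by simp only [apply_ite enorm, enorm_zero]

end StepFourier

section Domination

variable {ι : Type*} {d : ℕ} {p p' q : ℝ}

/-- With `l_n = dn` the logarithmic measure of the cubes, the two upper bounds for the Fourier
integral of the `k`-th cube combine to `2^{d - max(l_j, l_k)}` on the `j`-th box. -/
theorem two_rpow_mul_enorm_angularFourier_dyadicCube_le (hpp : p.HolderConjugate p') (hp2 : p < 2)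
    {j : ℤ} {x : EuclideanSpace ℝ (Fin d)} (hx : x ∈ frequencyBox d j) (k : ℤ) :
    2 ^ (((d * j : ℤ) : ℝ) / p')
        * ‖angularFourier (volume.restrict (dyadicCube d k)) (fun _ => 1) x‖ₑ
      ≤ 2 ^ (d : ℝ) * (2 ^ (-(1 / p' * |((d * j : ℤ) : ℝ) - (d * k : ℤ)|))
          * 2 ^ (-((d * k : ℤ) : ℝ) / p)) := by
  set u : ℝ := ((d * j : ℤ) : ℝ)
  set v : ℝ := ((d * k : ℤ) : ℝ)
  have hconj := hpp.one_div_add_one_div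
  have hp : 1 / 2 < 1 / p := one_div_lt_one_div_of_lt hpp.pos hp2
  have : (0 : ℝ) ≤ d := d.cast_nonneg
  rw [div_eq_mul_one_div u, div_eq_mul_one_div (-v)]
  rw [show 1 / p' = 1 - 1 / p by linarith]
  rcases le_total u v with huv | huv
  · refine (mul_le_mul_right (enorm_angularFourier_dyadicCube_le k x) _).trans ?_
    rw [← two_rpow_add, ← two_rpow_add, ← two_rpow_add, abs_of_nonpos (by linarith)]
    exact two_rpow_le (by linarith)
  · refine (mul_le_mul_right (enorm_angularFourier_dyadicCube_le_of_mem k hx) _).trans ?_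
    rw [← two_rpow_add, ← two_rpow_add, ← two_rpow_add, ← two_rpow_add,
      abs_of_nonneg (by linarith)]
    exact two_rpow_le (by nlinarith)

theorem IsStepOn.two_rpow_mul_enorm_le [DecidableEq ι] (hd : 0 < d)
    (hpp : p.HolderConjugate p') (hp2 : p < 2) {μ : Measure (EuclideanSpace ℝ (Fin d))}
    {k : ι → ℤ} (hk : Function.Injective k)
    (hμ : ∀ n, μ.restrict (dyadicCube d (k n)) = volume.restrict (dyadicCube d (k n)))
    {a : ι → ℂ} {f : EuclideanSpace ℝ (Fin d) → ℂ}
    (hf : IsStepOn μ (fun n => dyadicCube d (k n)) a f) (hfi : Integrable f μ) {n : ι}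
    {x : EuclideanSpace ℝ (Fin d)} (hx : x ∈ frequencyBox d (k n)) :
    2 ^ (-((d * k n : ℤ) : ℝ) / p) * ‖a n‖ₑ
      ≤ 2 ^ (d : ℝ) * (2 ^ (((d * k n : ℤ) : ℝ) / p') * ‖angularFourier μ f x‖ₑ)
        + 2 ^ (d : ℝ) * 2 ^ (d : ℝ) * ∑' m, if m = n then 0 else
          2 ^ (-(1 / p' * |((d * k n : ℤ) : ℝ) - (d * k m : ℤ)|))
            * (2 ^ (-((d * k m : ℤ) : ℝ) / p) * ‖a m‖ₑ) := by
  have := hk.countable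
  set l : ι → ℤ := fun n => d * k n
  let K (m : ι) : ℂ := angularFourier (volume.restrict (dyadicCube d (k m))) (fun _ => 1) x
  have hsum := hf.hasSum_angularFourier (fun n => measurableSet_dyadicCube d (k n))
    (fun m n hmn => pairwise_disjoint_dyadicCube hd (hk.ne hmn)) hfi x
  simp only [hμ] at hsum
  have hweight : (2 : ℝ≥0∞) ^ (-(l n : ℝ) / p)
      = 2 ^ (d : ℝ) * (2 ^ ((l n : ℝ) / p') * (2 ^ (-(d : ℝ)) * 2 ^ (-(l n : ℝ)))) := by
    rw [← two_rpow_add, ← two_rpow_add, ← two_rpow_add]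
    congr 1
    linear_combination (-(l n : ℝ)) * hpp.one_div_add_one_div
  calc 2 ^ (-(l n : ℝ) / p) * ‖a n‖ₑ
      ≤ 2 ^ (d : ℝ) * (2 ^ ((l n : ℝ) / p') * ‖a n * K n‖ₑ) := by
        rw [hweight, mul_assoc, mul_assoc, mul_comm _ ‖a n‖ₑ, enorm_mul]
        gcongr
        exact le_enorm_angularFourier_dyadicCube hx
    _ ≤ 2 ^ (d : ℝ) * (2 ^ ((l n : ℝ) / p') * (‖angularFourier μ f x‖ₑ
          + ∑' m, if m = n then 0 else ‖a m * K m‖ₑ)) :=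
        mul_le_mul_right (mul_le_mul_right (enorm_le_add_tsum_enorm_ite_of_hasSum hsum n) _) _
    _ ≤ _ := by
        rw [mul_add, mul_add, mul_assoc _ _ (∑' m, _)]
        refine add_le_add le_rfl (mul_le_mul_right ?_ _)
        rw [← ENNReal.tsum_mul_left, ← ENNReal.tsum_mul_left]
        refine ENNReal.tsum_le_tsum fun m => ?_
        split_ifs
        · simp only [mul_zero, le_rfl]
        · rw [enorm_mul, mul_left_comm, mul_comm ‖a m‖ₑ, ← mul_assoc _ _ ‖a m‖ₑ,
            ← mul_assoc _ _ ‖a m‖ₑ]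
          exact mul_le_mul' (two_rpow_mul_enorm_angularFourier_dyadicCube_le hpp hp2 hx (k m))
            le_rfl

end Domination

/-! ## Lower bounds for the Fourier transform of lacunary step functions -/

section LowerBound

variable {ι β : Type*} [MeasurableSpace β] {ν : Measure β} {d : ℕ} {p p' q : ℝ}
  {μ : Measure (EuclideanSpace ℝ (Fin d))} {k : ι → ℤ} {χ : β → EuclideanSpace ℝ (Fin d)}
  {a : ι → ℂ} {f : EuclideanSpace ℝ (Fin d) → ℂ} {G : β → ℂ}

/-- The box of frequencies has measure greater than `2^{l_n - 1}`, so that it contains a point at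
which the Fourier transform is at most its rearrangement at `2^{l_n - 1}`. -/
theorem IsStepOn.two_rpow_mul_enorm_le_rearrangement [DecidableEq ι] (hd : 0 < d)
    (hpp : p.HolderConjugate p') (hp2 : p < 2) (hk : Function.Injective k)
    (hμ : ∀ n, μ.restrict (dyadicCube d (k n)) = volume.restrict (dyadicCube d (k n)))
    (hf : IsStepOn μ (fun n => dyadicCube d (k n)) a f) (hfi : Integrable f μ)
    (hG : G =ᵐ[ν] angularFourier μ f ∘ χ) {n : ι}
    (hχ : 2 ^ ((d * k n : ℤ) : ℝ) ≤ ν (χ ⁻¹' frequencyBox d (k n))) :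
    2 ^ (-((d * k n : ℤ) : ℝ) / p) * ‖a n‖ₑ
      ≤ 2 ^ (d : ℝ) * (2 ^ (((d * k n : ℤ) : ℝ) / p')
          * rearrangement ν G (2 ^ ((d * k n - 1 : ℤ) : ℝ)))
        + 2 ^ (d : ℝ) * 2 ^ (d : ℝ) * ∑' m, if m = n then 0 else
          2 ^ (-(1 / p' * |((d * k n : ℤ) : ℝ) - (d * k m : ℤ)|))
            * (2 ^ (-((d * k m : ℤ) : ℝ) / p) * ‖a m‖ₑ) := by
  obtain ⟨x, hx, hGx, hle⟩ := exists_mem_enorm_le_rearrangement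
    ((two_rpow_lt (x := ((d * k n - 1 : ℤ) : ℝ)) (by push_cast; linarith)).trans_le hχ) hG G
  rw [hGx, Function.comp_apply] at hle
  refine (hf.two_rpow_mul_enorm_le hd hpp hp2 hk hμ hfi hx).trans (add_le_add ?_ le_rfl)
  exact mul_le_mul_right (mul_le_mul_right hle _) _

theorem exists_eLorentzNorm_le_of_isStepOn_dyadicCube (ι : Type*) (hd : 0 < d)
    (hpp : p.HolderConjugate p') (hp2 : p < 2) (hq : 0 < q) :
    ∃ (N : ℕ) (C : ℝ≥0∞), C ≠ ∞ ∧ ∀ {k : ι → ℤ},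
      (∀ n m, n ≠ m → (N : ℤ) < |d * k n - d * k m|) →
      (∀ n, μ.restrict (dyadicCube d (k n)) = volume.restrict (dyadicCube d (k n))) →
      (∀ n, 2 ^ ((d * k n : ℤ) : ℝ) ≤ ν (χ ⁻¹' frequencyBox d (k n))) →
      ∀ {a : ι → ℂ} {f : EuclideanSpace ℝ (Fin d) → ℂ} {G : β → ℂ},
      IsStepOn μ (fun n => dyadicCube d (k n)) a f → Integrable f μ →
      eLorentzNorm μ p q f < ∞ → G =ᵐ[ν] angularFourier μ f ∘ χ →
      eLorentzNorm μ p q f ≤ C * eLorentzNorm ν p' q G := by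
  classical
  obtain ⟨N, hN⟩ := exists_separation_absorption ι (one_div_pos.2 hpp.symm.pos) hq
    (ENNReal.mul_ne_top (two_rpow_ne_top d) (two_rpow_ne_top d))
  set D : ℝ≥0∞ := 2 ^ (q / p) * ((1 - 2 ^ (-(q / p)))⁻¹ * (2 ^ (1 + q) * (2 ^ (d * q)
    * (2 ^ (1 / p' * q) * 2 ^ (1 + q / p'))))) with hD
  have hDtop : D ≠ ∞ := by
    have := one_sub_two_rpow_inv_ne_top (neg_neg_of_pos (div_pos hq hpp.pos))
    simp only [hD, ne_eq, ENNReal.mul_eq_top, two_rpow_ne_top, this, and_false, false_and,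
      or_self, not_false_eq_true]
  refine ⟨N, D ^ (1 / q), by finiteness, fun {k} hsep hμ hχ {a f G} hf hfi hfin hG =>
    le_mul_of_rpow_le_mul_rpow hq ?_⟩
  have hl : Function.Injective fun n => (d : ℤ) * k n := injective_of_forall_lt_abs_sub hsep
  have hk : Function.Injective k := fun n m h => hl (congrArg _ h)
  have hμA (n : ι) := measure_dyadicCube_of_restrict_eq (hμ n)
  have hαtop : ∑' n, (2 ^ (-((d * k n : ℤ) : ℝ) / p) * ‖a n‖ₑ) ^ q ≠ ∞ :=
    ((hf.le_dyadicSum hl (fun n => (hμA n).ge) hq).trans_lt (ENNReal.mul_lt_top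
      (two_rpow_ne_top _).lt_top (dyadicSum_rearrangement_lt_top hpp.pos hq hfin))).ne
  calc eLorentzNorm μ p q f ^ q
      ≤ 2 ^ (q / p) * ((1 - 2 ^ (-(q / p)))⁻¹
          * ∑' n, (2 ^ (-((d * k n : ℤ) : ℝ) / p) * ‖a n‖ₑ) ^ q) :=
        hf.eLorentzNorm_rpow_le hl (fun n => (hμA n).le) hpp.pos hq
    _ ≤ 2 ^ (q / p) * ((1 - 2 ^ (-(q / p)))⁻¹ * (2 ^ (1 + q) * ∑' n, (2 ^ (d : ℝ)
          * (2 ^ (((d * k n : ℤ) : ℝ) / p')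
            * rearrangement ν G (2 ^ ((d * k n - 1 : ℤ) : ℝ)))) ^ q)) :=
        mul_le_mul_right (mul_le_mul_right (hN hsep _ _ hαtop fun n =>
          hf.two_rpow_mul_enorm_le_rearrangement hd hpp hp2 hk hμ hfi hG (hχ n)) _) _
    _ ≤ 2 ^ (q / p) * ((1 - 2 ^ (-(q / p)))⁻¹ * (2 ^ (1 + q) * (2 ^ (d * q)
          * (2 ^ (1 / p' * q) * (2 ^ (1 + q / p') * eLorentzNorm ν p' q G ^ q))))) := by
        simp_rw [two_rpow_mul_rpow (d : ℝ) hq.le]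
        rw [ENNReal.tsum_mul_left]
        gcongr
        exact (tsum_half_rpow_le_dyadicSum hl p' hq _).trans
          (mul_le_mul_right (dyadicSum_le_eLorentzNorm_rpow hpp.symm.pos hq) _)
    _ = D * eLorentzNorm ν p' q G ^ q := by ring

end LowerBound

/-! ## Failure of strict singularity -/

section NotStrictlySingular

variable {𝕜 : Type*} [RCLike 𝕜] {d : ℕ} {p p' q : ℝ} {μ : Measure (EuclideanSpace ℝ (Fin d))}

theorem not_finiteDimensional_stepSubspace_dyadicCube {ι : Type*} [Infinite ι] (hd : 0 < d)
    (hp : 0 < p) (hq : 0 < q) {k : ι → ℤ} (hk : Function.Injective k)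
    (hμ : ∀ n, μ.restrict (dyadicCube d (k n)) = volume.restrict (dyadicCube d (k n))) :
    ¬ FiniteDimensional 𝕜 (stepSubspace 𝕜 μ p q fun n => dyadicCube d (k n)) := by
  classical
  have hμA (n : ι) := measure_dyadicCube_of_restrict_eq (hμ n)
  have hl : Function.Injective fun n => (d : ℤ) * k n :=
    (mul_right_injective₀ (by omega)).comp hk
  have hdisj : Pairwise (Function.onFun Disjoint fun n => dyadicCube d (k n)) :=
    (pairwise_disjoint_dyadicCube hd).comp_of_injective hk
  refine not_finiteDimensional_stepSubspace (fun n => measurableSet_dyadicCube d (k n)) hdisj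
    (fun n => ?_) fun n => ?_
  · rw [hμA n]
    exact two_rpow_ne_zero _
  · have hle := (isStepOn_indicator (μ := μ) hdisj n (1 : 𝕜)).eLorentzNorm_rpow_le hl
      (fun m => (hμA m).le) hp hq
    rw [tsum_eq_single n fun m hm => by
      rw [Pi.single_eq_of_ne hm, enorm_zero, mul_zero, ENNReal.zero_rpow_of_pos hq],
      Pi.single_eq_same, enorm_one, mul_one] at hle
    refine (ENNReal.rpow_lt_top_iff_of_pos hq).1 (hle.trans_lt ?_)
    have := one_sub_two_rpow_inv_ne_top (neg_neg_of_pos (div_pos hq hp))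
    exact (ENNReal.mul_ne_top (two_rpow_ne_top _) (ENNReal.mul_ne_top this
      (ENNReal.rpow_ne_top_of_nonneg hq.le (two_rpow_ne_top _)))).lt_top

theorem lt_abs_mul_sub_mul_of_ne {d : ℕ} (hd : 0 < d) (N n m : ℕ) (hnm : n ≠ m) :
    (N : ℤ) < |(d : ℤ) * ((N + 1) * n : ℕ) - d * ((N + 1) * m : ℕ)| := by
  have hd' : (1 : ℤ) ≤ d := by omega
  have hnm' : 1 ≤ |(n : ℤ) - m| := Int.one_le_abs (by omega)
  calc (N : ℤ) < N + 1 := lt_add_one _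
    _ ≤ d * (N + 1) := le_mul_of_one_le_left (by positivity) hd'
    _ ≤ d * (N + 1) * |(n : ℤ) - m| := le_mul_of_one_le_right (by positivity) hnm'
    _ = _ := by
        rw [← abs_of_nonneg (by positivity : (0 : ℤ) ≤ d * (N + 1)), ← abs_mul]
        congr 1
        push_cast
        ring

variable [NormedAlgebra 𝕜 ℂ]

theorem not_strictlySingular_of_ae_eq_angularFourier {β Y : Type*} [MeasurableSpace β]
    [AddCommGroup Y] [Module 𝕜 Y] [Norm Y] {ν : Measure β} {χ : β → EuclideanSpace ℝ (Fin d)}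
    (hd : 0 < d) (hpp : p.HolderConjugate p') (hp2 : p < 2) (hq : 0 < q)
    (hμ : μ.restrict (cube d (Set.Ioc 0 2)) = volume.restrict (cube d (Set.Ioc 0 2)))
    (hχ : ∀ k : ℕ, 2 ^ ((d * k : ℤ) : ℝ) ≤ ν (χ ⁻¹' frequencyBox d k))
    {T : lorentzSpace 𝕜 𝕜 μ p q →ₗ[𝕜] Y} {c : ℝ} (hc : 0 ≤ c)
    (hT : ∀ f : lorentzSpace 𝕜 𝕜 μ p q, Integrable f.1 μ → ∃ g : β → ℂ,
      g =ᵐ[ν] angularFourier μ (complexify f.1) ∘ χ ∧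
        eLorentzNorm ν p' q g < ∞ ∧ (eLorentzNorm ν p' q g).toReal ≤ c * ‖T f‖) :
    ¬ StrictlySingular T := by
  obtain ⟨N, C, hC, hbound⟩ :=
    exists_eLorentzNorm_le_of_isStepOn_dyadicCube (μ := μ) (ν := ν) (χ := χ) ℕ hd hpp hp2 hq
  let k (n : ℕ) : ℤ := ((N + 1) * n : ℕ)
  have hk : Function.Injective k := Nat.cast_injective.comp (mul_right_injective₀ N.succ_ne_zero)
  have hsub (n : ℕ) : dyadicCube d (k n) ⊆ cube d (Set.Ioc 0 2) :=
    dyadicCube_subset_cube (Int.natCast_nonneg _)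
  have hμk (n : ℕ) : μ.restrict (dyadicCube d (k n)) = volume.restrict (dyadicCube d (k n)) := by
    rw [← Measure.restrict_restrict_of_subset (hsub n), hμ,
      Measure.restrict_restrict_of_subset (hsub n)]
  have hμU : μ (cube d (Set.Ioc 0 2)) ≠ ∞ := by
    rw [← Measure.restrict_apply_self, hμ, Measure.restrict_apply_self,
      volume_cube measurableSet_Ioc, Real.volume_Ioc]
    finiteness
  refine not_strictlySingular_of_le (c := C.toReal * c)
    (not_finiteDimensional_stepSubspace_dyadicCube hd hpp.pos hq hk hμk)
    (isClosedSubspace_stepSubspace hpp.pos hq _) (by positivity) ?_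
  rintro f ⟨a, ha⟩
  have hfi : Integrable f.1 μ :=
    ha.integrable hpp hp2 hq f.1.stronglyMeasurable (f.2 hq) hsub hμU
  obtain ⟨g, hg, hgfin, hgT⟩ := hT f hfi
  have hle := hbound (lt_abs_mul_sub_mul_of_ne hd N) hμk (fun n => hχ ((N + 1) * n)) ha.complexify
    (integrable_complexify hfi) ((eLorentzNorm_complexify p q f.1).trans_lt (f.2 hq)) hg
  rw [eLorentzNorm_complexify] at hle
  calc ‖f‖ ≤ C.toReal * (eLorentzNorm ν p' q g).toReal :=
        toReal_le_toReal_mul_toReal hC hgfin.ne hle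
    _ ≤ C.toReal * (c * ‖T f‖) := mul_le_mul_of_nonneg_left hgT ENNReal.toReal_nonneg
    _ = C.toReal * c * ‖T f‖ := (mul_assoc _ _ _).symm

theorem IsFourierTransform.not_strictlySingular (hd : 0 < d) (hpp : p.HolderConjugate p')
    (hp2 : p < 2) (hq : 0 < q)
    {T : lorentzSpace 𝕜 𝕜 (volume : Measure (EuclideanSpace ℝ (Fin d))) p q →ₗ[𝕜]
      lorentzSpace 𝕜 ℂ (volume : Measure (EuclideanSpace ℝ (Fin d))) p' q}
    (hT : IsFourierTransform T) : ¬ StrictlySingular T := by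
  refine not_strictlySingular_of_ae_eq_angularFourier (ν := volume) (χ := id) hd hpp hp2 hq rfl
    (fun k => (volume_frequencyBox d k).ge) zero_le_one fun f hf => ⟨(T f).1, ?_, (T f).2 hq,
      (one_mul ‖T f‖).ge⟩
  filter_upwards [hT.2 f hf] with x hx
  rw [hx, Function.comp_apply, id_eq, angularFourier_complexify]

theorem le_count_latticePoint_preimage_frequencyBox (d k : ℕ) :
    2 ^ ((d * k : ℤ) : ℝ) ≤ Measure.count (latticePoint (d := d) ⁻¹' frequencyBox d k) := by
  set M : ℤ := 2 ^ k with hM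
  have hMr : ((M : ℤ) : ℝ) = 2 ^ (k : ℤ) := by rw [hM, zpow_natCast]; push_cast; rfl
  have hsub : ((Fintype.piFinset fun _ : Fin d => Finset.Ioc M (2 * M) : Finset (Fin d → ℤ)) :
      Set (Fin d → ℤ)) ⊆ latticePoint ⁻¹' frequencyBox d k := by
    intro m hm i
    obtain ⟨hlo, hhi⟩ := Finset.mem_Ioc.1 (Fintype.mem_piFinset.1 (Finset.mem_coe.1 hm) i)
    rw [← hMr]
    exact ⟨Int.cast_le.2 hlo.le, (Int.cast_le.2 hhi).trans_eq (Int.cast_mul 2 M)⟩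
  have hcard : (2 * M - M).toNat = 2 ^ k := by
    rw [two_mul, add_sub_cancel_right, hM]
    exact_mod_cast Int.toNat_natCast (2 ^ k)
  calc (2 : ℝ≥0∞) ^ ((d * k : ℤ) : ℝ) = ((2 ^ k) ^ d : ℕ) := by
        rw [← pow_mul, mul_comm k]
        push_cast
        rw [← ENNReal.rpow_natCast]
        push_cast
        rfl
    _ = Measure.count ((Fintype.piFinset fun _ : Fin d => Finset.Ioc M (2 * M) :
          Finset (Fin d → ℤ)) : Set (Fin d → ℤ)) := by
        rw [Measure.count_apply_finset, Fintype.card_piFinset_const, Int.card_Ioc, hcard]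
    _ ≤ _ := measure_mono hsub

theorem IsDiscreteFourierTransform.not_strictlySingular (hd : 0 < d) (hpp : p.HolderConjugate p')
    (hp2 : p < 2) (hq : 0 < q)
    {T : lorentzSpace 𝕜 𝕜 (torusMeasure d) p q →ₗ[𝕜] lorentzSeqSpace 𝕜 (Fin d → ℤ) ℂ p' q}
    (hT : IsDiscreteFourierTransform T) : ¬ StrictlySingular T := by
  obtain ⟨C, hC, hle⟩ := exists_eLorentzNorm_count_le_eLorentzSeqNorm (ι := Fin d → ℤ) (F := ℂ)
    hpp.symm.pos hq
  have hμ : (torusMeasure d).restrict (cube d (Set.Ioc 0 2))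
      = volume.restrict (cube d (Set.Ioc 0 2)) := by
    rw [torusMeasure_eq, Measure.restrict_restrict_of_subset]
    exact fun t ht i => ⟨by linarith [(ht i).1, Real.pi_pos], (ht i).2.trans Real.two_le_pi⟩
  refine not_strictlySingular_of_ae_eq_angularFourier (ν := Measure.count) (χ := latticePoint)
    hd hpp hp2 hq hμ (le_count_latticePoint_preimage_frequencyBox d) ENNReal.toReal_nonneg
    fun f _ => ⟨(T f).1, ae_of_all _ fun m => ?_,
      (hle _).trans_lt (ENNReal.mul_lt_top hC.lt_top ((T f).2 hq)),
      toReal_le_toReal_mul_toReal hC ((T f).2 hq).ne (hle _)⟩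
  rw [hT.2 f m, Function.comp_apply, angularFourier_complexify]
  simp only [inner_latticePoint]

end NotStrictlySingular

theorem theorem6p1_general (𝕜 : Type*) [RCLike 𝕜] [NormedAlgebra 𝕜 ℂ] (d : ℕ) (hd : 0 < d)
    (p q p' : ℝ) (hp1 : 1 < p) (hp2 : p < 2) (hpp' : 1 / p + 1 / p' = 1) (hq : 0 < q) :
    ((∃ T : lorentzSpace 𝕜 𝕜 (volume : Measure (EuclideanSpace ℝ (Fin d))) p q →ₗ[𝕜]
          lorentzSpace 𝕜 ℂ (volume : Measure (EuclideanSpace ℝ (Fin d))) p' q,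
        IsFourierTransform T) ∧
      ∀ T : lorentzSpace 𝕜 𝕜 (volume : Measure (EuclideanSpace ℝ (Fin d))) p q →ₗ[𝕜]
          lorentzSpace 𝕜 ℂ (volume : Measure (EuclideanSpace ℝ (Fin d))) p' q,
        IsFourierTransform T → ¬ StrictlySingular T) ∧
    ((∃ T : lorentzSpace 𝕜 𝕜 (torusMeasure d) p q →ₗ[𝕜] lorentzSeqSpace 𝕜 (Fin d → ℤ) ℂ p' q,
        IsDiscreteFourierTransform T) ∧
      ∀ T : lorentzSpace 𝕜 𝕜 (torusMeasure d) p q →ₗ[𝕜] lorentzSeqSpace 𝕜 (Fin d → ℤ) ℂ p' q,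
        IsDiscreteFourierTransform T → ¬ StrictlySingular T) := by
  have hpp : p.HolderConjugate p' :=
    Real.holderConjugate_iff.2 ⟨hp1, by simpa only [one_div] using hpp'⟩
  exact ⟨⟨exists_isFourierTransform 𝕜 d hpp hp2 hq,
      fun _ hT => hT.not_strictlySingular hd hpp hp2 hq⟩,
    exists_isDiscreteFourierTransform 𝕜 d hpp hp2 hq,
    fun _ hT => hT.not_strictlySingular hd hpp hp2 hq⟩

theorem theorem6p1 (𝕜 : Type*) [RCLike 𝕜] [NormedAlgebra 𝕜 ℂ] (d : ℕ) (hd : 0 < d)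
    (p q p' : ℝ) (hp1 : 1 < p) (hp2 : p < 2) (hpp' : 1 / p + 1 / p' = 1) (hq : 1 < q) :
    ((∃ T : lorentzSpace 𝕜 𝕜 (volume : Measure (EuclideanSpace ℝ (Fin d))) p q →ₗ[𝕜]
          lorentzSpace 𝕜 ℂ (volume : Measure (EuclideanSpace ℝ (Fin d))) p' q,
        IsFourierTransform T) ∧
      ∀ T : lorentzSpace 𝕜 𝕜 (volume : Measure (EuclideanSpace ℝ (Fin d))) p q →ₗ[𝕜]
          lorentzSpace 𝕜 ℂ (volume : Measure (EuclideanSpace ℝ (Fin d))) p' q,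
        IsFourierTransform T → ¬ StrictlySingular T) ∧
    ((∃ T : lorentzSpace 𝕜 𝕜 (torusMeasure d) p q →ₗ[𝕜] lorentzSeqSpace 𝕜 (Fin d → ℤ) ℂ p' q,
        IsDiscreteFourierTransform T) ∧
      ∀ T : lorentzSpace 𝕜 𝕜 (torusMeasure d) p q →ₗ[𝕜] lorentzSeqSpace 𝕜 (Fin d → ℤ) ℂ p' q,
        IsDiscreteFourierTransform T → ¬ StrictlySingular T) :=
  theorem6p1_general 𝕜 d hd p q p' hp1 hp2 hpp' (one_pos.trans hq)
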